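/- Let $F/\mathbf F_q$ be an algebraic function field of one variable of genus $g$, and let $Q,P_1,\dots,P_n$ be distinct places of degree one; put $D=P_1+\dots+P_n$, $\mathcal L(\infty Q)=\bigcup_{i}\mathcal L(iQ)$ and, for a divisor $G$, $\mathcal L(-G+\infty Q)=\bigcup_i\mathcal L(-G+iQ)$. Let the Weierstrass semigroup $H(Q)$ be generated by positive integers $a_1,\dots,a_t$ ($t\ge 1$) and let $x_1,\dots,x_t\in F$ have pole divisors $(x_i)_\infty=a_iQ$. For $0\le j<a_1$ let $b_j=\min\{s\in H(Q): s\equiv j \pmod{a_1}\}$, and let $y_j=x_1^{e_1}\cdots x_t^{e_t}$, where $(e_1,\dots,e_t)\in\mathbf N_0^t$ is, among the vectors with $\sum_i a_ie_i=b_j$, the one that is lexicographically largest (then $e_1=0$). Thus $y_0,\dots,y_{a_1-1}$ is a basis of $\mathcal L(\infty Q)$ over $\mathbf F_q[x_1]$. Assume that there is $f\in\mathcal L(\infty Q)$ with zero divisor $(f)_0=D$, and that $f\in\mathbf F_q[x_1]$. Let $u\ge 0$ and $0\le m\le \ell$ be integers, let $\vec r\in\mathbf F_q^n$, and let $h\in\mathcal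 L(\infty Q)$ satisfy $h(P_i)=r_i$ for all $i$ and $-v_Q(h)\le n+2g-1$. Let $I_{\vec r,m,\ell}$ be the set of all $A(Z)\in\mathcal L(\infty Q)[Z]$ with $\deg_Z A\le \ell$ that have multiplicity (at least) $m$ at every $(P_i,r_i)$, i.e. if $A(Z+r_i)=\sum_k c_kZ^k$ then $v_{P_i}(c_k)\ge m-k$ for all $k$. Put $\eta_{i,j}=f^iy_j$ and $N=a_1(\ell+1)$. Identify $\{A\in \mathcal L(\infty Q)[Z]:\deg_ZA\le \ell\}$ with $\mathbf F_q[x_1]^{N}$ through the basis $\mathbf e_{1+j+ka_1}=y_jZ^k$ ($0\le j<a_1$, $0\le k\le \ell$), and order the monomials $x_1^i\mathbf e_{1+j+ka_1}=x_1^iy_jZ^k$ by the weight $-i\,v_Q(x_1)-v_Q(y_j)+ku$, ties being broken by the index of the basis vector (the larger index is the larger monomial). Let $$g_{1+j+ka_1}=\begin{cases}(Z-h)^{k}\,\eta_{m-k,j}, & 0\le k\le m,\\ Z^{k-m}(Z-h)^m\,\eta_{0,j}, & m<k\le \ell.\end{cases}$$ *Algorithm G* (Lee–O'Sullivan). Its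 input is a list $g_1,\dots,g_N\in\mathbf F_q[x_1]^N$, $g_s=(g_{s1},\dots,g_{sN})$, such that the last nonzero coordinate of $g_s$ is the $s$-th one for every $s$. For $r=1,\dots,N$ in turn, repeat the following until the leading term of $g_r$ lies in coordinate $r$: let $s$ be the coordinate in which the leading term of $g_r$ lies, $d=\deg g_{rs}-\deg g_{ss}$ and $c=\mathrm{lc}(g_{rs})\,\mathrm{lc}(g_{ss})^{-1}$; if $d\ge 0$ replace $g_r$ by $g_r-c\,x_1^{d}g_s$; if $d<0$ replace simultaneously $g_s$ by $g_r$ and $g_r$ by $x_1^{-d}g_r-c\,g_s$. The output is the final list $g_1,\dots,g_N$. Multiplications are counted in $\mathbf F_q$: one for each computation of $c$, and $\deg p+1$ for each multiplication of a nonzero coordinate $p$ of $g_s$ by $c$. Proposition. For $0\le i\le m$ and $0\le j<a_1$, the element $\eta_{i,j}$ has the least pole order at $Q$ among the nonzero elements of $\mathcal L(-iD+\infty Q)$ whose pole order at $Q$ is congruent to $j$ modulo $a_1$. The elements $g_1,\dots,g_N$ have unique coordinate vectors in $\mathbf F_q[x_1]^N$, and the last nonzero coordinate of $g_s$ is the $s$-th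 one. Algorithm G, run on them with the above order, terminates, its output is a minimal Gröbner basis (up to scaling its elements by nonzero constants) of $I_{\vec r,m,\ell}$ as an $\mathbf F_q[x_1]$-module, and it uses at most $$\Bigl[\max_{0\le j<a_1}\{-v_Q(y_j)\}+m(n+2g-1)+u(\ell-m)\Bigr]^2a_1^{-1}\sum_{i=1}^{a_1(\ell+1)}i^2$$ multiplications. -/

import Mathlib

open Polynomial IntermediateField

noncomputable section

namespace AGInterp

section Curves

variable {K F : Type*} [Field K] [Field F] [Algebra K F]

/-- `F / K` is an algebraic function field of one variable: a finite extension of `K(x)` for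
some `x` transcendental over `K`. -/
def IsFunctionField (K F : Type*) [Field K] [Field F] [Algebra K F] : Prop :=
  ∃ x : F, Transcendental K x ∧ FiniteDimensional K⟮x⟯ F

/-- A place of `F / K`, given by its normalized discrete valuation. -/
@[ext] structure Place (K F : Type*) [Field K] [Field F] [Algebra K F] where
  /-- the valuation `v_P`, with `v_P 0 = ⊤` -/
  val : AddValuation F (WithTop ℤ)
  /-- `v_P` is trivial on the nonzero constants -/
  val_const : ∀ c : K, c ≠ 0 → val (algebraMap K F c) = 0
  /-- `v_P` is normalized: its value group is `ℤ` -/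
  normalized : ∃ x : F, val x = ((1 : ℤ) : WithTop ℤ)

namespace Place

theorem val_const_nonneg (P : Place K F) (c : K) : 0 ≤ P.val (algebraMap K F c) := by
  by_cases h : c = 0
  · simp [h]
  · rw [P.val_const c h]

/-- The valuation ring of `P`, as a `K`-linear subspace of `F`. -/
def valRing (P : Place K F) : Submodule K F where
  carrier := {x | 0 ≤ P.val x}
  zero_mem' := by simp
  add_mem' := fun {x y} hx hy => le_trans (le_min hx hy) (P.val.map_add x y)
  smul_mem' := fun c x hx => by
    simp only [Set.mem_ofPred_eq, Algebra.smul_def, AddValuation.map_mul] at *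
    exact add_nonneg (P.val_const_nonneg c) hx

/-- The maximal ideal of the valuation ring of `P`, as a `K`-linear subspace of `F`. -/
def maxIdeal (P : Place K F) : Submodule K F where
  carrier := {x | 0 < P.val x}
  zero_mem' := by simp
  add_mem' := fun {x y} hx hy => lt_of_lt_of_le (lt_min hx hy) (P.val.map_add x y)
  smul_mem' := fun c x hx => by
    simp only [Set.mem_ofPred_eq, Algebra.smul_def, AddValuation.map_mul] at *
    exact lt_of_lt_of_le hx (le_add_of_nonneg_left (P.val_const_nonneg c))

/-- The degree of `P`: the `K`-dimension of its residue field. -/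
def degree (P : Place K F) : ℕ :=
  Module.finrank K (P.valRing ⧸ P.maxIdeal.submoduleOf P.valRing)

end Place

/-- The group of divisors. -/
abbrev Divisor (K F : Type*) [Field K] [Field F] [Algebra K F] : Type _ := Place K F →₀ ℤ

/-- The degree of a divisor. -/
def divDegree (A : Divisor K F) : ℤ := A.sum fun P c => c * (P.degree : ℤ)

/-- The Riemann–Roch space `L(A)`. -/
def rrSpace (A : Divisor K F) : Submodule K F where
  carrier := {x | ∀ P : Place K F, ((-(A P) : ℤ) : WithTop ℤ) ≤ P.val x}
  zero_mem' := fun P => by simp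
  add_mem' := fun {x y} hx hy P => le_trans (le_min (hx P) (hy P)) (P.val.map_add x y)
  smul_mem' := fun c x hx P => by
    rw [Algebra.smul_def, AddValuation.map_mul]
    exact le_trans (hx P) (le_add_of_nonneg_left (P.val_const_nonneg c))

/-- The genus: the supremum of `deg A - dim L(A) + 1` over all divisors `A`. Truncating negative
values at `0` is harmless, because `A = 0` contributes the value `0` when `K` is the full constant
field, as it is as soon as there is a place of degree one. -/
def genus (K F : Type*) [Field K] [Field F] [Algebra K F] : ℕ∞ :=
  ⨆ A : Divisor K F,
    (((divDegree A - (Module.finrank K (rrSpace A) : ℤ) + 1).toNat : ℕ) : ℕ∞)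

/-- `L(G + ∞Q)`, the union of the spaces `L(G + iQ)`. -/
def poleSpace (G : Divisor K F) (Q : Place K F) : Set F :=
  ⋃ i : ℕ, (rrSpace (G + Finsupp.single Q (i : ℤ)) : Set F)

/-- `L(∞Q)`. -/
def regularAway (Q : Place K F) : Set F := poleSpace 0 Q

/-- The pole order `-v_Q(x)` of a nonzero `x`. -/
def poleOrder (Q : Place K F) (x : F) : ℤ := -((Q.val x).untopD 0)

/-- The pole divisor of `x` is `A`. -/
def HasPoleDivisor (x : F) (A : Divisor K F) : Prop :=
  ∀ P : Place K F, min (P.val x) 0 = ((-(A P) : ℤ) : WithTop ℤ)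

/-- The zero divisor of `x` is `A`. -/
def HasZeroDivisor (x : F) (A : Divisor K F) : Prop :=
  ∀ P : Place K F, max (P.val x) 0 = ((A P : ℤ) : WithTop ℤ)

/-- The Weierstrass semigroup `H(Q)`: the pole orders of the nonzero elements of `L(∞Q)`. -/
def weierstrass (Q : Place K F) : Set ℕ :=
  {s | ∃ x ∈ regularAway Q, Q.val x = ((-(s : ℤ) : ℤ) : WithTop ℤ)}

/-- The weighted degree of an exponent vector. -/
def wdeg {t : ℕ} (a : Fin t → ℕ) (e : Fin t → ℕ) : ℕ := ∑ i, a i * e i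

/-- `e ≺ e'`: smaller weighted degree, or the same one and at the first index where they differ
the entry of `e` is the larger one. -/
def MonPrec {t : ℕ} (a : Fin t → ℕ) (e e' : Fin t → ℕ) : Prop :=
  wdeg a e < wdeg a e' ∨
    (wdeg a e = wdeg a e' ∧ ∃ i, (∀ j, j < i → e j = e' j) ∧ e' i < e i)

/-- `e` is the `≺`-minimum among the exponent vectors of weighted degree `s`. -/
def IsMinExponent {t : ℕ} (a : Fin t → ℕ) (s : ℕ) (e : Fin t → ℕ) : Prop :=
  wdeg a e = s ∧ ∀ e', wdeg a e' = s → e' = e ∨ MonPrec a e e'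

open Classical in
/-- The `≺`-minimal exponent vector of weighted degree `s` (`0` if there is none). -/
def minExponent {t : ℕ} (a : Fin t → ℕ) (s : ℕ) : Fin t → ℕ :=
  if h : ∃ e, IsMinExponent a s e then h.choose else 0

/-- `b_j`, the least element of `H(Q)` that is congruent to `j` modulo `a₁`. -/
def residueMin (Q : Place K F) (a₁ j : ℕ) : ℕ := sInf {s | s ∈ weierstrass Q ∧ s ≡ j [MOD a₁]}

/-- The module basis element `y_j` of `L(∞Q)` over `K[x₁]`; here `a₁ = a 0` and `x₁ = x 0`. -/
def basisElt (Q : Place K F) {t : ℕ} (a : Fin (t + 1) → ℕ) (x : Fin (t + 1) → F) (j : ℕ) : F :=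
  ∏ i, x i ^ minExponent a (residueMin Q (a 0) j) i

/-- `η` is an element of `L(G + ∞Q)` whose pole order at `Q` is the least one among the nonzero
elements of `L(G + ∞Q)` with pole order congruent to `j` modulo `a₁`. -/
def IsMinPole (G : Divisor K F) (Q : Place K F) (a₁ j : ℕ) (η : F) : Prop :=
  η ∈ poleSpace G Q ∧ η ≠ 0 ∧ poleOrder Q η ≡ j [ZMOD a₁] ∧
    ∀ ζ ∈ poleSpace G Q, ζ ≠ 0 → poleOrder Q ζ ≡ j [ZMOD a₁] → poleOrder Q η ≤ poleOrder Q ζ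

/-- `q(Z)` has multiplicity (at least) `m` at `(P, r)`: writing `q(Z + r) = ∑ c_t Z ^ t`, every
`c_t` vanishes at `P` to order at least `m - t`. -/
def HasMultiplicity (q : F[X]) (P : Place K F) (r : K) (m : ℕ) : Prop :=
  ∀ t : ℕ, (((m : ℤ) - (t : ℤ) : ℤ) : WithTop ℤ) ≤
    P.val ((q.comp (X + C (algebraMap K F r))).coeff t)

/-- `I_{r,m,ℓ}`: the polynomials in `L(∞Q)[Z]` of `Z`-degree at most `ℓ` that have multiplicity
`m` at all `(P_i, r_i)`. -/
def interpolationModule (Q : Place K F) {n : ℕ} (P : Fin n → Place K F) (r : Fin n → K)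
    (m ℓ : ℕ) : Set F[X] :=
  {q | q.natDegree ≤ ℓ ∧ (∀ t, q.coeff t ∈ regularAway Q) ∧
    ∀ i, HasMultiplicity q (P i) (r i) m}

/-- The generators of the interpolation module, in the order in which they are fed to the
algorithm: number `j + k a₁` (counting from zero) is `(Z - h) ^ k η_{m-k,j}` if `k ≤ m`, and
`Z ^ (k - m) (Z - h) ^ m η_{0,j}` if `k > m`. -/
def generator (a₁ m : ℕ) (η : ℕ → ℕ → F) (h : F) (r : ℕ) : F[X] :=
  if r / a₁ ≤ m then (X - C h) ^ (r / a₁) * C (η (m - r / a₁) (r % a₁))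
  else X ^ (r / a₁ - m) * (X - C h) ^ m * C (η 0 (r % a₁))

/-- The element of `L(∞Q)[Z]` with coordinate vector `p` with respect to the basis in which basis
element number `j + k a₁` (counting from zero) is `y_j Z ^ k`. -/
def ofCoords (a₁ : ℕ) (x₁ : F) (y : ℕ → F) {N : ℕ} (p : Fin N → K[X]) : F[X] :=
  ∑ r : Fin N, C (aeval x₁ (p r) * y (r.1 % a₁)) * X ^ (r.1 / a₁)

end Curves

section AlgorithmG

variable {K : Type*} [Field K] {N : ℕ}

/-- The monomial `x ^ e · e_i` of `K[x] ^ N` is written `(e, i)`. The order: by weight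
`e u_x + u_i`, ties broken by the index of the basis vector. -/
def MonLT (ux : ℤ) (w : Fin N → ℤ) (p q : ℕ × Fin N) : Prop :=
  p.1 * ux + w p.2 < q.1 * ux + w q.2 ∨
    (p.1 * ux + w p.2 = q.1 * ux + w q.2 ∧ p.2 < q.2)

/-- `p` is the leading monomial of the vector `v`. -/
def IsLeadMon (ux : ℤ) (w : Fin N → ℤ) (v : Fin N → K[X]) (p : ℕ × Fin N) : Prop :=
  (v p.2).coeff p.1 ≠ 0 ∧ ∀ q : ℕ × Fin N, (v q.2).coeff q.1 ≠ 0 → q = p ∨ MonLT ux w q p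

/-- Divisibility of monomials of `K[x] ^ N`. -/
def MonDvd (p q : ℕ × Fin N) : Prop := p.2 = q.2 ∧ p.1 ≤ q.1

/-- The rows of `B` form a minimal Gröbner basis of `S` (up to scaling the rows): they are nonzero
elements of `S`, the leading monomial of every nonzero element of `S` is divisible by the leading
monomial of a row, and no leading monomial of a row divides that of another row. -/
def IsMinimalGroebnerBasis (ux : ℤ) (w : Fin N → ℤ) (S : Set (Fin N → K[X]))
    (B : Fin N → Fin N → K[X]) : Prop :=
  (∀ i, B i ∈ S ∧ B i ≠ 0) ∧
  (∀ v ∈ S, v ≠ 0 → ∃ i p q, IsLeadMon ux w (B i) p ∧ IsLeadMon ux w v q ∧ MonDvd p q) ∧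
  (∀ i j p q, i ≠ j → IsLeadMon ux w (B i) p → IsLeadMon ux w (B j) q → ¬ MonDvd p q)

/-- `ind v = i`: the last nonzero coordinate of `v` is number `i`. -/
def HasInd (v : Fin N → K[X]) (i : Fin N) : Prop := v i ≠ 0 ∧ ∀ j, i < j → v j = 0

open Classical in
/-- The index of the leading monomial of `v` (the default value `d` if `v = 0`). -/
def leadIndex (ux : ℤ) (w : Fin N → ℤ) (v : Fin N → K[X]) (d : Fin N) : Fin N :=
  if h : ∃ p, IsLeadMon ux w v p then h.choose.2 else d

open Classical in
/-- The number of multiplications in `K` used to multiply the vector `v` by a scalar: one for each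
coefficient, up to the degree, of each nonzero coordinate. -/
def scaleCost (v : Fin N → K[X]) : ℕ := ∑ i, if v i = 0 then 0 else (v i).natDegree + 1

/-- A state of Algorithm G: the current vectors `g_1, …, g_N`, the current index `r` (counting
from zero) and the number of multiplications in `K` performed so far. -/
structure GState (K : Type*) [Field K] (N : ℕ) where
  rows : Fin N → Fin N → K[X]
  idx : ℕ
  mults : ℕ

open Classical in
/-- One step of Algorithm G. If `r` is out of range, the algorithm has stopped. Otherwise let `s`
be the index of the leading term of `g_r`. If `s = r`, go on to the next `r`. If `s ≠ r`, put
`d = deg g_{rs} - deg g_{ss}` and `c = lc g_{rs} / lc g_{ss}` (counted as one multiplication);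
if `d ≥ 0`, replace `g_r` by `g_r - c x ^ d g_s`; if `d < 0`, replace simultaneously `g_s` by `g_r`
and `g_r` by `x ^ (-d) g_r - c g_s`. -/
def algGStep (ux : ℤ) (w : Fin N → ℤ) (σ : GState K N) : GState K N :=
  if hr : σ.idx < N then
    let r : Fin N := ⟨σ.idx, hr⟩
    let gr := σ.rows r
    let s := leadIndex ux w gr r
    let gs := σ.rows s
    if s = r then { σ with idx := σ.idx + 1 }
    else
      let c : K := (gr s).leadingCoeff * ((gs s).leadingCoeff)⁻¹
      { rows :=
          if (gs s).natDegree ≤ (gr s).natDegree then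
            Function.update σ.rows r
              (gr - (C c * X ^ ((gr s).natDegree - (gs s).natDegree) : K[X]) • gs)
          else
            Function.update (Function.update σ.rows s gr) r
              ((X ^ ((gs s).natDegree - (gr s).natDegree) : K[X]) • gr - (C c : K[X]) • gs)
        idx := σ.idx
        mults := σ.mults + (1 + scaleCost gs) }
  else σ

/-- Algorithm G, run with weights `ux`, `w` on the vectors `g`, stops after finitely many steps in
the final state `τ`. -/
def AlgGHaltsWith (ux : ℤ) (w : Fin N → ℤ) (g : Fin N → Fin N → K[X]) (τ : GState K N) : Prop :=
  N ≤ τ.idx ∧ ∃ T : ℕ, (algGStep ux w)^[T] { rows := g, idx := 0, mults := 0 } = τ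

end AlgorithmG

end AGInterp

end

/-! Away from `Q` the function `f` has exactly the simple zeros `P_i`, so `L(-iD + ∞Q) = f ^ i
L(∞Q)`. As `f = φ(x₁)` is a polynomial in `x₁`, multiplication by `f` shifts pole orders by a fixed
multiple of `a₁`. Hence `f ^ i y_j` inherits the minimality of `y_j` in its residue class
(`IsPoleBasis.isMinPole`).

The same division shows that the given vectors generate the interpolation module. If `Z ^ k` is the
highest power in an element of the module, its coefficient vanishes to order `m - k` along `D`, so
its coordinates are divisible by `φ ^ (m - k)`, the diagonal entry of the generators in block `k`
(`IsGenSystem.dvd_of_hasInd`). Triangular division then gives generation (`span_eq_of_hasInd`).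
Algorithm G preserves spans, and after stage `r` the rows up to `r` lead in their own coordinates.
Vectors with leading terms in distinct coordinates form a minimal Gröbner basis of their span
(`isMinimalGroebnerBasis_of_lead`).

For termination and cost, encode the order by an integer key, namely weight times `N` plus index.
Let `E` be the key of the leading monomial of row `r` minus the key of its top monomial in
coordinate `r`. Each step strictly lowers `E` (`newRow_spec`), and the stage ends when `E = 0`.
Since `E = εN + s - r`, the labels `(ε, s)` of the steps of a stage are distinct. They satisfy `ε ≡
w_s - w_r` modulo `a₁`. With `H = n + 2g - 1` they also satisfy `ε ≤ min(k, m)(H - u)` for a row in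
block `k`, because a generator trades at most `min(k, m)` factors `Z` for `h`
(`IsGenSystem.step_bound`).

A step costs what the degrees in row `s` allow, hence is bounded through the leading weight of that
row. This weight never increases within a stage, and at its start it is the least leading weight in
coordinate `s` of the module spanned by the earlier rows. Every explicit element of that module
therefore yields a bound.

If `a₁ ≥ 2`, the congruence leaves at most one coordinate per block for each `ε`, and crude bounds
suffice (`IsGenSystem.stageBound_of_two_le`). If `a₁ = 1` there is no such saving and lower-order
terms matter. Then `L(∞Q) = K[x₁]`, and Euclidean division by `φ` produces elements of small leading
weight (`IsGenSystem.exists_lead_one`, `IsGenSystem.exists_lead_two`). With these, each stage stays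
within its share of the bound, except that the second stage uses up the share of the first, which
has no steps (`sum_stageBudget_le`). -/

namespace AGInterp

/-! ### Monomial keys, and vectors with leading terms in distinct coordinates -/

section AlgorithmG

variable {K : Type*} [Field K] {N : ℕ}

/-- The weight of a monomial of `K[x] ^ N`. -/
def monWt (ux : ℤ) (w : Fin N → ℤ) (p : ℕ × Fin N) : ℤ := p.1 * ux + w p.2

/-- An integer that encodes the position of a monomial in the order `MonLT`. -/
def monKey (ux : ℤ) (w : Fin N → ℤ) (p : ℕ × Fin N) : ℤ := monWt ux w p * N + (p.2 : ℕ)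

theorem lex_lt_of_key_lt {N : ℕ} {A B : ℤ} {i j : Fin N}
    (h : A * N + (i : ℕ) < B * N + (j : ℕ)) : A < B ∨ (A = B ∧ i < j) := by
  have hi : ((i : ℕ) : ℤ) < N := by exact_mod_cast i.2
  have hj : ((j : ℕ) : ℤ) < N := by exact_mod_cast j.2
  rcases lt_trichotomy A B with hAB | hAB | hAB
  · exact Or.inl hAB
  · refine Or.inr ⟨hAB, ?_⟩
    subst hAB
    rw [Fin.lt_def]
    omega
  · exfalso
    have : (B + 1) * (N : ℤ) ≤ A * N := by
      apply mul_le_mul_of_nonneg_right <;> omega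
    have h0 : (0 : ℤ) ≤ (i : ℕ) := by positivity
    nlinarith

theorem key_lt_of_lex_lt {N : ℕ} {A B : ℤ} {i j : Fin N}
    (h : A < B ∨ (A = B ∧ i < j)) : A * N + (i : ℕ) < B * N + (j : ℕ) := by
  have hi : ((i : ℕ) : ℤ) < N := by exact_mod_cast i.2
  rcases h with hAB | ⟨rfl, hij⟩
  · have : (A + 1) * (N : ℤ) ≤ B * N := by
      apply mul_le_mul_of_nonneg_right <;> omega
    have h0 : (0 : ℤ) ≤ (j : ℕ) := by positivity
    nlinarith
  · rw [Fin.lt_def] at hij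
    omega

theorem monLT_iff {ux : ℤ} {w : Fin N → ℤ} {p q : ℕ × Fin N} :
    MonLT ux w p q ↔ monKey ux w p < monKey ux w q :=
  ⟨fun h => key_lt_of_lex_lt h, fun h => lex_lt_of_key_lt h⟩

theorem monWt_le_of_monKey_le {ux : ℤ} {w : Fin N → ℤ} {p q : ℕ × Fin N}
    (h : monKey ux w p ≤ monKey ux w q) : monWt ux w p ≤ monWt ux w q := by
  by_contra hlt
  have := key_lt_of_lex_lt (i := q.2) (j := p.2) (Or.inl (not_le.mp hlt))
  unfold monKey at h
  omega

/-- The key determines the index and the weight, and `ux > 0` recovers the exponent from these two.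
-/
theorem monKey_injective {ux : ℤ} (hux : 0 < ux) (w : Fin N → ℤ) :
    Function.Injective (monKey ux w) := by
  intro p q h
  have h1 := mt (key_lt_of_lex_lt (A := monWt ux w p) (B := monWt ux w q) (i := p.2) (j := q.2))
    (by unfold monKey at h; omega)
  have h2 := mt (key_lt_of_lex_lt (A := monWt ux w q) (B := monWt ux w p) (i := q.2) (j := p.2))
    (by unfold monKey at h; omega)
  push Not at h1 h2
  have hW : monWt ux w p = monWt ux w q := le_antisymm h2.1 h1.1
  have hi : p.2 = q.2 := le_antisymm (h2.2 hW.symm) (h1.2 hW)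
  unfold monWt at hW
  rw [hi] at hW
  have : (p.1 : ℤ) = q.1 := mul_right_cancel₀ hux.ne' (by linarith)
  exact Prod.ext (by exact_mod_cast this) hi

theorem monKey_add {ux : ℤ} {w : Fin N → ℤ} (d e : ℕ) (i : Fin N) :
    monKey ux w (d + e, i) = monKey ux w (d, i) + e * ux * N := by
  simp only [monKey, monWt]; push_cast; ring

theorem monKey_lt_of_lt {ux : ℤ} (hux : 0 < ux) {w : Fin N → ℤ} {d e : ℕ} (i : Fin N)
    (h : d < e) : monKey ux w (d, i) < monKey ux w (e, i) :=
  key_lt_of_lex_lt (Or.inl (by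
    simp only [monWt]
    have : (d : ℤ) < e := by exact_mod_cast h
    nlinarith))

/-- All monomials of `v` have key at most `κ`. -/
def KeyLE (ux : ℤ) (w : Fin N → ℤ) (v : Fin N → K[X]) (κ : ℤ) : Prop :=
  ∀ d i, (v i).coeff d ≠ 0 → monKey ux w (d, i) ≤ κ

theorem isLeadMon_iff {ux : ℤ} (hux : 0 < ux) {w : Fin N → ℤ} {v : Fin N → K[X]}
    {p : ℕ × Fin N} :
    IsLeadMon ux w v p ↔ (v p.2).coeff p.1 ≠ 0 ∧ KeyLE ux w v (monKey ux w p) := by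
  refine and_congr_right fun _ => ⟨fun h d i hd => ?_, fun h q hq => ?_⟩
  · rcases h (d, i) hd with rfl | hlt
    · exact le_rfl
    · exact (monLT_iff.mp hlt).le
  · rcases (h q.1 q.2 hq).lt_or_eq with hlt | heq
    · exact Or.inr (monLT_iff.mpr hlt)
    · exact Or.inl (monKey_injective hux w heq)

theorem IsLeadMon.unique {ux : ℤ} (hux : 0 < ux) {w : Fin N → ℤ} {v : Fin N → K[X]}
    {p q : ℕ × Fin N} (hp : IsLeadMon ux w v p) (hq : IsLeadMon ux w v q) : p = q := by
  rw [isLeadMon_iff hux] at hp hq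
  exact monKey_injective hux w (le_antisymm (hq.2 _ _ hp.1) (hp.2 _ _ hq.1))

theorem exists_isLeadMon {ux : ℤ} (hux : 0 < ux) (w : Fin N → ℤ) {v : Fin N → K[X]}
    (hv : v ≠ 0) : ∃ p, IsLeadMon ux w v p := by
  classical
  let s : Finset (ℕ × Fin N) :=
    Finset.univ.biUnion fun i => (v i).support.image fun d => (d, i)
  have hs : ∀ d i, (d, i) ∈ s ↔ (v i).coeff d ≠ 0 := by
    intro d i
    simp [s]
  have hne : s.Nonempty := by
    obtain ⟨i, hi⟩ := Function.ne_iff.mp hv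
    exact ⟨((v i).natDegree, i), (hs _ _).mpr (by simpa using hi)⟩
  obtain ⟨p, hp, hmax⟩ := s.exists_max_image (monKey ux w) hne
  exact ⟨p, (isLeadMon_iff hux).mpr ⟨(hs _ _).mp hp, fun d i hd => hmax _ ((hs d i).mpr hd)⟩⟩

theorem leadIndex_eq {ux : ℤ} (hux : 0 < ux) {w : Fin N → ℤ} {v : Fin N → K[X]}
    {p : ℕ × Fin N} (hp : IsLeadMon ux w v p) (d : Fin N) : leadIndex ux w v d = p.2 := by
  have h : ∃ p, IsLeadMon ux w v p := ⟨p, hp⟩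
  unfold leadIndex
  rw [dif_pos h, h.choose_spec.unique hux hp]

theorem IsLeadMon.natDegree_eq {ux : ℤ} (hux : 0 < ux) {w : Fin N → ℤ} {v : Fin N → K[X]}
    {p : ℕ × Fin N} (hp : IsLeadMon ux w v p) : (v p.2).natDegree = p.1 := by
  rw [isLeadMon_iff hux] at hp
  have hle : p.1 ≤ (v p.2).natDegree := le_natDegree_of_ne_zero hp.1
  by_contra hne
  have hlt := lt_of_le_of_ne hle (Ne.symm hne)
  have hv : v p.2 ≠ 0 := fun h => hp.1 (by rw [h, coeff_zero])
  have := hp.2 (v p.2).natDegree p.2 (by simpa using hv)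
  exact absurd (monKey_lt_of_lt hux p.2 hlt) (not_lt.mpr this)

theorem IsLeadMon.ne_zero {ux : ℤ} {w : Fin N → ℤ} {v : Fin N → K[X]}
    {p : ℕ × Fin N} (hp : IsLeadMon ux w v p) : v ≠ 0 := by
  rintro rfl
  exact hp.1 (by simp)

/-- Subtracting with cancellation of the common leading term lowers the key. -/
theorem KeyLE.sub_lt {ux : ℤ} (hux : 0 < ux) {w : Fin N → ℤ} {v v' : Fin N → K[X]}
    {p : ℕ × Fin N} (h : KeyLE ux w v (monKey ux w p)) (h' : KeyLE ux w v' (monKey ux w p))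
    (hc : (v p.2).coeff p.1 = (v' p.2).coeff p.1) : KeyLE ux w (v - v') (monKey ux w p - 1) := by
  intro d i hd
  have hle : monKey ux w (d, i) ≤ monKey ux w p := by
    by_contra hgt
    have h1 : (v i).coeff d = 0 := by
      by_contra h1; exact hgt (h d i h1)
    have h2 : (v' i).coeff d = 0 := by
      by_contra h2; exact hgt (h' d i h2)
    exact hd (by simp [h1, h2])
  rcases hle.lt_or_eq with hlt | heq
  · omega
  · have hp := monKey_injective hux w heq
    subst hp
    exact absurd (by simpa [sub_eq_zero] using hc) hd

theorem coeff_C_mul_X_pow_mul' (c : K) (D d : ℕ) (q : K[X]) :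
    ((C c * X ^ D : K[X]) * q).coeff d = if D ≤ d then c * q.coeff (d - D) else 0 := by
  rw [mul_assoc, coeff_C_mul, coeff_X_pow_mul']
  split_ifs <;> simp

theorem KeyLE.shift {ux : ℤ} {w : Fin N → ℤ} {v : Fin N → K[X]} {κ : ℤ}
    (h : KeyLE ux w v κ) (c : K) (D : ℕ) :
    KeyLE ux w ((C c * X ^ D : K[X]) • v) (κ + D * ux * N) := by
  intro d i hd
  simp only [Pi.smul_apply, smul_eq_mul, coeff_C_mul_X_pow_mul'] at hd
  split_ifs at hd with hDd
  · have := h (d - D) i (right_ne_zero_of_mul hd)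
    have h2 := monKey_add (ux := ux) (w := w) (d - D) D i
    rw [Nat.sub_add_cancel hDd] at h2
    omega
  · exact absurd rfl hd

/-- Vectors with leading terms in pairwise distinct coordinates: the leading monomial of a
combination is a multiple of the leading monomial of one of them. -/
theorem exists_lead_dvd {ux : ℤ} (hux : 0 < ux) {w : Fin N → ℤ} {B : Fin N → Fin N → K[X]}
    {s : Set (Fin N)} {D : Fin N → ℕ} (hB : ∀ i ∈ s, IsLeadMon ux w (B i) (D i, i))
    {v : Fin N → K[X]} (hv : v ∈ Submodule.span K[X] (B '' s)) (hv0 : v ≠ 0) :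
    ∃ i ∈ s, ∃ e, IsLeadMon ux w v (D i + e, i) := by
  classical
  obtain ⟨c, hc, rfl⟩ := (Finsupp.mem_span_image_iff_linearCombination K[X]).mp hv
  have hcs : ∀ i ∈ c.support, i ∈ s := fun i hi => hc hi
  have hne : c.support.Nonempty := by
    rw [Finsupp.support_nonempty_iff]
    rintro rfl
    exact hv0 (by simp)
  -- The leading terms of the summands lie in distinct coordinates, so their keys differ. The
  -- largest one is attained once and cannot cancel.
  obtain ⟨i, hi, hmax⟩ := c.support.exists_max_image
    (fun i => monKey ux w (D i + (c i).natDegree, i)) hne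
  have hterm : ∀ j ∈ c.support, KeyLE ux w (c j • B j) (monKey ux w (D j + (c j).natDegree, j)) := by
    intro j hj d t hd
    simp only [Pi.smul_apply, smul_eq_mul, coeff_mul] at hd
    obtain ⟨⟨d1, d2⟩, hmem, hprod⟩ := Finset.exists_ne_zero_of_sum_ne_zero hd
    rw [Finset.HasAntidiagonal.mem_antidiagonal] at hmem
    have h1 : d1 ≤ (c j).natDegree := le_natDegree_of_ne_zero (left_ne_zero_of_mul hprod)
    have h2 := ((isLeadMon_iff hux).mp (hB j (hcs j hj))).2 d2 t (right_ne_zero_of_mul hprod)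
    have h3 := monKey_add (ux := ux) (w := w) d2 d1 t
    have h4 := monKey_add (ux := ux) (w := w) (D j) (c j).natDegree j
    simp only at hmem
    rw [show d = d2 + d1 by omega, h3, h4]
    have h5 : (d1 : ℤ) * ux * N ≤ (c j).natDegree * ux * N := by
      have : (d1 : ℤ) ≤ (c j).natDegree := by exact_mod_cast h1
      have hN : (0 : ℤ) ≤ N := by positivity
      exact mul_le_mul_of_nonneg_right (mul_le_mul_of_nonneg_right this hux.le) hN
    omega
  refine ⟨i, hcs i hi, (c i).natDegree, (isLeadMon_iff hux).mpr ⟨?_, ?_⟩⟩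
  · rw [Finsupp.linearCombination_apply, Finsupp.sum, Finset.sum_apply, finsetSum_coeff,
      Finset.sum_eq_single i]
    · have hdeg := (hB i (hcs i hi)).natDegree_eq hux
      simp only at hdeg
      simp only [Pi.smul_apply, smul_eq_mul]
      rw [add_comm, ← hdeg, coeff_mul_degree_add_degree]
      refine mul_ne_zero ?_ ?_
      · simpa using hi
      · have := (hB i (hcs i hi)).1
        simp only at this
        rw [← hdeg] at this
        simpa using this
    · intro j hj hji
      by_contra hne0
      have h1 := hterm j hj _ _ hne0
      have h2 := hmax j hj
      have h3 := monKey_injective hux w (le_antisymm h1 h2)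
      exact hji (Prod.ext_iff.mp h3).2.symm
    · intro h
      exact absurd hi h
  · intro d t hd
    rw [Finsupp.linearCombination_apply, Finsupp.sum, Finset.sum_apply, finsetSum_coeff] at hd
    obtain ⟨j, hj, hjne⟩ := Finset.exists_ne_zero_of_sum_ne_zero hd
    exact (hterm j hj d t hjne).trans (hmax j hj)

/-- Divisibility of monomials requires equal coordinates, so minimality is automatic. The division
property is `exists_lead_dvd`. -/
theorem isMinimalGroebnerBasis_of_lead {ux : ℤ} (hux : 0 < ux) {w : Fin N → ℤ}
    {B : Fin N → Fin N → K[X]} {D : Fin N → ℕ} (hB : ∀ i, IsLeadMon ux w (B i) (D i, i)) :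
    IsMinimalGroebnerBasis ux w (Submodule.span K[X] (Set.range B) : Set (Fin N → K[X])) B := by
  refine ⟨fun i => ⟨Submodule.subset_span ⟨i, rfl⟩, (hB i).ne_zero⟩, fun v hv hv0 => ?_, ?_⟩
  · rw [SetLike.mem_coe, ← Set.image_univ] at hv
    obtain ⟨i, -, e, he⟩ := exists_lead_dvd hux (fun i _ => hB i) hv hv0
    exact ⟨i, _, _, hB i, he, rfl, by simp⟩
  · intro i j p q hij hp hq hd
    rw [hp.unique hux (hB i), hq.unique hux (hB j)] at hd
    exact hij hd.1

end AlgorithmG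

/-! ### One stage of Algorithm G and the labels of its steps -/

section AlgorithmG

variable {K : Type*} [Field K] {N : ℕ}

/-- All monomials of `v` have weight at most `B`. -/
def WtLE (ux : ℤ) (w : Fin N → ℤ) (v : Fin N → K[X]) (B : ℤ) : Prop :=
  ∀ d i, (v i).coeff d ≠ 0 → monWt ux w (d, i) ≤ B

/-- What holds while Algorithm G works on row `r`. The integer `E` compares the leading monomial of
row `r` with its monomial of highest degree in coordinate `r`. -/
structure StageInv (ux : ℤ) (w : Fin N → ℤ) (r : Fin N) (V : Submodule K[X] (Fin N → K[X]))
    (B : ℤ) (Λ : Fin N → ℤ) (ρ : Fin N → Fin N → K[X]) (E : ℤ) : Prop where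
  lead : ∀ i < r, ∃ D, IsLeadMon ux w (ρ i) (D, i) ∧ monWt ux w (D, i) ≤ Λ i ∧
    ∀ d, (ρ i r).coeff d ≠ 0 → E < monKey ux w (D, i) - monKey ux w (d, r)
  supp : ∀ i ≤ r, ∀ j, r < j → ρ i j = 0
  span_eq : Submodule.span K[X] (ρ '' Set.Iic r) = V
  wt : ∀ i ≤ r, WtLE ux w (ρ i) B
  diag_ne : ρ r r ≠ 0
  diag : ∃ p, IsLeadMon ux w (ρ r) p ∧ monKey ux w p = E + monKey ux w ((ρ r r).natDegree, r)

theorem algGStep_of_lead_eq {ux : ℤ} (hux : 0 < ux) {w : Fin N → ℤ} {ρ : Fin N → Fin N → K[X]}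
    {r : Fin N} {μ : ℕ} {p : ℕ × Fin N} (hp : IsLeadMon ux w (ρ r) p) (hpr : p.2 = r) :
    algGStep ux w ⟨ρ, r, μ⟩ = ⟨ρ, r + 1, μ⟩ := by
  unfold algGStep
  rw [dif_pos r.2]
  simp only [Fin.eta]
  rw [if_pos (by rw [leadIndex_eq hux hp, hpr])]

-- Both branches have the form `x ^ D1 g_r - c x ^ D2 g_s` with one of the exponents zero. Writing
-- the trivial factors out lets `newRow_spec` treat them together.
open Classical in
theorem algGStep_of_lead_ne {ux : ℤ} (hux : 0 < ux) {w : Fin N → ℤ} {ρ : Fin N → Fin N → K[X]}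
    {r s : Fin N} {μ P D : ℕ} (hp : IsLeadMon ux w (ρ r) (P, s)) (hsr : s ≠ r)
    (hs : IsLeadMon ux w (ρ s) (D, s)) :
    ∃ c : K, c * (ρ s s).coeff D = (ρ r s).coeff P ∧ c ≠ 0 ∧
      algGStep ux w ⟨ρ, r, μ⟩ = ⟨if D ≤ P then
          Function.update ρ r ((C 1 * X ^ 0 : K[X]) • ρ r - (C c * X ^ (P - D) : K[X]) • ρ s)
        else Function.update (Function.update ρ s (ρ r)) r
          ((C 1 * X ^ (D - P) : K[X]) • ρ r - (C c * X ^ 0 : K[X]) • ρ s),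
        r, μ + (1 + scaleCost (ρ s))⟩ := by
  have hdr := hp.natDegree_eq hux
  have hds := hs.natDegree_eq hux
  simp only at hdr hds
  have hs0 := hs.1
  have hp0 := hp.1
  simp only at hs0 hp0
  refine ⟨(ρ r s).leadingCoeff * ((ρ s s).leadingCoeff)⁻¹, ?_, ?_, ?_⟩
  · rw [leadingCoeff, leadingCoeff, hdr, hds, inv_mul_cancel_right₀ hs0]
  · rw [leadingCoeff, leadingCoeff, hdr, hds]
    exact mul_ne_zero hp0 (inv_ne_zero hs0)
  · unfold algGStep
    rw [dif_pos r.2]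
    simp only [Fin.eta, leadIndex_eq hux hp]
    rw [if_neg hsr, hdr, hds]
    simp only [map_one, pow_zero, mul_one, one_mul, one_smul]

theorem span_update_sub {ρ : Fin N → Fin N → K[X]} {r s : Fin N} (hs : s < r) (a : K[X]) :
    Submodule.span K[X] (Function.update ρ r ((C 1 * X ^ 0 : K[X]) • ρ r - a • ρ s) '' Set.Iic r) =
      Submodule.span K[X] (ρ '' Set.Iic r) := by
  set ρ' := Function.update ρ r ((C 1 * X ^ 0 : K[X]) • ρ r - a • ρ s) with hρ'
  have hr' : ρ' r = ρ r - a • ρ s := by simp [hρ']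
  have hi' : ∀ i, i ≠ r → ρ' i = ρ i := fun i hi => by simp [hρ', hi]
  have mem : ∀ i ≤ r, ρ i ∈ Submodule.span K[X] (ρ '' Set.Iic r) :=
    fun i hi => Submodule.subset_span ⟨i, hi, rfl⟩
  have mem' : ∀ i ≤ r, ρ' i ∈ Submodule.span K[X] (ρ' '' Set.Iic r) :=
    fun i hi => Submodule.subset_span ⟨i, hi, rfl⟩
  refine le_antisymm (Submodule.span_le.mpr ?_) (Submodule.span_le.mpr ?_)
  · rintro _ ⟨i, hi, rfl⟩
    by_cases hir : i = r
    · subst hir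
      rw [hr']
      exact Submodule.sub_mem _ (mem _ hi) (Submodule.smul_mem _ _ (mem _ hs.le))
    · rw [hi' i hir]
      exact mem i hi
  · rintro _ ⟨i, hi, rfl⟩
    by_cases hir : i = r
    · subst hir
      have h2 := mem' s hs.le
      rw [hi' s hs.ne] at h2
      have h3 := Submodule.add_mem _ (mem' i hi) (Submodule.smul_mem _ a h2)
      rwa [hr', sub_add_cancel] at h3
    · rw [← hi' i hir]
      exact mem' i hi

theorem span_update_swap {ρ : Fin N → Fin N → K[X]} {r s : Fin N} (hs : s < r) (a : K[X]) {c : K}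
    (hc : c ≠ 0) :
    Submodule.span K[X] (Function.update (Function.update ρ s (ρ r)) r
        (a • ρ r - (C c * X ^ 0 : K[X]) • ρ s) '' Set.Iic r) =
      Submodule.span K[X] (ρ '' Set.Iic r) := by
  set ρ' := Function.update (Function.update ρ s (ρ r)) r
        (a • ρ r - (C c * X ^ 0 : K[X]) • ρ s) with hρ'
  have hr' : ρ' r = a • ρ r - (C c : K[X]) • ρ s := by simp [hρ']
  have hs' : ρ' s = ρ r := by simp [hρ', hs.ne]
  have hi' : ∀ i, i ≠ r → i ≠ s → ρ' i = ρ i := fun i hi hi2 => by simp [hρ', hi, hi2]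
  have mem : ∀ i ≤ r, ρ i ∈ Submodule.span K[X] (ρ '' Set.Iic r) :=
    fun i hi => Submodule.subset_span ⟨i, hi, rfl⟩
  have mem' : ∀ i ≤ r, ρ' i ∈ Submodule.span K[X] (ρ' '' Set.Iic r) :=
    fun i hi => Submodule.subset_span ⟨i, hi, rfl⟩
  have hrm : ρ r ∈ Submodule.span K[X] (ρ' '' Set.Iic r) := hs' ▸ mem' s hs.le
  refine le_antisymm (Submodule.span_le.mpr ?_) (Submodule.span_le.mpr ?_)
  · rintro _ ⟨i, hi, rfl⟩
    by_cases hir : i = r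
    · rw [hir, hr']
      exact Submodule.sub_mem _ (Submodule.smul_mem _ _ (mem _ le_rfl))
        (Submodule.smul_mem _ _ (mem _ hs.le))
    · by_cases his : i = s
      · rw [his, hs']
        exact mem r le_rfl
      · rw [hi' i hir his]
        exact mem i hi
  · rintro _ ⟨i, hi, rfl⟩
    by_cases hir : i = r
    · rw [hir]
      exact hrm
    · by_cases his : i = s
      · rw [his]
        -- The old row `s` is no longer in the list, but `c ≠ 0` recovers it from the two new rows.
        have h1 : ρ s = (C c⁻¹ : K[X]) • (a • ρ r - ρ' r) := by
          rw [hr', sub_sub_cancel, smul_smul, ← C_mul, inv_mul_cancel₀ hc, C_1, one_smul]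
        rw [h1]
        exact Submodule.smul_mem _ _ (Submodule.sub_mem _ (Submodule.smul_mem _ _ hrm)
          (mem' r le_rfl))
      · rw [← hi' i hir his]
        exact mem' i hi

/-- The new row `r`, whichever branch of the algorithm is taken. -/
theorem newRow_spec {ux : ℤ} (hux : 0 < ux) {w : Fin N → ℤ} {r s : Fin N}
    {v v' : Fin N → K[X]} {P D D1 D2 : ℕ} {c : K} {E : ℤ}
    (hp : IsLeadMon ux w v (P, s)) (hs : IsLeadMon ux w v' (D, s))
    (hc : c * (v' s).coeff D = (v s).coeff P) (hT : P + D1 = D + D2) (hv : v r ≠ 0)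
    (hE : monKey ux w (P, s) = E + monKey ux w ((v r).natDegree, r))
    (hv' : ∀ d, (v' r).coeff d ≠ 0 → E < monKey ux w (D, s) - monKey ux w (d, r)) :
    let v₁ := (C 1 * X ^ D1 : K[X]) • v - (C c * X ^ D2 : K[X]) • v'
    KeyLE ux w v₁ (monKey ux w (P + D1, s) - 1) ∧ v₁ r ≠ 0 ∧
      ∃ E' < E, ∃ p, IsLeadMon ux w v₁ p ∧
        monKey ux w p = E' + monKey ux w ((v₁ r).natDegree, r) := by
  intro v₁
  have hkey : KeyLE ux w v₁ (monKey ux w (P + D1, s) - 1) := by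
    refine KeyLE.sub_lt (p := (P + D1, s)) hux ?_ ?_ ?_
    · have := ((isLeadMon_iff hux).mp hp).2.shift 1 D1
      rwa [← monKey_add] at this
    · have := ((isLeadMon_iff hux).mp hs).2.shift c D2
      rwa [← monKey_add, ← hT] at this
    · simp only [Pi.smul_apply, smul_eq_mul, coeff_C_mul_X_pow_mul']
      rw [if_pos (by omega), if_pos (by omega), hT, Nat.add_sub_cancel, hc, ← hT,
        Nat.add_sub_cancel, one_mul]
  -- The two leading monomials are shifted to the same place. Since `v'` has the larger gap between
  -- its lead and coordinate `r`, its contribution there lies strictly below the top term of `v`, so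
  -- that top term survives.
  have hsmall : ∀ d, (v' r).coeff d ≠ 0 → d + D2 < (v r).natDegree + D1 := by
    intro d hd
    have h1 := hv' d hd
    by_contra hle
    have h2 : monKey ux w ((v r).natDegree + D1, r) ≤ monKey ux w (d + D2, r) := by
      rcases (not_lt.mp hle).lt_or_eq with h | h
      · exact (monKey_lt_of_lt hux r h).le
      · rw [h]
    have h3 := monKey_add (ux := ux) (w := w) P D1 s
    rw [hT] at h3
    have h4 := monKey_add (ux := ux) (w := w) D D2 s
    have h5 := monKey_add (ux := ux) (w := w) (v r).natDegree D1 r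
    have h6 := monKey_add (ux := ux) (w := w) d D2 r
    omega
  have hcoeff : ∀ d, (v r).natDegree + D1 ≤ d →
      (v₁ r).coeff d = (v r).coeff (d - D1) := by
    intro d hd
    simp only [v₁, Pi.sub_apply, Pi.smul_apply, smul_eq_mul, coeff_sub, coeff_C_mul_X_pow_mul']
    rw [if_pos (by omega), one_mul, sub_eq_self]
    split_ifs with h
    · by_contra hne
      have := hsmall _ (right_ne_zero_of_mul hne)
      omega
    · rfl
  have hlc : (v₁ r).coeff ((v r).natDegree + D1) ≠ 0 := by
    rw [hcoeff _ le_rfl, Nat.add_sub_cancel]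
    simpa using hv
  have hv₁ : v₁ r ≠ 0 := fun h => hlc (by rw [h, coeff_zero])
  have hdeg : (v₁ r).natDegree = (v r).natDegree + D1 := by
    refine le_antisymm (natDegree_le_iff_coeff_eq_zero.mpr fun d hd => ?_)
      (le_natDegree_of_ne_zero hlc)
    rw [hcoeff d hd.le]
    exact coeff_eq_zero_of_natDegree_lt (by omega)
  refine ⟨hkey, hv₁, ?_⟩
  obtain ⟨p, hpl⟩ := exists_isLeadMon hux w (v := v₁) (fun h => hv₁ (by rw [h]; rfl))
  refine ⟨monKey ux w p - monKey ux w ((v₁ r).natDegree, r), ?_, p, hpl, by ring⟩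
  have h1 := hkey _ _ hpl.1
  have h2 := monKey_add (ux := ux) (w := w) P D1 s
  have h3 := monKey_add (ux := ux) (w := w) (v r).natDegree D1 r
  rw [hdeg]
  simp only [Prod.mk.eta] at h1
  omega

open Classical in
/-- One step inside a stage of Algorithm G. -/
theorem StageInv.step {ux : ℤ} (hux : 0 < ux) {w : Fin N → ℤ} {r : Fin N}
    {V : Submodule K[X] (Fin N → K[X])} {B : ℤ} {Λ : Fin N → ℤ} {ρ : Fin N → Fin N → K[X]} {E : ℤ}
    (hI : StageInv ux w r V B Λ ρ E) (μ : ℕ) {p : ℕ × Fin N} (hp : IsLeadMon ux w (ρ r) p)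
    (hpr : p.2 ≠ r) :
    p.2 < r ∧ ∃ D ρ', ∃ E' < E, IsLeadMon ux w (ρ p.2) (D, p.2) ∧ monWt ux w (D, p.2) ≤ Λ p.2 ∧
      (∀ d, (ρ p.2 r).coeff d ≠ 0 → E < monKey ux w (D, p.2) - monKey ux w (d, r)) ∧
      algGStep ux w ⟨ρ, r, μ⟩ = ⟨ρ', r, μ + (1 + scaleCost (ρ p.2))⟩ ∧
      StageInv ux w r V B Λ ρ' E' ∧ ∀ i, r < i → ρ' i = ρ i := by
  obtain ⟨P, s⟩ := p
  simp only at hpr ⊢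
  have hsr : s < r := by
    refine lt_of_le_of_ne (not_lt.mp fun h => hp.1 ?_) hpr
    simp [hI.supp r le_rfl s h]
  obtain ⟨q, hq, hE⟩ := hI.diag
  obtain rfl := hq.unique hux hp
  obtain ⟨D, hs, hΛ, hcr⟩ := hI.lead s hsr
  obtain ⟨c, hc, hc0, hstep⟩ := algGStep_of_lead_ne hux (μ := μ) hp hpr hs
  have hsupp1 : ∀ a b : K[X], ∀ j, r < j → (a • ρ r - b • ρ s) j = 0 := by
    intro a b j hj
    simp [hI.supp r le_rfl j hj, hI.supp s hsr.le j hj]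
  by_cases hDP : D ≤ P
  · rw [if_pos hDP] at hstep
    obtain ⟨hk, hne, E', hE', hl⟩ := newRow_spec hux hp hs hc (D1 := 0) (D2 := P - D)
      (by omega) hI.diag_ne hE hcr
    refine ⟨hsr, D, _, E', hE', hs, hΛ, hcr, hstep, ⟨?_, ?_, ?_, ?_, ?_, ?_⟩, ?_⟩
    · intro i hi
      obtain ⟨Di, h1, h2, h3⟩ := hI.lead i hi
      rw [Function.update_of_ne hi.ne]
      exact ⟨Di, h1, h2, fun d hd => hE'.trans (h3 d hd)⟩
    · intro i hi j hj
      by_cases hir : i = r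
      · subst hir
        rw [Function.update_self]
        exact hsupp1 _ _ j hj
      · rw [Function.update_of_ne hir]
        exact hI.supp i hi j hj
    · rw [span_update_sub hsr, hI.span_eq]
    · intro i hi
      by_cases hir : i = r
      · subst hir
        rw [Function.update_self]
        intro d j hd
        exact (monWt_le_of_monKey_le ((hk d j hd).trans (by rw [add_zero]; omega))).trans
          (hI.wt i le_rfl P s hp.1)
      · rw [Function.update_of_ne hir]
        exact hI.wt i hi
    · rwa [Function.update_self]
    · rwa [Function.update_self]
    · intro i hi
      rw [Function.update_of_ne hi.ne']
  · rw [if_neg hDP] at hstep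
    obtain ⟨hk, hne, E', hE', hl⟩ := newRow_spec hux hp hs hc (D1 := D - P) (D2 := 0)
      (by omega) hI.diag_ne hE hcr
    refine ⟨hsr, D, _, E', hE', hs, hΛ, hcr, hstep, ⟨?_, ?_, ?_, ?_, ?_, ?_⟩, ?_⟩
    · intro i hi
      rw [Function.update_of_ne hi.ne]
      by_cases his : i = s
      · subst his
        rw [Function.update_self]
        -- After the swap, row `s` is the old row `r`. Its lead has the smaller exponent `P < D`, so
        -- the leading weight does not grow, and its gap to coordinate `r` is at least `E`, hence
        -- larger than `E'`.
        refine ⟨P, hp, le_trans ?_ hΛ, fun d hd => hE'.trans_le ?_⟩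
        · exact monWt_le_of_monKey_le (monKey_lt_of_lt hux i (not_le.mp hDP)).le
        · have hd' : monKey ux w (d, r) ≤ monKey ux w ((ρ r r).natDegree, r) := by
            rcases (le_natDegree_of_ne_zero hd).lt_or_eq with h | h
            · exact (monKey_lt_of_lt hux r h).le
            · rw [h]
          omega
      · rw [Function.update_of_ne his]
        obtain ⟨Di, h1, h2, h3⟩ := hI.lead i hi
        exact ⟨Di, h1, h2, fun d hd => hE'.trans (h3 d hd)⟩
    · intro i hi j hj
      by_cases hir : i = r
      · subst hir
        rw [Function.update_self]
        exact hsupp1 _ _ j hj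
      · rw [Function.update_of_ne hir]
        by_cases his : i = s
        · subst his
          rw [Function.update_self]
          exact hI.supp r le_rfl j hj
        · rw [Function.update_of_ne his]
          exact hI.supp i hi j hj
    · rw [span_update_swap hsr _ hc0, hI.span_eq]
    · intro i hi
      by_cases hir : i = r
      · subst hir
        rw [Function.update_self]
        intro d j hd
        -- The shifted lead of row `r` is exactly the lead of the old row `s`, so no new weight
        -- exceeds an old one.
        refine (monWt_le_of_monKey_le ((hk d j hd).trans ?_)).trans (hI.wt s hsr.le D s hs.1)
        rw [show P + (D - P) = D by omega]
        omega
      · rw [Function.update_of_ne hir]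
        by_cases his : i = s
        · subst his
          rw [Function.update_self]
          exact hI.wt r le_rfl
        · rw [Function.update_of_ne his]
          exact hI.wt i hi
    · rwa [Function.update_self]
    · rwa [Function.update_self]
    · intro i hi
      rw [Function.update_of_ne hi.ne', Function.update_of_ne (hsr.trans hi).ne']

/-- A complete stage of Algorithm G, with a bound on its cost: the steps have pairwise distinct
labels `(ε, s)`, where `s` is the coordinate of the leading term of row `r` and `ε` the difference
between its weight and the weight of the coordinate `r` of row `r`. -/
theorem StageInv.run {ux : ℤ} (hux : 0 < ux) {w : Fin N → ℤ} {r : Fin N}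
    {V : Submodule K[X] (Fin N → K[X])} {B : ℤ} {Λ : Fin N → ℤ} (S : Finset (ℤ × Fin N))
    (c : Fin N → ℕ)
    (hc : ∀ s < r, ∀ (v : Fin N → K[X]) (D : ℕ), IsLeadMon ux w v (D, s) →
      monWt ux w (D, s) ≤ Λ s → (∀ j, r < j → v j = 0) →
      (∀ d, (v r).coeff d ≠ 0 → monWt ux w (d, r) + 2 ≤ monWt ux w (D, s)) → WtLE ux w v B →
      1 + scaleCost v ≤ c s) :
    ∀ (n : ℕ) (E : ℤ) (ρ : Fin N → Fin N → K[X]) (μ : ℕ), E.toNat ≤ n →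
      StageInv ux w r V B Λ ρ E →
      (∀ (ε : ℤ) (s : Fin N), 1 ≤ ε → s < r → ux ∣ ε + w r - w s →
        ε * N + (s : ℕ) - (r : ℕ) ≤ E → (ε, s) ∈ S) →
      ∃ T ρ' μ' E', (algGStep ux w)^[T] ⟨ρ, r, μ⟩ = ⟨ρ', r + 1, μ'⟩ ∧
        StageInv ux w r V B Λ ρ' E' ∧ (∃ D, IsLeadMon ux w (ρ' r) (D, r)) ∧
        (∀ i, r < i → ρ' i = ρ i) ∧
        μ' ≤ μ + ∑ x ∈ S with x.1 * N + (x.2 : ℕ) - (r : ℕ) ≤ E, c x.2 := by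
  intro n
  induction n with
  | zero =>
    intro E ρ μ hn hI _
    obtain ⟨p, hp, hE⟩ := hI.diag
    -- With `E ≤ 0` the leading monomial cannot be above the top monomial in coordinate `r`, so they
    -- coincide.
    have hpr : p.2 = r := by
      by_contra hpr
      have h1 := ((isLeadMon_iff hux).mp hp).2 (ρ r r).natDegree r (by simpa using hI.diag_ne)
      have h2 : p = ((ρ r r).natDegree, r) := monKey_injective hux w (by omega)
      exact hpr (by rw [h2])
    exact ⟨1, ρ, μ, E, algGStep_of_lead_eq hux hp hpr, hI, ⟨p.1, by rwa [show (p.1, r) = p from Prod.ext rfl hpr.symm]⟩,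
      fun _ _ => rfl, Nat.le_add_right _ _⟩
  | succ n ih =>
    intro E ρ μ hn hI hS
    obtain ⟨p, hp, hE⟩ := hI.diag
    by_cases hpr : p.2 = r
    · exact ⟨1, ρ, μ, E, algGStep_of_lead_eq hux hp hpr, hI, ⟨p.1, by rwa [show (p.1, r) = p from Prod.ext rfl hpr.symm]⟩,
        fun _ _ => rfl, Nat.le_add_right _ _⟩
    · obtain ⟨hsr, D, ρ₁, E₁, hE₁, hs, hΛ, hcr, hstep, hI₁, hrest⟩ := hI.step hux μ hp hpr
      -- `E` is read as a label: its weight part is `ε`, its index part is `p.2 - r`.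
      have hε : ∃ ε : ℤ, E = ε * N + (p.2 : ℕ) - (r : ℕ) ∧
          ε = monWt ux w p - monWt ux w ((ρ r r).natDegree, r) := by
        refine ⟨_, ?_, rfl⟩
        unfold monKey at hE
        simp only at hE ⊢
        linarith
      obtain ⟨ε, hEε, hεw⟩ := hε
      have hsr' : (p.2 : ℕ) < (r : ℕ) := hsr
      have hE0 : 0 ≤ E := by
        have h1 := ((isLeadMon_iff hux).mp hp).2 (ρ r r).natDegree r (by simpa using hI.diag_ne)
        omega
      have hε1 : 1 ≤ ε := by
        by_contra hlt
        have : ε * N ≤ 0 := mul_nonpos_of_nonpos_of_nonneg (by omega) (by positivity)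
        omega
      have hmem : (ε, p.2) ∈ S := by
        refine hS ε p.2 hε1 hsr ⟨p.1 - (ρ r r).natDegree, ?_⟩ hEε.ge
        rw [hεw]
        simp only [monWt]
        ring
      have hcost : 1 + scaleCost (ρ p.2) ≤ c p.2 := by
        refine hc p.2 hsr _ D hs hΛ (hI.supp _ hsr.le) (fun d hd => ?_) (hI.wt _ hsr.le)
        have h1 := hcr d hd
        rw [hEε] at h1
        unfold monKey at h1
        simp only at h1
        -- The gap of row `s` exceeds `E` with the same index part, so its weight part exceeds `ε ≥
        -- 1`. This is the source of the summand `2`.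
        by_contra hlt
        have h2 : (monWt ux w (D, p.2) - monWt ux w (d, r)) * N ≤ ε * N :=
          mul_le_mul_of_nonneg_right (by omega) (by positivity)
        linarith
      obtain ⟨T, ρ', μ', E', hT, hI', hl', hr', hμ'⟩ := ih E₁ ρ₁ (μ + (1 + scaleCost (ρ p.2)))
        (by omega) hI₁ (fun ε' s' h1 h2 h3 h4 => hS ε' s' h1 h2 h3 (by omega))
      refine ⟨T + 1, ρ', μ', E', ?_, hI', hl', fun i hi => by rw [hr' i hi, hrest i hi], ?_⟩
      · rw [Function.iterate_succ_apply, hstep, hT]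
      -- The present label has value `E > E₁`, so it is not used again by the remaining steps.
      · have hsub : insert (ε, p.2) (S.filter fun x => x.1 * N + (x.2 : ℕ) - (r : ℕ) ≤ E₁) ⊆
            S.filter fun x => x.1 * N + (x.2 : ℕ) - (r : ℕ) ≤ E := by
          intro x hx
          rw [Finset.mem_insert, Finset.mem_filter] at hx
          rw [Finset.mem_filter]
          rcases hx with rfl | ⟨hx, hx2⟩
          · exact ⟨hmem, hEε.ge⟩
          · exact ⟨hx, by omega⟩
        have hle := Finset.sum_le_sum_of_subset (f := fun x : ℤ × Fin N => c x.2) hsub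
        rw [Finset.sum_insert] at hle
        · simp only at hle
          omega
        · rw [Finset.mem_filter]
          rintro ⟨-, h⟩
          simp only at h
          omega

end AlgorithmG

/-! ### The complete run, and triangular generating systems -/

section AlgorithmG

variable {K : Type*} [Field K] {N : ℕ}

/-- The stage of Algorithm G that works on row `r` costs at most `C` multiplications, by the
criterion of `StageInv.run`. The leading weights `Λ` of the previous rows are the least ones that
occur in the module they generate. -/
def StageBound (ux : ℤ) (w : Fin N → ℤ) (g : Fin N → Fin N → K[X]) (B : ℤ) (r : Fin N)
    (C : ℚ) : Prop :=
  ∀ Λ : Fin N → ℤ, (∀ i < r, Λ i ≤ B ∧ ∃ D : ℕ, Λ i = monWt ux w (D, i)) →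
    (∀ i < r, ∀ v ∈ Submodule.span K[X] (g '' Set.Iio r), ∀ e,
      IsLeadMon ux w v (e, i) → Λ i ≤ monWt ux w (e, i)) →
    ∃ (S : Finset (ℤ × Fin N)) (c : Fin N → ℕ),
      (∀ (ε : ℤ) (s : Fin N), 1 ≤ ε → s < r → ux ∣ ε + w r - w s → ∀ d i, (g r i).coeff d ≠ 0 →
        ε * N + (s : ℕ) ≤
          (monWt ux w (d, i) - monWt ux w ((g r r).natDegree, r)) * N + (i : ℕ) → (ε, s) ∈ S) ∧
      (∀ s < r, ∀ (v : Fin N → K[X]) (D : ℕ), IsLeadMon ux w v (D, s) →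
        monWt ux w (D, s) ≤ Λ s → (∀ j, r < j → v j = 0) →
        (∀ d, (v r).coeff d ≠ 0 → monWt ux w (d, r) + 2 ≤ monWt ux w (D, s)) →
        1 + scaleCost v ≤ c s) ∧
      ((∑ x ∈ S, c x.2 : ℕ) : ℚ) ≤ C

/-- What holds before the stage `r` of Algorithm G. -/
structure RunInv (ux : ℤ) (w : Fin N → ℤ) (g : Fin N → Fin N → K[X]) (B : ℤ) (r : ℕ)
    (ρ : Fin N → Fin N → K[X]) : Prop where
  lead : ∀ i : Fin N, (i : ℕ) < r → ∃ D, IsLeadMon ux w (ρ i) (D, i)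
  supp : ∀ i : Fin N, (i : ℕ) < r → ∀ j : Fin N, r ≤ j → ρ i j = 0
  rest : ∀ i : Fin N, r ≤ i → ρ i = g i
  span_eq : Submodule.span K[X] (ρ '' {i | (i : ℕ) < r}) =
    Submodule.span K[X] (g '' {i | (i : ℕ) < r})
  wt : ∀ i, WtLE ux w (ρ i) B

/-- When a stage begins, the earlier rows vanish in coordinate `r`, so the gap condition of
`StageInv` is vacuous. They lead in distinct coordinates, so by `exists_lead_dvd` their leading
weights are the least possible ones in their span, as `StageBound` demands. -/
theorem RunInv.stage {ux : ℤ} (hux : 0 < ux) {w : Fin N → ℤ} {g : Fin N → Fin N → K[X]} {B : ℤ}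
    (hind : ∀ s, HasInd (g s) s) {r : Fin N} {ρ : Fin N → Fin N → K[X]}
    (hI : RunInv ux w g B r ρ) {C : ℚ} (hC : StageBound ux w g B r C) (μ : ℕ) :
    ∃ T ρ' μ', (algGStep ux w)^[T] ⟨ρ, r, μ⟩ = ⟨ρ', r + 1, μ'⟩ ∧
      RunInv ux w g B (r + 1) ρ' ∧ (μ' : ℚ) ≤ μ + C := by
  classical
  have hr : ρ r = g r := hI.rest r le_rfl
  have hex : ∀ i : Fin N, ∃ D, i < r → IsLeadMon ux w (ρ i) (D, i) := by
    intro i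
    by_cases h : i < r
    · obtain ⟨D, hD⟩ := hI.lead i h
      exact ⟨D, fun _ => hD⟩
    · exact ⟨0, fun h' => absurd h' h⟩
  choose D hD using hex
  have hIio : {i : Fin N | (i : ℕ) < r} = Set.Iio r := rfl
  have hIic : {i : Fin N | (i : ℕ) < (r : ℕ) + 1} = Set.Iic r := by
    ext i
    exact Nat.lt_succ_iff
  have hspan := hI.span_eq
  rw [hIio] at hspan
  have himg : ∀ f : Fin N → Fin N → K[X], f '' Set.Iic r = insert (f r) (f '' Set.Iio r) := by
    intro f
    rw [← Set.Iio_insert, Set.image_insert_eq]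
  obtain ⟨S, c, hS, hc, hsum⟩ := hC (fun i => monWt ux w (D i, i))
    (fun i hi => ⟨hI.wt i _ _ (hD i hi).1, D i, rfl⟩) (by
      intro i hi v hv e he
      rw [← hspan] at hv
      obtain ⟨j, hj, e', he'⟩ := exists_lead_dvd hux (s := Set.Iio r) (fun j hj => hD j hj) hv
        he.ne_zero
      have h1 := he.unique hux he'
      rw [Prod.mk.injEq] at h1
      obtain ⟨h1, rfl⟩ := h1
      subst h1
      simp only [monWt]
      push_cast
      have h2 : (0 : ℤ) ≤ (e' : ℤ) := by positivity
      nlinarith)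
  obtain ⟨p, hp⟩ := exists_isLeadMon hux w (v := ρ r)
    (fun h => (hind r).1 (by rw [← hr, h]; rfl))
  have hInv : StageInv ux w r (Submodule.span K[X] (g '' Set.Iic r)) B
      (fun i => monWt ux w (D i, i)) ρ
      (monKey ux w p - monKey ux w ((ρ r r).natDegree, r)) := by
    refine ⟨fun i hi => ⟨D i, hD i hi, le_rfl, fun d hd => ?_⟩, ?_, ?_, fun i _ => hI.wt i, ?_,
      p, hp, by ring⟩
    · exact absurd (by rw [hI.supp i hi r le_rfl, coeff_zero]) hd
    · intro i hi j hj
      rcases hi.lt_or_eq with h | rfl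
      · exact hI.supp i h j (le_of_lt hj)
      · rw [hr]
        exact (hind i).2 j hj
    · rw [himg, himg, Submodule.span_insert, Submodule.span_insert, hspan, hr]
    · rw [hr]
      exact (hind r).1
  obtain ⟨T, ρ', μ', E', hT, hI', ⟨D', hD'⟩, hrest, hμ⟩ := StageInv.run hux S c
    (fun s hs v Dv h1 h2 h3 h4 _ => hc s hs v Dv h1 h2 h3 h4) _ _ ρ μ le_rfl hInv
    (by
      intro ε s h1 h2 h3 h4
      refine hS ε s h1 h2 h3 p.1 p.2 (by rw [← hr]; exact hp.1) ?_
      rw [← hr]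
      unfold monKey at h4
      simp only [Prod.mk.eta] at h4 ⊢
      linarith)
  refine ⟨T, ρ', μ', hT, ⟨?_, ?_, ?_, ?_, ?_⟩, ?_⟩
  · intro i hi
    rcases (Nat.lt_succ_iff.mp hi).lt_or_eq with h | h
    · obtain ⟨Di, h1, -, -⟩ := hI'.lead i h
      exact ⟨Di, h1⟩
    · obtain rfl := Fin.ext h
      exact ⟨D', hD'⟩
  · intro i hi j hj
    exact hI'.supp i (Nat.lt_succ_iff.mp hi) j hj
  · intro i hi
    rw [hrest i hi]
    exact hI.rest i (by omega)
  · rw [hIic]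
    exact hI'.span_eq
  · intro i
    by_cases h : i ≤ r
    · exact hI'.wt i h
    · rw [hrest i (not_le.mp h)]
      exact hI.wt i
  · refine le_trans ?_ (add_le_add_right hsum _)
    have h1 : μ' ≤ μ + ∑ x ∈ S, c x.2 :=
      hμ.trans (Nat.add_le_add_left
        (Finset.sum_le_sum_of_subset (f := fun x : ℤ × Fin N => c x.2) (Finset.filter_subset _ _)) _)
    exact_mod_cast h1

/-- Algorithm G terminates on a lower triangular system. -/
theorem algG_halts {ux : ℤ} (hux : 0 < ux) {w : Fin N → ℤ} {g : Fin N → Fin N → K[X]} {B : ℤ}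
    (hind : ∀ s, HasInd (g s) s) (hB : ∀ i, WtLE ux w (g i) B) (C : ℕ → ℚ)
    (hC : ∀ r : Fin N, StageBound ux w g B r (C r)) :
    ∃ τ, AlgGHaltsWith ux w g τ ∧
      IsMinimalGroebnerBasis ux w (Submodule.span K[X] (Set.range g) : Set (Fin N → K[X])) τ.rows ∧
      (τ.mults : ℚ) ≤ ∑ r ∈ Finset.range N, C r := by
  have main : ∀ r ≤ N, ∃ T ρ μ, (algGStep ux w)^[T] ⟨g, 0, 0⟩ = ⟨ρ, r, μ⟩ ∧
      RunInv ux w g B r ρ ∧ (μ : ℚ) ≤ ∑ i ∈ Finset.range r, C i := by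
    intro r
    induction r with
    | zero =>
      intro _
      exact ⟨0, g, 0, rfl, ⟨by simp, by simp, fun _ _ => rfl, rfl, hB⟩, by simp⟩
    | succ r ih =>
      intro hr
      obtain ⟨T, ρ, μ, hT, hI, hμ⟩ := ih (by omega)
      obtain ⟨T', ρ', μ', hT', hI', hμ'⟩ :=
        RunInv.stage (r := ⟨r, hr⟩) hux hind hI (hC ⟨r, hr⟩) μ
      refine ⟨T' + T, ρ', μ', ?_, hI', ?_⟩
      · rw [Function.iterate_add_apply, hT, hT']
      · rw [Finset.sum_range_succ]
        simp only at hμ'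
        linarith
  obtain ⟨T, ρ, μ, hT, hI, hμ⟩ := main N le_rfl
  refine ⟨⟨ρ, N, μ⟩, ⟨le_rfl, T, hT⟩, ?_, hμ⟩
  choose D hD using fun i : Fin N => hI.lead i i.2
  have h := isMinimalGroebnerBasis_of_lead hux hD
  have huniv : {i : Fin N | (i : ℕ) < N} = Set.univ := by ext i; simp
  have hs := hI.span_eq
  rw [huniv, Set.image_univ, Set.image_univ] at hs
  rwa [hs] at h

/-- Vectors that generate a module, by their last nonzero coordinates. -/
theorem mem_span_of_hasInd {g : Fin N → Fin N → K[X]} {S : Submodule K[X] (Fin N → K[X])}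
    (hg : ∀ s, g s ∈ S) (hind : ∀ s, HasInd (g s) s)
    (hdvd : ∀ v ∈ S, ∀ s, HasInd v s → g s s ∣ v s) :
    ∀ (r : ℕ), ∀ v ∈ S, (∀ j : Fin N, r ≤ j → v j = 0) →
      v ∈ Submodule.span K[X] (g '' {i : Fin N | (i : ℕ) < r}) := by
  intro r
  induction r with
  | zero =>
    intro v _ hv
    have : v = 0 := funext fun j => hv j (Nat.zero_le _)
    rw [this]
    exact Submodule.zero_mem _
  | succ r ih =>
    intro v hvS hv
    have hmono : Submodule.span K[X] (g '' {i : Fin N | (i : ℕ) < r}) ≤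
        Submodule.span K[X] (g '' {i : Fin N | (i : ℕ) < r + 1}) :=
      Submodule.span_mono (Set.image_mono fun i hi => Nat.lt_succ_of_lt hi)
    by_cases h0 : ∀ j : Fin N, r ≤ j → v j = 0
    · exact hmono (ih v hvS h0)
    · push Not at h0
      obtain ⟨s, hs, hs0⟩ := h0
      have hsr : (s : ℕ) = r := by
        by_contra hne
        exact hs0 (hv s (by omega))
      have hvs : HasInd v s := ⟨hs0, fun j hj => hv j (by rw [Fin.lt_def] at hj; omega)⟩
      obtain ⟨q, hq⟩ := hdvd v hvS s hvs
      have h1 : v - q • g s ∈ Submodule.span K[X] (g '' {i : Fin N | (i : ℕ) < r}) := by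
        refine ih _ (S.sub_mem hvS (S.smul_mem _ (hg s))) fun j hj => ?_
        by_cases hjs : j = s
        · subst hjs
          simp [hq, mul_comm]
        · have hlt : s < j := by
            rw [Fin.lt_def]
            have : (j : ℕ) ≠ s := fun h => hjs (Fin.ext h)
            omega
          simp [hvs.2 j hlt, (hind s).2 j hlt]
      have h2 : q • g s ∈ Submodule.span K[X] (g '' {i : Fin N | (i : ℕ) < r + 1}) :=
        Submodule.smul_mem _ _ (Submodule.subset_span ⟨s, by simp [hsr], rfl⟩)
      have h3 := Submodule.add_mem _ (hmono h1) h2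
      rwa [sub_add_cancel] at h3

theorem span_eq_of_hasInd {g : Fin N → Fin N → K[X]} {S : Submodule K[X] (Fin N → K[X])}
    (hg : ∀ s, g s ∈ S) (hind : ∀ s, HasInd (g s) s)
    (hdvd : ∀ v ∈ S, ∀ s, HasInd v s → g s s ∣ v s) :
    Submodule.span K[X] (Set.range g) = S := by
  refine le_antisymm (Submodule.span_le.mpr ?_) fun v hv => ?_
  · rintro _ ⟨s, rfl⟩
    exact hg s
  · refine Submodule.span_mono ?_ (mem_span_of_hasInd hg hind hdvd N v hv fun j hj => ?_)
    · rintro _ ⟨i, -, rfl⟩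
      exact ⟨i, rfl⟩
    · exact absurd j.2 (not_lt.mpr hj)

end AlgorithmG

/-! ### Valuations, Riemann's inequality and Weierstrass gaps -/

section Curves

variable {K F : Type*} [Field K] [Field F] [Algebra K F]

section Val

variable (v : AddValuation F (WithTop ℤ))

theorem exists_val_eq {z : F} (hz : z ≠ 0) : ∃ k : ℤ, v z = (k : WithTop ℤ) := by
  obtain ⟨k, hk⟩ := WithTop.ne_top_iff_exists.mp (v.ne_top_iff.mpr hz)
  exact ⟨k, hk.symm⟩

theorem ne_zero_of_val_eq {z : F} {k : ℤ} (h : v z = (k : WithTop ℤ)) : z ≠ 0 := by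
  rintro rfl
  simp at h

theorem le_val_mul {x y : F} {a b : ℤ} (hx : (a : WithTop ℤ) ≤ v x) (hy : (b : WithTop ℤ) ≤ v y) :
    ((a + b : ℤ) : WithTop ℤ) ≤ v (x * y) := by
  rw [v.map_mul, WithTop.coe_add]
  exact add_le_add hx hy

theorem lt_val_mul {x y : F} {a b : ℤ} (hx : (a : WithTop ℤ) < v x) (hy : (b : WithTop ℤ) ≤ v y) :
    ((a + b : ℤ) : WithTop ℤ) < v (x * y) := by
  by_cases hx0 : x = 0
  · simp [hx0]
  by_cases hy0 : y = 0
  · simp [hy0]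
  obtain ⟨k, hk⟩ := exists_val_eq v hx0
  obtain ⟨l, hl⟩ := exists_val_eq v hy0
  rw [hk] at hx
  rw [hl] at hy
  rw [v.map_mul, hk, hl]
  norm_cast at *
  omega

theorem val_mul_eq {x y : F} {a b : ℤ} (hx : v x = (a : WithTop ℤ)) (hy : v y = (b : WithTop ℤ)) :
    v (x * y) = ((a + b : ℤ) : WithTop ℤ) := by
  rw [v.map_mul, hx, hy, WithTop.coe_add]

theorem le_val_pow {x : F} {a : ℤ} (hx : (a : WithTop ℤ) ≤ v x) (n : ℕ) :
    ((n * a : ℤ) : WithTop ℤ) ≤ v (x ^ n) := by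
  induction n with
  | zero => simp
  | succ n ih =>
    rw [pow_succ]
    have := le_val_mul v ih hx
    rwa [show ((n + 1 : ℕ) : ℤ) * a = n * a + a by push_cast; ring]

theorem val_pow_eq {x : F} {a : ℤ} (hx : v x = (a : WithTop ℤ)) (n : ℕ) :
    v (x ^ n) = ((n * a : ℤ) : WithTop ℤ) := by
  induction n with
  | zero => simp
  | succ n ih =>
    rw [pow_succ, val_mul_eq v ih hx]
    congr 1
    push_cast
    ring

theorem val_div_eq {x y : F} {a b : ℤ} (hx : v x = (a : WithTop ℤ)) (hy : v y = (b : WithTop ℤ)) :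
    v (x / y) = ((a - b : ℤ) : WithTop ℤ) := by
  have hy0 := ne_zero_of_val_eq v hy
  obtain ⟨k, hk⟩ := exists_val_eq v (div_ne_zero (ne_zero_of_val_eq v hx) hy0)
  have h := val_mul_eq v hk hy
  rw [div_mul_cancel₀ _ hy0, hx] at h
  rw [hk]
  norm_cast at *
  omega

theorem le_val_div {x y : F} {a b : ℤ} (hx : (a : WithTop ℤ) ≤ v x) (hy : v y = (b : WithTop ℤ)) :
    ((a - b : ℤ) : WithTop ℤ) ≤ v (x / y) := by
  by_cases hx0 : x = 0
  · simp [hx0]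
  obtain ⟨k, hk⟩ := exists_val_eq v hx0
  rw [val_div_eq v hk hy]
  rw [hk] at hx
  norm_cast at *
  omega

/-- If the terms of a sum have pairwise distinct values, the value of the sum is their minimum. -/
theorem val_sum_of_injOn {ι : Type*} (s : Finset ι) (f : ι → F)
    (hf : ∀ i ∈ s, ∀ j ∈ s, v (f i) = v (f j) → i = j) :
    (s.Nonempty → ∃ i ∈ s, v (∑ i ∈ s, f i) = v (f i)) ∧
      ∀ i ∈ s, v (∑ i ∈ s, f i) ≤ v (f i) := by
  classical
  induction s using Finset.induction_on with
  | empty => simp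
  | insert a s ha ih =>
    obtain ⟨ih1, ih2⟩ := ih fun i hi j hj =>
      hf i (Finset.mem_insert_of_mem hi) j (Finset.mem_insert_of_mem hj)
    rw [Finset.sum_insert ha]
    rcases s.eq_empty_or_nonempty with rfl | hne
    · simp
    obtain ⟨i, hi, hiv⟩ := ih1 hne
    have hdist : v (f a) ≠ v (∑ i ∈ s, f i) := by
      rw [hiv]
      intro h
      exact ha (hf a (Finset.mem_insert_self _ _) i (Finset.mem_insert_of_mem hi) h ▸ hi)
    have hadd := v.map_add_of_distinct_val hdist
    refine ⟨fun _ => ?_, fun j hj => ?_⟩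
    · rcases min_choice (v (f a)) (v (∑ i ∈ s, f i)) with h | h
      · exact ⟨a, Finset.mem_insert_self _ _, hadd.trans h⟩
      · exact ⟨i, Finset.mem_insert_of_mem hi, (hadd.trans h).trans hiv⟩
    · rw [hadd]
      rcases Finset.mem_insert.mp hj with rfl | hj
      · exact min_le_left _ _
      · exact (min_le_right _ _).trans (ih2 j hj)

end Val

theorem Place.val_smul (P : Place K F) {c : K} (hc : c ≠ 0) (z : F) :
    P.val (algebraMap K F c * z) = P.val z := by
  rw [AddValuation.map_mul, P.val_const c hc, zero_add]

/-- Functions with pairwise distinct valuations are linearly independent over the constants. -/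
theorem linearIndependent_of_val {ι : Type*} (P : Place K F) {f : ι → F}
    (h0 : ∀ i, f i ≠ 0) (hinj : Function.Injective fun i => P.val (f i)) :
    LinearIndependent K f := by
  classical
  rw [linearIndependent_iff']
  intro s c hc i hi
  by_contra hci
  have h := (val_sum_of_injOn P.val (s.filter fun i => c i ≠ 0) (fun i => c i • f i) ?_).2 i
    (Finset.mem_filter.mpr ⟨hi, hci⟩)
  · have hsum : ∑ j ∈ s.filter (fun i => c i ≠ 0), c j • f j = 0 := by
      rw [← hc]
      refine Finset.sum_subset (Finset.filter_subset _ _) fun j hj hj' => ?_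
      have : c j = 0 := by
        by_contra h
        exact hj' (Finset.mem_filter.mpr ⟨hj, h⟩)
      rw [this, zero_smul]
    rw [hsum, AddValuation.map_zero, top_le_iff, Algebra.smul_def, P.val_smul hci,
      AddValuation.top_iff] at h
    exact h0 i h
  · intro j hj k hk hjk
    simp only [Algebra.smul_def] at hjk
    rw [P.val_smul (Finset.mem_filter.mp hj).2, P.val_smul (Finset.mem_filter.mp hk).2] at hjk
    exact hinj hjk

theorem mem_poleSpace {G : Divisor K F} {Q : Place K F} {z : F} :
    z ∈ poleSpace G Q ↔ ∀ P ≠ Q, ((-(G P) : ℤ) : WithTop ℤ) ≤ P.val z := by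
  classical
  unfold poleSpace
  rw [Set.mem_iUnion]
  constructor
  · rintro ⟨i, hi⟩ P hP
    have := hi P
    rwa [Finsupp.add_apply, Finsupp.single_eq_of_ne hP, add_zero] at this
  · intro h
    obtain ⟨i, hi⟩ : ∃ i : ℕ, ((-(G Q + i) : ℤ) : WithTop ℤ) ≤ Q.val z := by
      by_cases hz : z = 0
      · exact ⟨0, by simp [hz]⟩
      · obtain ⟨k, hk⟩ := exists_val_eq Q.val hz
        refine ⟨(-k - G Q).toNat, ?_⟩
        rw [hk]
        norm_cast
        have := Int.self_le_toNat (-k - G Q)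
        omega
    refine ⟨i, fun P => ?_⟩
    by_cases hP : P = Q
    · subst hP
      rwa [Finsupp.add_apply, Finsupp.single_eq_same]
    · rw [Finsupp.add_apply, Finsupp.single_eq_of_ne hP, add_zero]
      exact h P hP

theorem mem_regularAway {Q : Place K F} {z : F} :
    z ∈ regularAway Q ↔ ∀ P ≠ Q, 0 ≤ P.val z := by
  unfold regularAway
  rw [mem_poleSpace]
  simp

/-- The ring of functions that are regular away from `Q`. -/
def regularRing (Q : Place K F) : Subalgebra K F where
  carrier := regularAway Q
  mul_mem' := by
    intro x y hx hy
    rw [mem_regularAway] at *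
    intro P hP
    rw [AddValuation.map_mul]
    exact add_nonneg (hx P hP) (hy P hP)
  add_mem' := by
    intro x y hx hy
    rw [mem_regularAway] at *
    intro P hP
    exact (le_min (hx P hP) (hy P hP)).trans (P.val.map_add x y)
  algebraMap_mem' := by
    intro c
    rw [mem_regularAway]
    intro P _
    exact P.val_const_nonneg c

theorem mem_regularRing {Q : Place K F} {z : F} : z ∈ regularRing Q ↔ z ∈ regularAway Q := Iff.rfl

theorem mem_rrSpace_single {Q : Place K F} {i : ℤ} {z : F} :
    z ∈ rrSpace (Finsupp.single Q i) ↔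
      z ∈ regularAway Q ∧ ((-i : ℤ) : WithTop ℤ) ≤ Q.val z := by
  classical
  rw [mem_regularAway]
  constructor
  · intro h
    refine ⟨fun P hP => ?_, ?_⟩
    · have := h P
      rwa [Finsupp.single_eq_of_ne hP, neg_zero] at this
    · have := h Q
      rwa [Finsupp.single_eq_same] at this
  · rintro ⟨h1, h2⟩ P
    by_cases hP : P = Q
    · subst hP
      rwa [Finsupp.single_eq_same]
    · rw [Finsupp.single_eq_of_ne hP, neg_zero]
      exact h1 P hP

theorem exists_const_of_degree_one {P : Place K F} (hP : P.degree = 1) {z : F}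
    (hz : 0 ≤ P.val z) : ∃ c : K, 0 < P.val (z - algebraMap K F c) := by
  have h1 : (1 : F) ∈ P.valRing := by
    change 0 ≤ P.val 1
    simp
  have hne : (Submodule.Quotient.mk (⟨1, h1⟩ : P.valRing) :
      P.valRing ⧸ P.maxIdeal.submoduleOf P.valRing) ≠ 0 := by
    rw [Ne, Submodule.Quotient.mk_eq_zero]
    change ¬ (0 < P.val 1)
    simp
  obtain ⟨c, hc⟩ := (finrank_eq_one_iff_of_nonzero' _ hne).mp hP
    (Submodule.Quotient.mk (⟨z, hz⟩ : P.valRing))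
  refine ⟨c, ?_⟩
  rw [← Submodule.Quotient.mk_smul, eq_comm, Submodule.Quotient.eq] at hc
  have : 0 < P.val (z - c • (1 : F)) := hc
  rwa [Algebra.smul_def, mul_one] at this

/-- At a place of degree one, leading coefficients can be cancelled. -/
theorem exists_cancel {P : Place K F} (hP : P.degree = 1) {x z : F} (hz : z ≠ 0)
    (hxz : P.val z ≤ P.val x) : ∃ c : K, P.val z < P.val (x - algebraMap K F c * z) := by
  obtain ⟨k, hk⟩ := exists_val_eq P.val hz
  have h1 : 0 ≤ P.val (x / z) := by
    have := le_val_div P.val (hk ▸ hxz) hk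
    simpa using this
  obtain ⟨c, hc⟩ := exists_const_of_degree_one hP h1
  refine ⟨c, ?_⟩
  have h2 := lt_val_mul P.val (a := 0) (by simpa using hc) hk.ge
  rwa [sub_mul, div_mul_cancel₀ _ hz, zero_add, ← hk] at h2

theorem le_genus {g : ℕ} (hg : genus K F = (g : ℕ∞)) (A : Divisor K F) :
    divDegree A - (Module.finrank K (rrSpace A) : ℤ) + 1 ≤ g := by
  have h1 : (((divDegree A - (Module.finrank K (rrSpace A) : ℤ) + 1).toNat : ℕ) : ℕ∞) ≤
      (g : ℕ∞) := by
    rw [← hg]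
    exact le_iSup (fun A : Divisor K F =>
      (((divDegree A - (Module.finrank K (rrSpace A) : ℤ) + 1).toNat : ℕ) : ℕ∞)) A
  have h2 := Nat.cast_le.mp h1
  have h3 := Int.self_le_toNat (divDegree A - (Module.finrank K (rrSpace A) : ℤ) + 1)
  omega

theorem divDegree_single (Q : Place K F) (i : ℤ) :
    divDegree (Finsupp.single Q i) = i * Q.degree := by
  unfold divDegree
  rw [Finsupp.sum_single_index (by simp)]

theorem divDegree_add (A B : Divisor K F) : divDegree (A + B) = divDegree A + divDegree B := by
  classical
  unfold divDegree
  rw [Finsupp.sum_add_index] <;> intros <;> ring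

theorem divDegree_sum {ι : Type*} (s : Finset ι) (A : ι → Divisor K F) :
    divDegree (∑ i ∈ s, A i) = ∑ i ∈ s, divDegree (A i) := by
  classical
  induction s using Finset.induction_on with
  | empty => simp [divDegree]
  | insert a s ha ih => rw [Finset.sum_insert ha, Finset.sum_insert ha, divDegree_add, ih]

section Genus

variable {g : ℕ} {Q : Place K F}

/-- `finrank` is `0` for an infinite-dimensional space. Riemann's inequality makes it positive in
degree at least `g`, and this already forces finite dimension. -/
theorem finiteDimensional_rrSpace_single (hg : genus K F = (g : ℕ∞)) (hQ : Q.degree = 1)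
    (i : ℤ) :
    FiniteDimensional K (rrSpace (Finsupp.single Q i)) := by
  have h1 : FiniteDimensional K (rrSpace (Finsupp.single Q (max i g))) := by
    refine Module.finite_of_finrank_pos ?_
    have := le_genus hg (Finsupp.single Q (max i g))
    rw [divDegree_single, hQ] at this
    omega
  refine Submodule.finiteDimensional_of_le (S₂ := rrSpace (Finsupp.single Q (max i g))) ?_
  intro z hz
  rw [mem_rrSpace_single] at *
  refine ⟨hz.1, le_trans ?_ hz.2⟩
  norm_cast
  omega

/-- Otherwise the powers of `z` would be infinitely many independent elements of the
finite-dimensional space `L(0)`. -/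
theorem val_nonpos_of_regularAway (hg : genus K F = (g : ℕ∞)) (hQ : Q.degree = 1)
    {z : F} (hz : z ∈ regularAway Q) (hz0 : z ≠ 0) :
    Q.val z ≤ 0 := by
  by_contra hpos
  rw [not_le] at hpos
  obtain ⟨k, hk⟩ := exists_val_eq Q.val hz0
  have hk0 : 0 < k := by
    rw [hk] at hpos
    exact_mod_cast hpos
  have := finiteDimensional_rrSpace_single hg hQ 0
  have hmem : ∀ e : ℕ, z ^ e ∈ rrSpace (Finsupp.single Q 0) := by
    intro e
    rw [mem_rrSpace_single]
    refine ⟨(regularRing Q).pow_mem hz e, ?_⟩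
    rw [val_pow_eq Q.val hk]
    norm_cast
    have : 0 ≤ (e : ℤ) * k := by positivity
    omega
  have hli : LinearIndependent K fun e : ℕ => z ^ e := by
    refine linearIndependent_of_val Q (fun e => pow_ne_zero e hz0) fun a b hab => ?_
    simp only [val_pow_eq Q.val hk] at hab
    norm_cast at hab
    have := mul_right_cancel₀ hk0.ne' hab
    exact_mod_cast this
  have hli' : LinearIndependent K fun e : ℕ => (⟨z ^ e, hmem e⟩ : rrSpace (Finsupp.single Q 0)) :=
    LinearIndependent.of_comp (rrSpace (Finsupp.single Q 0)).subtype hli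
  have hfin := hli'.finite
  exact not_finite ℕ

theorem exists_poleOrder (hg : genus K F = (g : ℕ∞)) (hQ : Q.degree = 1)
    {z : F} (hz : z ∈ regularAway Q) (hz0 : z ≠ 0) :
    ∃ s : ℕ, s ∈ weierstrass Q ∧ Q.val z = ((-(s : ℤ) : ℤ) : WithTop ℤ) := by
  obtain ⟨k, hk⟩ := exists_val_eq Q.val hz0
  have h1 := val_nonpos_of_regularAway hg hQ hz hz0
  rw [hk] at h1
  norm_cast at h1
  have h2 : Q.val z = ((-((-k).toNat : ℤ) : ℤ) : WithTop ℤ) := by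
    rw [hk]
    norm_cast
    omega
  exact ⟨(-k).toNat, ⟨z, hz, h2⟩, h2⟩

-- At a place of degree one, each non-gap raises the dimension by at most one, and a gap does not
-- raise it.
open Classical in
theorem finrank_rrSpace_single_le (hg : genus K F = (g : ℕ∞)) (hQ : Q.degree = 1) (i : ℕ) :
    Module.finrank K (rrSpace (Finsupp.single Q ((i : ℤ) - 1))) ≤
      ((Finset.range i).filter fun s => s ∈ weierstrass Q).card := by
  induction i with
  | zero =>
    have : rrSpace (Finsupp.single Q (((0 : ℕ) : ℤ) - 1)) = ⊥ := by
      rw [eq_bot_iff]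
      intro z hz
      rw [mem_rrSpace_single] at hz
      rw [Submodule.mem_bot]
      by_contra hz0
      have h1 := hz.2.trans (val_nonpos_of_regularAway hg hQ hz.1 hz0)
      norm_cast at h1
    rw [this, finrank_bot]
    exact Nat.zero_le _
  | succ i ih =>
    rw [Finset.range_add_one, Finset.filter_insert]
    have hfd := finiteDimensional_rrSpace_single hg hQ ((i : ℤ) - 1)
    split_ifs with hi
    · rw [Finset.card_insert_of_notMem (by simp)]
      obtain ⟨x, hx, hxv⟩ := hi
      have hx0 := ne_zero_of_val_eq Q.val hxv
      have hle : rrSpace (Finsupp.single Q (((i + 1 : ℕ) : ℤ) - 1)) ≤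
          rrSpace (Finsupp.single Q ((i : ℤ) - 1)) ⊔ Submodule.span K {x} := by
        intro z hz
        rw [mem_rrSpace_single] at hz
        obtain ⟨c, hc⟩ := exists_cancel hQ hx0 (x := z) (by
          rw [hxv]
          refine le_trans ?_ hz.2
          rw [WithTop.coe_le_coe]
          push_cast
          omega)
        have h1 : z - algebraMap K F c * x ∈ rrSpace (Finsupp.single Q ((i : ℤ) - 1)) := by
          rw [mem_rrSpace_single]
          refine ⟨(regularRing Q).sub_mem hz.1
            ((regularRing Q).mul_mem ((regularRing Q).algebraMap_mem c) hx), ?_⟩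
          by_cases h0 : z - algebraMap K F c * x = 0
          · simp [h0]
          · obtain ⟨k, hk⟩ := exists_val_eq Q.val h0
            rw [hk, hxv, WithTop.coe_lt_coe] at hc
            rw [hk, WithTop.coe_le_coe]
            omega
        have h2 : algebraMap K F c * x ∈ Submodule.span K {x} := by
          rw [← Algebra.smul_def]
          exact Submodule.smul_mem _ _ (Submodule.mem_span_singleton_self x)
        have h3 := Submodule.add_mem_sup h1 h2
        rwa [sub_add_cancel] at h3
      have h1 := Submodule.finrank_mono hle
      have h2 := Submodule.finrank_add_le_finrank_add_finrank
        (rrSpace (Finsupp.single Q ((i : ℤ) - 1))) (Submodule.span K {x})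
      rw [finrank_span_singleton hx0] at h2
      omega
    · refine le_trans (Submodule.finrank_mono ?_) ih
      intro z hz
      rw [mem_rrSpace_single] at *
      refine ⟨hz.1, ?_⟩
      by_cases hz0 : z = 0
      · simp [hz0]
      obtain ⟨s, hs, hsv⟩ := exists_poleOrder hg hQ hz.1 hz0
      have h1 := hz.2
      rw [hsv, WithTop.coe_le_coe] at h1 ⊢
      have h2 : s ≠ i := fun h => hi (h ▸ hs)
      push_cast at h1
      omega

/-- The Weierstrass semigroup has only finitely many gaps. -/
theorem finite_compl_weierstrass (hg : genus K F = (g : ℕ∞)) (hQ : Q.degree = 1) :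
    (weierstrass Q)ᶜ.Finite := by
  classical
  by_contra hinf
  -- With `g + 1` gaps below `b`, the dimension of `L((b-1)Q)` is at most `b - g - 1`, contradicting
  -- Riemann's inequality.
  obtain ⟨t, ht, hcard⟩ := (Set.not_finite.mp hinf).exists_subset_card_eq (g + 1)
  obtain ⟨b, hb⟩ := t.exists_nat_subset_range
  have h1 := le_genus hg (Finsupp.single Q ((b : ℤ) - 1))
  rw [divDegree_single, hQ] at h1
  have h2 := finrank_rrSpace_single_le hg hQ b
  have h3 := Finset.card_filter_add_card_filter_not (s := Finset.range b) (fun s => s ∈ weierstrass Q)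
  have h4 : t ⊆ (Finset.range b).filter fun s => s ∉ weierstrass Q := fun s hs =>
    Finset.mem_filter.mpr ⟨hb hs, ht hs⟩
  have h5 := Finset.card_le_card h4
  rw [Finset.card_range] at h3
  push_cast at h1
  omega

/-- A residue class is infinite and the gaps are finite in number, so the infimum is taken over a
nonempty set and is attained. -/
theorem residueMin_spec (hg : genus K F = (g : ℕ∞)) (hQ : Q.degree = 1) {a : ℕ} (ha : 0 < a)
    (j : ℕ) : residueMin Q a j ∈ weierstrass Q ∧ residueMin Q a j ≡ j [MOD a] ∧
      ∀ s ∈ weierstrass Q, s ≡ j [MOD a] → residueMin Q a j ≤ s := by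
  have hne : {s | s ∈ weierstrass Q ∧ s ≡ j [MOD a]}.Nonempty := by
    by_contra hemp
    rw [Set.not_nonempty_iff_eq_empty] at hemp
    refine Set.infinite_of_injective_forall_mem (f := fun k : ℕ => a * k + j) (fun x y h => ?_)
      (fun k => ?_) (finite_compl_weierstrass hg hQ)
    · simp only [Nat.add_right_cancel_iff] at h
      exact Nat.eq_of_mul_eq_mul_left ha h
    · intro hk
      have : a * k + j ∈ ({s | s ∈ weierstrass Q ∧ s ≡ j [MOD a]} : Set ℕ) :=
        ⟨hk, by simp [Nat.ModEq]⟩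
      rw [hemp] at this
      exact this
  have h := Nat.sInf_mem hne
  exact ⟨h.1, h.2, fun s hs hsj => Nat.sInf_le ⟨hs, hsj⟩⟩

/-- The dimension of `L(0)` is at most one. -/
theorem finrank_rrSpace_zero_le (hg : genus K F = (g : ℕ∞)) (hQ : Q.degree = 1) :
    Module.finrank K (rrSpace (Finsupp.single Q (0 : ℤ))) ≤ 1 := by
  classical
  have h := finrank_rrSpace_single_le hg hQ 1
  have h2 := Finset.card_filter_le (Finset.range 1) (fun s => s ∈ weierstrass Q)
  rw [Finset.card_range] at h2
  rw [show ((1 : ℕ) : ℤ) - 1 = 0 by norm_num] at h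
  omega

end Genus

end Curves

/-! ### The basis of `L(∞Q)` over `K[x₁]` -/

section Curves

variable {K F : Type*} [Field K] [Field F] [Algebra K F]

/-- Positive weights leave finitely many exponent vectors of a given weighted degree, and among
these the `≺`-minimum is the lexicographic maximum. -/
theorem exists_isMinExponent {t : ℕ} {a : Fin t → ℕ} (ha : ∀ i, 0 < a i) {s : ℕ}
    (hs : ∃ e, wdeg a e = s) : ∃ e, IsMinExponent a s e := by
  classical
  have hfin : {e : Fin t → ℕ | wdeg a e = s}.Finite := by
    refine (Set.finite_Iic (fun _ : Fin t => s)).subset fun e he i => ?_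
    have h1 : a i * e i ≤ wdeg a e :=
      Finset.single_le_sum (f := fun i => a i * e i) (fun _ _ => Nat.zero_le _) (Finset.mem_univ i)
    exact (Nat.le_mul_of_pos_left _ (ha i)).trans (h1.trans_eq he)
  obtain ⟨e, he, hmax⟩ := hfin.toFinset.exists_max_image
    (fun e => (toLex e : Lex (Fin t → ℕ))) (by
      obtain ⟨e, he⟩ := hs
      exact ⟨e, hfin.mem_toFinset.mpr he⟩)
  simp only [Set.Finite.mem_toFinset, Set.mem_ofPred_eq] at he hmax
  refine ⟨e, he, fun e' he' => ?_⟩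
  rcases (hmax e' he').lt_or_eq with h | h
  · obtain ⟨i, h1, h2⟩ := h
    exact Or.inr (Or.inr ⟨he.trans he'.symm, i, fun j hj => (h1 j hj).symm, h2⟩)
  · exact Or.inl (toLex.injective h)

theorem wdeg_minExponent {t : ℕ} {a : Fin t → ℕ} (ha : ∀ i, 0 < a i) {s : ℕ}
    (hs : s ∈ AddSubmonoid.closure (Set.range a)) : wdeg a (minExponent a s) = s := by
  have hex : ∃ e, wdeg a e = s := by
    induction hs using AddSubmonoid.closure_induction with
    | mem x hx =>
      obtain ⟨i, rfl⟩ := hx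
      exact ⟨Pi.single i 1, by simp [wdeg, Pi.single_apply]⟩
    | zero => exact ⟨0, by simp [wdeg]⟩
    | add x y _ _ hx hy =>
      obtain ⟨e, rfl⟩ := hx
      obtain ⟨e', rfl⟩ := hy
      exact ⟨e + e', by simp [wdeg, mul_add, Finset.sum_add_distrib]⟩
  have h := exists_isMinExponent ha hex
  unfold minExponent
  rw [dif_pos h]
  exact h.choose_spec.1

theorem HasPoleDivisor.val_eq {Q : Place K F} {z : F} {a : ℕ} (ha : 0 < a)
    (h : HasPoleDivisor z (Finsupp.single Q (a : ℤ))) :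
    z ∈ regularAway Q ∧ Q.val z = ((-(a : ℤ) : ℤ) : WithTop ℤ) := by
  classical
  constructor
  · rw [mem_regularAway]
    intro P hP
    have := h P
    rw [Finsupp.single_eq_of_ne hP, neg_zero, WithTop.coe_zero, min_eq_right_iff] at this
    exact this
  · have := h Q
    rw [Finsupp.single_eq_same] at this
    rcases min_choice (Q.val z) 0 with h1 | h1
    · rw [← h1, this]
    · rw [h1] at this
      norm_cast at this
      omega

theorem val_prod_eq {ι : Type*} (v : AddValuation F (WithTop ℤ)) (s : Finset ι) (f : ι → F)
    (k : ι → ℤ) (h : ∀ i ∈ s, v (f i) = (k i : WithTop ℤ)) :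
    v (∏ i ∈ s, f i) = ((∑ i ∈ s, k i : ℤ) : WithTop ℤ) := by
  classical
  induction s using Finset.induction_on with
  | empty => simp
  | insert i s hi ih =>
    rw [Finset.prod_insert hi, Finset.sum_insert hi]
    exact val_mul_eq v (h i (Finset.mem_insert_self _ _))
      (ih fun j hj => h j (Finset.mem_insert_of_mem hj))

/-- Functions `x₁` and `y_0, …, y_{a-1}` in `L(∞Q)`, with pole orders `a` and `b_j`, where `b_j` is
the least pole order that is congruent to `j` modulo `a`. -/
structure IsPoleBasis (Q : Place K F) (a : ℕ) (x₁ : F) (y : ℕ → F) (b : ℕ → ℕ) : Prop where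
  deg : Q.degree = 1
  pole : ∀ z ∈ regularAway Q, z ≠ 0 →
    ∃ s : ℕ, s ∈ weierstrass Q ∧ Q.val z = ((-(s : ℤ) : ℤ) : WithTop ℤ)
  pos : 0 < a
  x_mem : x₁ ∈ regularRing Q
  x_val : Q.val x₁ = ((-(a : ℤ) : ℤ) : WithTop ℤ)
  y_mem : ∀ j, y j ∈ regularRing Q
  y_val : ∀ j, Q.val (y j) = ((-(b j : ℤ) : ℤ) : WithTop ℤ)
  b_mod : ∀ j, b j ≡ j [MOD a]
  b_min : ∀ j, ∀ s ∈ weierstrass Q, s ≡ j [MOD a] → b j ≤ s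

/-- Only the weighted degree of the chosen exponent vector enters, because it is the pole order of
the monomial. The lexicographic choice has no further effect. -/
theorem isPoleBasis_basisElt {g : ℕ} {Q : Place K F} (hg : genus K F = (g : ℕ∞))
    (hQ : Q.degree = 1) {t : ℕ} {a : Fin (t + 1) → ℕ} (ha : ∀ i, 0 < a i)
    (hgen : (AddSubmonoid.closure (Set.range a) : Set ℕ) = weierstrass Q)
    {x : Fin (t + 1) → F} (hx : ∀ i, HasPoleDivisor (x i) (Finsupp.single Q (a i : ℤ))) :
    IsPoleBasis Q (a 0) (x 0) (basisElt Q a x) (residueMin Q (a 0)) := by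
  refine ⟨hQ, fun z hz hz0 => exists_poleOrder hg hQ hz hz0, ha 0, ((hx 0).val_eq (ha 0)).1,
    ((hx 0).val_eq (ha 0)).2, fun j => ?_, fun j => ?_,
    fun j => (residueMin_spec hg hQ (ha 0) j).2.1, fun j => (residueMin_spec hg hQ (ha 0) j).2.2⟩
  · exact Subalgebra.prod_mem _ fun i _ => Subalgebra.pow_mem _ ((hx i).val_eq (ha i)).1 _
  · have hmem : residueMin Q (a 0) j ∈ AddSubmonoid.closure (Set.range a) := by
      rw [← SetLike.mem_coe, hgen]
      exact (residueMin_spec hg hQ (ha 0) j).1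
    have h1 := wdeg_minExponent ha hmem
    unfold basisElt
    rw [val_prod_eq Q.val _ _ (fun i => (minExponent a (residueMin Q (a 0) j) i : ℤ) * -(a i : ℤ))
      fun i _ => val_pow_eq Q.val ((hx i).val_eq (ha i)).2 _]
    congr 1
    conv_rhs => rw [← h1]
    unfold wdeg
    push_cast
    rw [← Finset.sum_neg_distrib]
    exact Finset.sum_congr rfl fun i _ => by ring

/-- The combination `∑ p_j(x₁) y_j`. -/
noncomputable def comb (a : ℕ) (x₁ : F) (y : ℕ → F) (p : Fin a → K[X]) : F :=
  ∑ j : Fin a, aeval x₁ (p j) * y j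

namespace IsPoleBasis

variable {Q : Place K F} {a : ℕ} {x₁ : F} {y : ℕ → F} {b : ℕ → ℕ}

theorem val_aeval (h : IsPoleBasis Q a x₁ y b) {p : K[X]} (hp : p ≠ 0) :
    Q.val (aeval x₁ p) = ((-((a : ℤ) * p.natDegree) : ℤ) : WithTop ℤ) := by
  have hterm : ∀ e ∈ p.support, Q.val (algebraMap K F (p.coeff e) * x₁ ^ e) =
      ((-((a : ℤ) * e) : ℤ) : WithTop ℤ) := by
    intro e he
    rw [Q.val_smul (mem_support_iff.mp he), val_pow_eq Q.val h.x_val]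
    congr 1
    ring
  have ha : (a : ℤ) ≠ 0 := by exact_mod_cast h.pos.ne'
  obtain ⟨h1, h2⟩ := val_sum_of_injOn Q.val p.support
    (fun e => algebraMap K F (p.coeff e) * x₁ ^ e) (by
      intro i hi j hj hij
      rw [hterm i hi, hterm j hj, WithTop.coe_inj, neg_inj] at hij
      exact_mod_cast mul_left_cancel₀ ha hij)
  obtain ⟨i, hi, hiv⟩ := h1 (support_nonempty.mpr hp)
  have h3 := h2 p.natDegree (natDegree_mem_support_of_nonzero hp)
  rw [hiv, hterm i hi, hterm _ (natDegree_mem_support_of_nonzero hp), WithTop.coe_le_coe] at h3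
  have h4 : i ≤ p.natDegree := le_natDegree_of_mem_supp i hi
  have h5 : p.natDegree ≤ i := by
    have : (a : ℤ) * p.natDegree ≤ a * i := by linarith
    exact_mod_cast le_of_mul_le_mul_left this (by exact_mod_cast h.pos)
  have h6 : i = p.natDegree := le_antisymm h4 h5
  rw [aeval_eq_sum_range, ← h6, ← hterm i hi, ← hiv]
  congr 1
  rw [h6]
  symm
  refine Finset.sum_subset_zero_on_sdiff (fun e he => ?_) (fun e he => ?_) (fun e _ => ?_)
  · exact Finset.mem_range_succ_iff.mpr (le_natDegree_of_mem_supp e he)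
  · rw [Finset.mem_sdiff, notMem_support_iff] at he
    rw [he.2, zero_smul]
  · rw [Algebra.smul_def]

theorem aeval_mem (h : IsPoleBasis Q a x₁ y b) (p : K[X]) : aeval x₁ p ∈ regularRing Q := by
  rw [aeval_eq_sum_range]
  exact Subalgebra.sum_mem _ fun e _ => Subalgebra.smul_mem _ (Subalgebra.pow_mem _ h.x_mem e) _

/-- The pole order of the `j`-th summand is congruent to `j` modulo `a`. The summands thus have
distinct valuations and cannot cancel. -/
theorem val_comb_le (h : IsPoleBasis Q a x₁ y b) {p : Fin a → K[X]} {j : Fin a} (hj : p j ≠ 0) :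
    Q.val (comb a x₁ y p) ≤ ((-((a : ℤ) * (p j).natDegree + b j) : ℤ) : WithTop ℤ) := by
  classical
  have hterm : ∀ j : Fin a, p j ≠ 0 → Q.val (aeval x₁ (p j) * y j) =
      ((-((a : ℤ) * (p j).natDegree + b j) : ℤ) : WithTop ℤ) := by
    intro j hj
    rw [val_mul_eq Q.val (h.val_aeval hj) (h.y_val j)]
    congr 1
    ring
  have hsum : comb a x₁ y p = ∑ j : Fin a with p j ≠ 0, aeval x₁ (p j) * y j := by
    unfold comb
    symm
    refine Finset.sum_subset (Finset.filter_subset _ _) fun j _ hj => ?_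
    have : p j = 0 := by
      by_contra hne
      exact hj (Finset.mem_filter.mpr ⟨Finset.mem_univ _, hne⟩)
    simp [this]
  rw [hsum, ← hterm j hj]
  refine (val_sum_of_injOn Q.val _ (fun j : Fin a => aeval x₁ (p j) * y j) ?_).2 j
    (Finset.mem_filter.mpr ⟨Finset.mem_univ _, hj⟩)
  intro i hi k hk hik
  rw [hterm i (Finset.mem_filter.mp hi).2, hterm k (Finset.mem_filter.mp hk).2, WithTop.coe_inj,
    neg_inj] at hik
  have h1 : a * (p i).natDegree + b i = a * (p k).natDegree + b k := by exact_mod_cast hik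
  have h2 : b i ≡ b k [MOD a] := by
    have : (a * (p i).natDegree + b i) % a = (a * (p k).natDegree + b k) % a := by rw [h1]
    simpa [Nat.ModEq, Nat.mul_add_mod] using this
  have h3 : (i : ℕ) ≡ k [MOD a] := ((h.b_mod i).symm.trans h2).trans (h.b_mod k)
  rw [Nat.ModEq, Nat.mod_eq_of_lt i.2, Nat.mod_eq_of_lt k.2] at h3
  exact Fin.ext h3

theorem wt_le_of_le_val (h : IsPoleBasis Q a x₁ y b) {p : Fin a → K[X]} {B : ℤ}
    (hB : ((-B : ℤ) : WithTop ℤ) ≤ Q.val (comb a x₁ y p)) {j : Fin a} (hj : p j ≠ 0) :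
    (a : ℤ) * (p j).natDegree + b j ≤ B := by
  have := hB.trans (h.val_comb_le hj)
  rw [WithTop.coe_le_coe] at this
  omega

theorem comb_sub (p q : Fin a → K[X]) :
    comb a x₁ y (p - q) = comb a x₁ y p - comb a x₁ y q := by
  simp [comb, sub_mul, Finset.sum_sub_distrib]

theorem comb_injective (h : IsPoleBasis Q a x₁ y b) {p q : Fin a → K[X]}
    (hpq : comb a x₁ y p = comb a x₁ y q) : p = q := by
  funext j
  by_contra hne
  have h1 := h.val_comb_le (p := p - q) (j := j) (sub_ne_zero.mpr hne)
  rw [comb_sub, hpq, sub_self, AddValuation.map_zero, top_le_iff] at h1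
  exact WithTop.coe_ne_top h1

/-- Induction on the pole order: it is at least the `b_j` of its class, so some `x₁ ^ e y_j` has the
same pole order and cancels the leading term at `Q`. -/
theorem exists_comb (h : IsPoleBasis Q a x₁ y b) {z : F} (hz : z ∈ regularRing Q) :
    ∃ p : Fin a → K[X], comb a x₁ y p = z := by
  classical
  have main : ∀ (s : ℕ) (z : F), z ∈ regularRing Q → ((-(s : ℤ) + 1 : ℤ) : WithTop ℤ) ≤ Q.val z →
      ∃ p : Fin a → K[X], comb a x₁ y p = z := by
    intro s
    induction s with
    | zero =>
      intro z hz hv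
      by_cases hz0 : z = 0
      · exact ⟨0, by simp [comb, hz0]⟩
      · obtain ⟨s, -, hs⟩ := h.pole z hz hz0
        rw [hs, WithTop.coe_le_coe] at hv
        push_cast at hv
        omega
    | succ s ih =>
      intro z hz hv
      by_cases hz0 : z = 0
      · exact ⟨0, by simp [comb, hz0]⟩
      obtain ⟨s', hs', hsv⟩ := h.pole z hz hz0
      by_cases hss : s' = s
      · subst hss
        let j : Fin a := ⟨s' % a, Nat.mod_lt _ h.pos⟩
        have hle : b j ≤ s' := h.b_min j s' hs' (Nat.mod_modEq _ _).symm
        have hmod : b j ≡ s' [MOD a] := (h.b_mod j).trans (Nat.mod_modEq _ _)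
        obtain ⟨e, he⟩ := (Nat.modEq_iff_dvd' hle).mp hmod
        have hval : Q.val (x₁ ^ e * y j) = ((-(s' : ℤ) : ℤ) : WithTop ℤ) := by
          rw [val_mul_eq Q.val (val_pow_eq Q.val h.x_val e) (h.y_val j)]
          congr 1
          have : (s' : ℤ) - b j = a * e := by
            rw [← Nat.cast_sub hle, he]
            push_cast
            ring
          linarith
        obtain ⟨c, hc⟩ := exists_cancel h.deg (ne_zero_of_val_eq _ hval) (hval.trans hsv.symm).le
        have hmem : z - algebraMap K F c * (x₁ ^ e * y j) ∈ regularRing Q :=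
          Subalgebra.sub_mem _ hz (Subalgebra.mul_mem _ (Subalgebra.algebraMap_mem _ c)
            (Subalgebra.mul_mem _ (Subalgebra.pow_mem _ h.x_mem e) (h.y_mem j)))
        obtain ⟨p, hp⟩ := ih _ hmem (by
          by_cases h0 : z - algebraMap K F c * (x₁ ^ e * y j) = 0
          · simp [h0]
          · obtain ⟨k, hk⟩ := exists_val_eq Q.val h0
            rw [hk, hval, WithTop.coe_lt_coe] at hc
            rw [hk, WithTop.coe_le_coe]
            omega)
        refine ⟨p - Pi.single j (-(C c * X ^ e)), ?_⟩
        rw [comb_sub, hp]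
        have : comb a x₁ y (Pi.single j (-(C c * X ^ e)) : Fin a → K[X]) =
            -(algebraMap K F c * (x₁ ^ e * y j)) := by
          unfold comb
          rw [Finset.sum_eq_single j]
          · simp [mul_assoc]
          · intro k _ hk
            simp [Pi.single_eq_of_ne hk]
          · simp
        rw [this]
        ring
      · refine ih z hz ?_
        rw [hsv, WithTop.coe_le_coe] at hv ⊢
        push_cast at hv
        omega
  by_cases hz0 : z = 0
  · exact ⟨0, by simp [comb, hz0]⟩
  obtain ⟨s, -, hs⟩ := h.pole z hz hz0
  refine main (s + 1) z hz ?_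
  rw [hs, WithTop.coe_le_coe]
  push_cast
  omega

end IsPoleBasis

end Curves

/-! ### Coordinates, multiplicities and functions with zero divisor `D` -/

section Curves

variable {K F : Type*} [Field K] [Field F] [Algebra K F]

/-- The coordinates of `v` that belong to the power `Z ^ k`. -/
noncomputable def block (a : ℕ) {N : ℕ} (v : Fin N → K[X]) (k : ℕ) (j : Fin a) : K[X] :=
  if h : (j : ℕ) + a * k < N then v ⟨j + a * k, h⟩ else 0

theorem block_div_mod {a : ℕ} (ha : 0 < a) {N : ℕ} (v : Fin N → K[X]) (i : Fin N) :
    block a v (i / a) ⟨i % a, Nat.mod_lt _ ha⟩ = v i := by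
  have h : (i : ℕ) % a + a * (i / a) = i := Nat.mod_add_div _ _
  unfold block
  simp only [h, i.2, dif_pos, Fin.eta]

theorem coeff_ofCoords {a : ℕ} (ha : 0 < a) (x₁ : F) (y : ℕ → F) {N : ℕ} (v : Fin N → K[X])
    (k : ℕ) : (ofCoords a x₁ y v).coeff k = comb a x₁ y (block a v k) := by
  classical
  unfold ofCoords comb
  rw [finsetSum_coeff]
  -- The condition `i / a = k` is spread over the positions `j` within block `k`, so that the two
  -- sums can be exchanged.
  have h1 : ∀ i : Fin N, (C (aeval x₁ (v i) * y ((i : ℕ) % a)) * X ^ ((i : ℕ) / a)).coeff k =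
      ∑ j : Fin a, if (i : ℕ) = j + a * k then aeval x₁ (v i) * y ((i : ℕ) % a) else 0 := by
    intro i
    rw [coeff_C_mul_X_pow]
    by_cases hk : k = (i : ℕ) / a
    · rw [if_pos hk, Finset.sum_eq_single (⟨i % a, Nat.mod_lt _ ha⟩ : Fin a)]
      · rw [if_pos]
        rw [hk]
        exact (Nat.mod_add_div _ _).symm
      · intro j _ hj
        rw [if_neg]
        intro hij
        apply hj
        ext
        simp [hij, Nat.add_mul_mod_self_left, Nat.mod_eq_of_lt j.2]
      · simp
    · rw [if_neg hk]
      symm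
      refine Finset.sum_eq_zero fun j _ => if_neg fun hij => hk ?_
      rw [hij, Nat.add_mul_div_left _ _ ha, Nat.div_eq_of_lt j.2, zero_add]
  simp_rw [h1]
  rw [Finset.sum_comm]
  refine Finset.sum_congr rfl fun j _ => ?_
  unfold block
  by_cases h : (j : ℕ) + a * k < N
  · rw [dif_pos h, Finset.sum_eq_single (⟨j + a * k, h⟩ : Fin N)]
    · simp [Nat.mod_eq_of_lt j.2]
    · intro i _ hi
      rw [if_neg]
      intro hij
      exact hi (Fin.ext hij)
    · simp
  · rw [dif_neg h]
    rw [map_zero, zero_mul]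
    refine Finset.sum_eq_zero fun i _ => if_neg fun hij => h ?_
    rw [← hij]
    exact i.2

theorem ofCoords_add (a : ℕ) (x₁ : F) (y : ℕ → F) {N : ℕ} (v v' : Fin N → K[X]) :
    ofCoords a x₁ y (v + v') = ofCoords a x₁ y v + ofCoords a x₁ y v' := by
  simp only [ofCoords, Pi.add_apply, map_add, add_mul, Finset.sum_add_distrib]

theorem ofCoords_smul (a : ℕ) (x₁ : F) (y : ℕ → F) {N : ℕ} (p : K[X]) (v : Fin N → K[X]) :
    ofCoords a x₁ y (p • v) = C (aeval x₁ p) * ofCoords a x₁ y v := by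
  simp only [ofCoords, Pi.smul_apply, smul_eq_mul, map_mul, Finset.mul_sum, mul_assoc]

theorem natDegree_ofCoords_le {a : ℕ} (ha : 0 < a) (x₁ : F) (y : ℕ → F) {ℓ : ℕ}
    (v : Fin (a * (ℓ + 1)) → K[X]) : (ofCoords a x₁ y v).natDegree ≤ ℓ := by
  rw [natDegree_le_iff_coeff_eq_zero]
  intro k hk
  rw [coeff_ofCoords ha]
  refine Finset.sum_eq_zero fun j _ => ?_
  unfold block
  rw [dif_neg, map_zero, zero_mul]
  have : a * (ℓ + 1) ≤ a * k := Nat.mul_le_mul_left a hk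
  omega

section Multiplicity

variable {P : Place K F} {r : K}

theorem HasMultiplicity.mul {q q' : F[X]} {m m' : ℕ} (h : HasMultiplicity q P r m)
    (h' : HasMultiplicity q' P r m') : HasMultiplicity (q * q') P r (m + m') := by
  intro t
  rw [mul_comp, coeff_mul]
  refine P.val.map_le_sum fun x hx => ?_
  have hx' := Finset.HasAntidiagonal.mem_antidiagonal.mp hx
  have := le_val_mul P.val (h x.1) (h' x.2)
  refine le_trans ?_ this
  rw [WithTop.coe_le_coe, ← hx']
  push_cast
  omega

theorem HasMultiplicity.add {q q' : F[X]} {m : ℕ} (h : HasMultiplicity q P r m)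
    (h' : HasMultiplicity q' P r m) : HasMultiplicity (q + q') P r m := by
  intro t
  rw [add_comp, coeff_add]
  exact (le_min (h t) (h' t)).trans (P.val.map_add _ _)

theorem hasMultiplicity_C {z : F} {m : ℕ} (h : ((m : ℤ) : WithTop ℤ) ≤ P.val z) :
    HasMultiplicity (C z) P r m := by
  intro t
  rw [C_comp, coeff_C]
  split_ifs with ht
  · subst ht
    simpa using h
  · simp

theorem hasMultiplicity_X_sub_C {z : F} (h : 0 < P.val (z - algebraMap K F r)) :
    HasMultiplicity (X - C z) P r 1 := by
  intro t
  have hcomp : (X - C z).comp (X + C (algebraMap K F r)) = X + C (algebraMap K F r - z) := by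
    simp only [sub_comp, X_comp, C_comp, C_sub]
    ring
  rw [hcomp, coeff_add, coeff_C, coeff_X]
  rcases t with _ | _ | t
  · simp only [CharP.cast_eq_zero, if_true, one_ne_zero, if_false, zero_add]
    rw [P.val.map_sub_swap]
    by_cases hz : z - algebraMap K F r = 0
    · simp [hz]
    · obtain ⟨k, hk⟩ := exists_val_eq P.val hz
      rw [hk] at h ⊢
      norm_cast at *
  · simp
  · simp

theorem hasMultiplicity_X : HasMultiplicity (X : F[X]) P r 0 := by
  intro t
  rw [X_comp, coeff_add, coeff_C, coeff_X]
  rcases t with _ | _ | t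
  · simpa using P.val_const_nonneg r
  · simp only [zero_add, if_true, one_ne_zero, if_false, add_zero, AddValuation.map_one]
    norm_cast
  · simp

end Multiplicity

section Interpolation

variable {Q : Place K F} {n : ℕ} {P : Fin n → Place K F} {r : Fin n → K}

theorem interp_mul {q q' : F[X]} {m m' ℓ ℓ' : ℕ} (h : q ∈ interpolationModule Q P r m ℓ)
    (h' : q' ∈ interpolationModule Q P r m' ℓ') :
    q * q' ∈ interpolationModule Q P r (m + m') (ℓ + ℓ') := by
  refine ⟨natDegree_mul_le.trans (add_le_add h.1 h'.1), fun t => ?_,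
    fun i => (h.2.2 i).mul (h'.2.2 i)⟩
  rw [coeff_mul]
  exact (regularRing Q).sum_mem fun x _ => (regularRing Q).mul_mem (h.2.1 _) (h'.2.1 _)

theorem interp_add {q q' : F[X]} {m ℓ : ℕ} (h : q ∈ interpolationModule Q P r m ℓ)
    (h' : q' ∈ interpolationModule Q P r m ℓ) : q + q' ∈ interpolationModule Q P r m ℓ := by
  refine ⟨(natDegree_add_le _ _).trans (max_le h.1 h'.1), fun t => ?_,
    fun i => (h.2.2 i).add (h'.2.2 i)⟩
  rw [coeff_add]
  exact (regularRing Q).add_mem (h.2.1 _) (h'.2.1 _)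

theorem interp_C {z : F} {m : ℕ} (hz : z ∈ regularAway Q)
    (h : ∀ i, ((m : ℤ) : WithTop ℤ) ≤ (P i).val z) :
    C z ∈ interpolationModule Q P r m 0 := by
  refine ⟨by simp, fun t => ?_, fun i => hasMultiplicity_C (h i)⟩
  rw [coeff_C]
  split_ifs
  · exact hz
  · exact (regularRing Q).zero_mem

theorem interp_C_zero (hPQ : ∀ i, P i ≠ Q) {z : F} (hz : z ∈ regularAway Q) :
    C z ∈ interpolationModule Q P r 0 0 :=
  interp_C hz fun i => by simpa using mem_regularAway.mp hz (P i) (hPQ i)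

theorem interp_X : (X : F[X]) ∈ interpolationModule Q P r 0 1 := by
  refine ⟨natDegree_X_le, fun t => ?_, fun i => hasMultiplicity_X⟩
  rw [coeff_X]
  split_ifs
  · exact (regularRing Q).one_mem
  · exact (regularRing Q).zero_mem

theorem interp_X_sub_C {h : F} (hh : h ∈ regularAway Q)
    (hhr : ∀ i, 0 < (P i).val (h - algebraMap K F (r i))) :
    X - C h ∈ interpolationModule Q P r 1 1 := by
  refine ⟨natDegree_X_sub_C_le _, fun t => ?_, fun i => hasMultiplicity_X_sub_C (hhr i)⟩
  rw [coeff_sub]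
  refine (regularRing Q).sub_mem (interp_X (P := P) (r := r) |>.2.1 t) ?_
  rw [coeff_C]
  split_ifs
  · exact hh
  · exact (regularRing Q).zero_mem

theorem interp_pow {q : F[X]} {m ℓ : ℕ} (h : q ∈ interpolationModule Q P r m ℓ) (e : ℕ) :
    q ^ e ∈ interpolationModule Q P r (e * m) (e * ℓ) := by
  induction e with
  | zero =>
    rw [pow_zero, Nat.zero_mul, Nat.zero_mul, ← C_1]
    exact interp_C (regularRing Q).one_mem fun i => by simp
  | succ e ih =>
    rw [pow_succ, Nat.succ_mul, Nat.succ_mul]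
    exact interp_mul ih h

theorem interp_mono {q : F[X]} {m ℓ ℓ' : ℕ} (h : q ∈ interpolationModule Q P r m ℓ)
    (hℓ : ℓ ≤ ℓ') : q ∈ interpolationModule Q P r m ℓ' :=
  ⟨h.1.trans hℓ, h.2⟩

/-- The coordinate vectors of the interpolation module. -/
def interpSubmodule (P : Fin n → Place K F) (r : Fin n → K) (hPQ : ∀ i, P i ≠ Q) (a : ℕ) {x₁ : F}
    (hx : x₁ ∈ regularRing Q) (y : ℕ → F) (N m ℓ : ℕ) : Submodule K[X] (Fin N → K[X]) where
  carrier := {v | ofCoords a x₁ y v ∈ interpolationModule Q P r m ℓ}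
  add_mem' := by
    intro v v' hv hv'
    rw [Set.mem_ofPred_eq, ofCoords_add]
    exact interp_add hv hv'
  zero_mem' := by
    have h : ofCoords a x₁ y (0 : Fin N → K[X]) = C 0 := by simp [ofCoords]
    rw [Set.mem_ofPred_eq, h]
    exact interp_mono (interp_C (regularRing Q).zero_mem fun i => by simp) (Nat.zero_le _)
  smul_mem' := by
    intro p v hv
    rw [Set.mem_ofPred_eq, ofCoords_smul]
    have h1 : aeval x₁ p ∈ regularRing Q := by
      rw [aeval_eq_sum_range]
      exact Subalgebra.sum_mem _ fun e _ => Subalgebra.smul_mem _ (Subalgebra.pow_mem _ hx e) _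
    have h2 := interp_mul (interp_C_zero (r := r) hPQ h1) hv
    rwa [Nat.zero_add, Nat.zero_add] at h2

end Interpolation

/-- `f` is regular away from `Q` and has the zero divisor `P_1 + ⋯ + P_n` away from `Q`. -/
structure HasSimpleZeros (Q : Place K F) {n : ℕ} (P : Fin n → Place K F) (f : F) : Prop where
  mem : f ∈ regularRing Q
  val_one : ∀ i, (P i).val f = ((1 : ℤ) : WithTop ℤ)
  val_zero : ∀ P' ≠ Q, (∀ i, P i ≠ P') → P'.val f = ((0 : ℤ) : WithTop ℤ)
  ne_zero : f ≠ 0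

theorem sum_single_apply_self {n : ℕ} {P : Fin n → Place K F} (hP : Function.Injective P)
    (k : Fin n) : (∑ i, Finsupp.single (P i) (1 : ℤ)) (P k) = 1 := by
  classical
  rw [Finsupp.finsetSum_apply, Finset.sum_eq_single k]
  · simp
  · intro i _ hi
    rw [Finsupp.single_eq_of_ne fun h => hi (hP h.symm)]
  · simp

theorem sum_single_apply_of_ne {n : ℕ} {P : Fin n → Place K F} {P' : Place K F}
    (hP' : ∀ i, P i ≠ P') : (∑ i, Finsupp.single (P i) (1 : ℤ)) P' = 0 := by
  classical
  rw [Finsupp.finsetSum_apply]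
  exact Finset.sum_eq_zero fun i _ => Finsupp.single_eq_of_ne (hP' i).symm

theorem hasSimpleZeros_of_hasZeroDivisor {Q : Place K F} {n : ℕ} {P : Fin n → Place K F}
    (hP : Function.Injective P) (hPQ : ∀ i, P i ≠ Q) {f : F} (hf : f ∈ regularAway Q)
    (hfD : HasZeroDivisor f (∑ i, Finsupp.single (P i) (1 : ℤ))) : HasSimpleZeros Q P f := by
  refine ⟨hf, fun i => ?_, fun P' hP' hne => ?_, ?_⟩
  · have h := hfD (P i)
    rw [sum_single_apply_self hP, max_eq_left (mem_regularAway.mp hf _ (hPQ i))] at h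
    exact h
  · have h := hfD P'
    rw [sum_single_apply_of_ne hne, max_eq_left (mem_regularAway.mp hf _ hP')] at h
    exact h
  · rintro rfl
    have h := hfD Q
    rw [AddValuation.map_zero, max_eq_left le_top] at h
    exact WithTop.top_ne_coe h

theorem mem_poleSpace_neg {Q : Place K F} {n : ℕ} {P : Fin n → Place K F}
    (hP : Function.Injective P) (hPQ : ∀ i, P i ≠ Q) {i : ℕ} {z : F} :
    z ∈ poleSpace (-((i : ℤ) • ∑ k, Finsupp.single (P k) (1 : ℤ))) Q ↔
      z ∈ regularAway Q ∧ ∀ k, ((i : ℤ) : WithTop ℤ) ≤ (P k).val z := by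
  rw [mem_poleSpace, mem_regularAway]
  constructor
  · intro h
    have h2 : ∀ k, ((i : ℤ) : WithTop ℤ) ≤ (P k).val z := by
      intro k
      have := h (P k) (hPQ k)
      rwa [Finsupp.neg_apply, neg_neg, Finsupp.smul_apply, sum_single_apply_self hP, smul_eq_mul,
        mul_one] at this
    refine ⟨fun P' hP' => ?_, h2⟩
    by_cases hk : ∃ k, P k = P'
    · obtain ⟨k, rfl⟩ := hk
      refine le_trans ?_ (h2 k)
      norm_cast
      omega
    · push Not at hk
      have := h P' hP'
      rwa [Finsupp.neg_apply, neg_neg, Finsupp.smul_apply, sum_single_apply_of_ne hk, smul_zero]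
        at this
  · rintro ⟨h1, h2⟩ P' hP'
    rw [Finsupp.neg_apply, neg_neg, Finsupp.smul_apply]
    by_cases hk : ∃ k, P k = P'
    · obtain ⟨k, rfl⟩ := hk
      rw [sum_single_apply_self hP, smul_eq_mul, mul_one]
      exact h2 k
    · push Not at hk
      rw [sum_single_apply_of_ne hk, smul_zero]
      exact h1 P' hP'

/-- This is `L(-iD + ∞Q) ⊆ f ^ i L(∞Q)`: away from `Q` the zeros of `f ^ i` are exactly those of
`iD`. -/
theorem HasSimpleZeros.div_pow_mem {Q : Place K F} {n : ℕ} {P : Fin n → Place K F} {f : F}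
    (hf : HasSimpleZeros Q P f) {i : ℕ} {z : F} (hz : z ∈ regularRing Q)
    (hzP : ∀ k, ((i : ℤ) : WithTop ℤ) ≤ (P k).val z) : z / f ^ i ∈ regularRing Q := by
  rw [mem_regularRing, mem_regularAway] at *
  intro P' hP'
  by_cases hk : ∃ k, P k = P'
  · obtain ⟨k, rfl⟩ := hk
    have := le_val_div (P k).val (hzP k) (val_pow_eq _ (hf.val_one k) i)
    simpa using this
  · push Not at hk
    have := le_val_div P'.val (a := 0) (by simpa using hz P' hP')
      (val_pow_eq _ (hf.val_zero P' hP' hk) i)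
    simpa using this

theorem divDegree_smul_sum {n : ℕ} {P : Fin n → Place K F} (hP : ∀ i, (P i).degree = 1) (e : ℤ) :
    divDegree (e • ∑ i, Finsupp.single (P i) (1 : ℤ)) = e * n := by
  rw [Finset.smul_sum, divDegree_sum]
  simp_rw [Finsupp.smul_single, divDegree_single, hP]
  simp [mul_comm]

/-- The pole order of `f` is at most the number of its zeros. -/
theorem HasSimpleZeros.le_val {g : ℕ} (hg : genus K F = (g : ℕ∞)) {Q : Place K F}
    (hQ : Q.degree = 1) {n : ℕ} {P : Fin n → Place K F} (hPdeg : ∀ i, (P i).degree = 1)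
    (hP : Function.Injective P) (hPQ : ∀ i, P i ≠ Q) {f : F} (hf : HasSimpleZeros Q P f) :
    ((-(n : ℤ) : ℤ) : WithTop ℤ) ≤ Q.val f := by
  obtain ⟨k, hk⟩ := exists_val_eq Q.val hf.ne_zero
  rw [hk, WithTop.coe_le_coe]
  by_contra hlt
  -- If the pole order `-k` exceeds `n`, the divisor `A = -eD - ekQ` has degree at least `e = g +
  -- 1`, while division by `f ^ e` embeds `L(A)` into `L(0)`, of dimension at most one. This
  -- contradicts Riemann's inequality.
  let e : ℕ := g + 1
  let A : Divisor K F := -((e : ℤ) • ∑ i, Finsupp.single (P i) (1 : ℤ)) +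
    Finsupp.single Q (-(e * k))
  have hfe : f ^ e ≠ 0 := pow_ne_zero _ hf.ne_zero
  have hmem : ∀ z ∈ rrSpace A, z / f ^ e ∈ rrSpace (Finsupp.single Q (0 : ℤ)) := by
    intro z hz
    have hreg : z ∈ poleSpace (-((e : ℤ) • ∑ k, Finsupp.single (P k) (1 : ℤ))) Q := by
      rw [mem_poleSpace]
      intro P' hP'
      have := hz P'
      rwa [Finsupp.add_apply, Finsupp.single_eq_of_ne hP', add_zero] at this
    rw [mem_poleSpace_neg hP hPQ] at hreg
    rw [mem_rrSpace_single]
    refine ⟨hf.div_pow_mem hreg.1 hreg.2, ?_⟩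
    have hzQ := hz Q
    rw [Finsupp.add_apply, Finsupp.single_eq_same, Finsupp.neg_apply, Finsupp.smul_apply,
      sum_single_apply_of_ne hPQ] at hzQ
    have := le_val_div Q.val hzQ (val_pow_eq Q.val hk e)
    refine le_trans ?_ this
    rw [WithTop.coe_le_coe]
    simp
  let L : rrSpace A →ₗ[K] rrSpace (Finsupp.single Q (0 : ℤ)) :=
    { toFun := fun z => ⟨z.1 / f ^ e, hmem z.1 z.2⟩
      map_add' := fun x z => Subtype.ext (add_div _ _ _)
      map_smul' := fun c x => Subtype.ext (smul_div_assoc c x.1 (f ^ e)) }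
  have hinj : Function.Injective L := by
    intro x z hxz
    have : x.1 / f ^ e = z.1 / f ^ e := congrArg Subtype.val hxz
    exact Subtype.ext ((div_left_inj' hfe).mp this)
  have := finiteDimensional_rrSpace_single hg hQ 0
  have h1 := LinearMap.finrank_le_finrank_of_injective hinj
  have h2 := finrank_rrSpace_zero_le hg hQ
  have h3 := le_genus hg A
  have h4 : divDegree A = (e : ℤ) * (-k - n) := by
    rw [divDegree_add, divDegree_single, hQ, ← neg_smul, divDegree_smul_sum hPdeg]
    push_cast
    ring
  rw [h4] at h3
  have h5 : (e : ℤ) * 1 ≤ e * (-k - n) := by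
    apply mul_le_mul_of_nonneg_left <;> omega
  have h6 : (e : ℤ) = g + 1 := by simp [e]
  omega

end Curves

/-! ### The generators of the interpolation module -/

section Curves

variable {K F : Type*} [Field K] [Field F] [Algebra K F]

theorem poleOrder_eq {Q : Place K F} {z : F} {k : ℤ} (h : Q.val z = ((-k : ℤ) : WithTop ℤ)) :
    poleOrder Q z = k := by
  unfold poleOrder
  rw [h, WithTop.untopD_coe, neg_neg]

namespace IsPoleBasis

variable {Q : Place K F} {a : ℕ} {x₁ : F} {y : ℕ → F} {b : ℕ → ℕ}

/-- Dividing a competitor by `f ^ i` gives an element of `L(∞Q)`. Because `f` is a polynomial in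
`x₁`, its pole order is a multiple of `a`, so the residue class is unchanged and the minimality of
`b_j` applies. -/
theorem isMinPole (hB : IsPoleBasis Q a x₁ y b) {n : ℕ} {P : Fin n → Place K F}
    (hP : Function.Injective P) (hPQ : ∀ i, P i ≠ Q) {f : F} (hf : HasSimpleZeros Q P f)
    {φ : K[X]} (hφ : aeval x₁ φ = f) (i j : ℕ) :
    IsMinPole (-((i : ℤ) • ∑ k, Finsupp.single (P k) (1 : ℤ))) Q a j (f ^ i * y j) := by
  have hφ0 : φ ≠ 0 := by
    rintro rfl
    exact hf.ne_zero (by rw [← hφ, map_zero])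
  have hfv := hB.val_aeval hφ0
  rw [hφ] at hfv
  have hval : Q.val (f ^ i * y j) = ((-(i * (a * φ.natDegree) + b j : ℤ) : ℤ) : WithTop ℤ) := by
    rw [val_mul_eq Q.val (val_pow_eq Q.val hfv i) (hB.y_val j)]
    congr 1
    ring
  have hpo := poleOrder_eq hval
  have hbj : (b j : ℤ) ≡ j [ZMOD a] := (Int.natCast_modEq_iff).mpr (hB.b_mod j)
  refine ⟨(mem_poleSpace_neg hP hPQ).mpr ⟨(regularRing Q).mul_mem
    ((regularRing Q).pow_mem hf.mem i) (hB.y_mem j), fun k => ?_⟩, ne_zero_of_val_eq _ hval, ?_,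
    fun ζ hζ hζ0 hζj => ?_⟩
  · have := le_val_mul (P k).val (val_pow_eq _ (hf.val_one k) i).ge (b := 0)
      (by simpa using mem_regularAway.mp (hB.y_mem j) _ (hPQ k))
    simpa using this
  · rw [hpo]
    refine Int.ModEq.trans ?_ hbj
    rw [Int.modEq_iff_dvd]
    exact ⟨-(i * φ.natDegree), by ring⟩
  · rw [mem_poleSpace_neg hP hPQ] at hζ
    have hreg := hf.div_pow_mem hζ.1 hζ.2
    obtain ⟨s, hs, hsv⟩ := hB.pole _ hreg (div_ne_zero hζ0 (pow_ne_zero i hf.ne_zero))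
    have h1 := val_mul_eq Q.val hsv (val_pow_eq Q.val hfv i)
    rw [div_mul_cancel₀ _ (pow_ne_zero i hf.ne_zero)] at h1
    have h2 : Q.val ζ = ((-(i * (a * φ.natDegree) + s : ℤ) : ℤ) : WithTop ℤ) := by
      rw [h1]
      congr 1
      ring
    rw [hpo, poleOrder_eq h2]
    rw [poleOrder_eq h2] at hζj
    have h3 : (s : ℤ) ≡ j [ZMOD a] := by
      refine Int.ModEq.trans ?_ hζj
      rw [Int.modEq_iff_dvd]
      exact ⟨i * φ.natDegree, by ring⟩
    have := hB.b_min j s hs (Int.natCast_modEq_iff.mp h3)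
    omega

theorem ofCoords_injective (hB : IsPoleBasis Q a x₁ y b) {N : ℕ} {v v' : Fin N → K[X]}
    (h : ofCoords a x₁ y v = ofCoords a x₁ y v') : v = v' := by
  funext i
  have h1 : comb a x₁ y (block a v (i / a)) = comb a x₁ y (block a v' (i / a)) := by
    rw [← coeff_ofCoords hB.pos, ← coeff_ofCoords hB.pos, h]
  have h2 := congrFun (hB.comb_injective h1) ⟨i % a, Nat.mod_lt _ hB.pos⟩
  rwa [block_div_mod hB.pos, block_div_mod hB.pos] at h2

theorem exists_ofCoords (hB : IsPoleBasis Q a x₁ y b) {ℓ : ℕ} {q : F[X]} (hq : q.natDegree ≤ ℓ)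
    (hqR : ∀ t, q.coeff t ∈ regularAway Q) :
    ∃ v : Fin (a * (ℓ + 1)) → K[X], ofCoords a x₁ y v = q := by
  choose p hp using fun t => hB.exists_comb (hqR t)
  refine ⟨fun i => p (i / a) ⟨i % a, Nat.mod_lt _ hB.pos⟩, Polynomial.ext fun k => ?_⟩
  rw [coeff_ofCoords hB.pos]
  by_cases hk : k ≤ ℓ
  · rw [← hp k]
    congr 1
    funext j
    have hlt : (j : ℕ) + a * k < a * (ℓ + 1) := by
      have h1 := Nat.mul_le_mul_left a hk
      have h2 := j.2
      rw [Nat.mul_succ]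
      omega
    unfold block
    rw [dif_pos hlt]
    simp only [Nat.add_mul_mod_self_left, Nat.mod_eq_of_lt j.2, Nat.add_mul_div_left _ _ hB.pos,
      Nat.div_eq_of_lt j.2, zero_add, Fin.eta]
  · rw [← coeff_ofCoords hB.pos,
      coeff_eq_zero_of_natDegree_lt ((natDegree_ofCoords_le hB.pos _ _ _).trans_lt (not_le.mp hk)),
      coeff_eq_zero_of_natDegree_lt (hq.trans_lt (not_le.mp hk))]

end IsPoleBasis

theorem generator_eq (a m : ℕ) (f h : F) (y : ℕ → F) (s : ℕ) :
    generator a m (fun i j => f ^ i * y j) h s =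
      X ^ (s / a - min (s / a) m) * (X - C h) ^ min (s / a) m *
        C (f ^ (m - min (s / a) m) * y (s % a)) := by
  unfold generator
  split_ifs with hk
  · rw [min_eq_left hk, Nat.sub_self, pow_zero, one_mul]
  · rw [min_eq_right (by omega), Nat.sub_self]

theorem generator_mem_interp {Q : Place K F} {n : ℕ} {P : Fin n → Place K F} (hPQ : ∀ i, P i ≠ Q)
    {r : Fin n → K} {f h : F} (hf : HasSimpleZeros Q P f) (hh : h ∈ regularAway Q)
    (hhr : ∀ i, 0 < (P i).val (h - algebraMap K F (r i))) {y : ℕ → F}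
    (hy : ∀ j, y j ∈ regularRing Q) (a m s : ℕ) :
    generator a m (fun i j => f ^ i * y j) h s ∈ interpolationModule Q P r m (s / a) := by
  rw [generator_eq]
  have h1 := interp_mul (interp_mul (interp_pow (interp_X (Q := Q) (P := P) (r := r))
    (s / a - min (s / a) m)) (interp_pow (interp_X_sub_C hh hhr) (min (s / a) m)))
    (interp_C (r := r) (m := m - min (s / a) m)
    (z := f ^ (m - min (s / a) m) * y (s % a))
    ((regularRing Q).mul_mem ((regularRing Q).pow_mem hf.mem _) (hy _)) fun k => by
      have := le_val_mul (P k).val (val_pow_eq _ (hf.val_one k) (m - min (s / a) m)).ge (b := 0)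
        (by simpa using mem_regularAway.mp (hy (s % a)) _ (hPQ k))
      simpa using this)
  have e1 : (s / a - min (s / a) m) * 0 + min (s / a) m * 1 + (m - min (s / a) m) = m := by omega
  have e2 : (s / a - min (s / a) m) * 1 + min (s / a) m * 1 + 0 = s / a := by omega
  rwa [e1, e2] at h1

theorem coeff_generator (a m : ℕ) (f h : F) (y : ℕ → F) (s i : ℕ) :
    (generator a m (fun i j => f ^ i * y j) h s).coeff i =
      (if s / a - min (s / a) m ≤ i then
        (-h) ^ (s / a - i) * ((min (s / a) m).choose (i - (s / a - min (s / a) m)) : F) else 0) *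
        (f ^ (m - min (s / a) m) * y (s % a)) := by
  rw [generator_eq, coeff_mul_C, coeff_X_pow_mul']
  congr 1
  split_ifs with hi
  · rw [sub_eq_add_neg, ← C_neg, coeff_X_add_C_pow]
    congr 2
    omega
  · rfl

theorem coeff_generator_top (a m : ℕ) (f h : F) (y : ℕ → F) (s : ℕ) :
    (generator a m (fun i j => f ^ i * y j) h s).coeff (s / a) =
      f ^ (m - min (s / a) m) * y (s % a) := by
  rw [coeff_generator, if_pos (Nat.sub_le _ _), Nat.sub_self, pow_zero, one_mul,
    Nat.sub_sub_self (min_le_left _ _), Nat.choose_self, Nat.cast_one, one_mul]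

/-- Only the powers `Z ^ i` with `k - min(k, m) ≤ i ≤ k` occur in a generator, with coefficients
of bounded pole order. -/
theorem val_coeff_generator {Q : Place K F} {a m : ℕ} {f h : F} {y : ℕ → F} {b : ℕ → ℕ}
    (hy : ∀ j, Q.val (y j) = ((-(b j : ℤ) : ℤ) : WithTop ℤ)) {H e : ℤ}
    (hH : ((-H : ℤ) : WithTop ℤ) ≤ Q.val h) (he : ((-e : ℤ) : WithTop ℤ) ≤ Q.val f) {s i : ℕ}
    (hne : (generator a m (fun i j => f ^ i * y j) h s).coeff i ≠ 0) :
    s / a - min (s / a) m ≤ i ∧ i ≤ s / a ∧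
      ((-(((s / a : ℕ) - i : ℤ) * H + (m - min (s / a) m : ℕ) * e + b (s % a)) : ℤ) : WithTop ℤ) ≤
        Q.val ((generator a m (fun i j => f ^ i * y j) h s).coeff i) := by
  rw [coeff_generator] at hne
  have h1 : s / a - min (s / a) m ≤ i := by
    by_contra hlt
    rw [if_neg hlt, zero_mul] at hne
    exact hne rfl
  have h2 : i ≤ s / a := by
    by_contra hlt
    rw [if_pos h1, Nat.choose_eq_zero_of_lt (by omega), Nat.cast_zero, mul_zero, zero_mul] at hne
    exact hne rfl
  refine ⟨h1, h2, ?_⟩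
  rw [coeff_generator, if_pos h1]
  have hh : ((-H : ℤ) : WithTop ℤ) ≤ Q.val (-h) := by rwa [Q.val.map_neg]
  -- The binomial coefficient is a constant that may vanish in positive characteristic, so only an
  -- inequality is available.
  have hc : ((0 : ℤ) : WithTop ℤ) ≤
      Q.val ((min (s / a) m).choose (i - (s / a - min (s / a) m)) : F) := by
    have := Q.val_const_nonneg ((min (s / a) m).choose (i - (s / a - min (s / a) m)) : K)
    rwa [map_natCast] at this
  have := le_val_mul Q.val (le_val_mul Q.val (le_val_pow Q.val hh (s / a - i)) hc)
    (le_val_mul Q.val (le_val_pow Q.val he (m - min (s / a) m)) (hy (s % a)).ge)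
  refine le_trans ?_ this
  rw [WithTop.coe_le_coe]
  push_cast [Nat.cast_sub h2]
  apply le_of_eq
  ring

/-- The coordinate vectors of the generators, and what they depend on. -/
structure IsGenSystem (Q : Place K F) {n : ℕ} (P : Fin n → Place K F) (r : Fin n → K) (a : ℕ)
    (x₁ : F) (y : ℕ → F) (b : ℕ → ℕ) (f : F) (φ : K[X]) (h : F) (m ℓ : ℕ)
    (G : Fin (a * (ℓ + 1)) → Fin (a * (ℓ + 1)) → K[X]) : Prop where
  basis : IsPoleBasis Q a x₁ y b
  ne : ∀ i, P i ≠ Q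
  zeros : HasSimpleZeros Q P f
  aeval_eq : aeval x₁ φ = f
  h_mem : h ∈ regularAway Q
  h_val : ∀ i, 0 < (P i).val (h - algebraMap K F (r i))
  gen : ∀ s, ofCoords a x₁ y (G s) = generator a m (fun i j => f ^ i * y j) h s

namespace IsGenSystem

variable {Q : Place K F} {n : ℕ} {P : Fin n → Place K F} {r : Fin n → K} {a : ℕ}
    {x₁ : F} {y : ℕ → F} {b : ℕ → ℕ} {f : F} {φ : K[X]} {h : F} {m ℓ : ℕ}
    {G : Fin (a * (ℓ + 1)) → Fin (a * (ℓ + 1)) → K[X]}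

theorem phi_ne_zero (hG : IsGenSystem Q P r a x₁ y b f φ h m ℓ G) : φ ≠ 0 := by
  rintro rfl
  exact hG.zeros.ne_zero (by rw [← hG.aeval_eq, map_zero])

theorem div_le (hG : IsGenSystem Q P r a x₁ y b f φ h m ℓ G) (s : Fin (a * (ℓ + 1))) :
    (s : ℕ) / a ≤ ℓ :=
  Nat.lt_succ_iff.mp ((Nat.div_lt_iff_lt_mul hG.basis.pos).mpr (s.2.trans_eq (mul_comm _ _)))

/-- The leading coefficient in `Z` is `f` to a power times `y_j`. As `f = φ(x₁)`, it has a single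
nonzero coordinate, which makes the system triangular. -/
theorem block_top (hG : IsGenSystem Q P r a x₁ y b f φ h m ℓ G) (s : Fin (a * (ℓ + 1))) :
    block a (G s) (s / a) = Pi.single (⟨s % a, Nat.mod_lt _ hG.basis.pos⟩ : Fin a)
      (φ ^ (m - min ((s : ℕ) / a) m)) := by
  apply hG.basis.comb_injective
  rw [← coeff_ofCoords hG.basis.pos, hG.gen, coeff_generator_top]
  unfold comb
  rw [Finset.sum_eq_single (⟨s % a, Nat.mod_lt _ hG.basis.pos⟩ : Fin a)]
  · rw [Pi.single_eq_same, map_pow, hG.aeval_eq]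
  · intro j _ hj
    rw [Pi.single_eq_of_ne hj, map_zero, zero_mul]
  · simp

theorem block_eq_zero (hG : IsGenSystem Q P r a x₁ y b f φ h m ℓ G) (s : Fin (a * (ℓ + 1)))
    {k : ℕ} (hk : (s : ℕ) / a < k) : block a (G s) k = 0 := by
  apply hG.basis.comb_injective
  rw [← coeff_ofCoords hG.basis.pos, hG.gen, coeff_eq_zero_of_natDegree_lt]
  · simp [comb]
  · exact lt_of_le_of_lt (generator_mem_interp hG.ne hG.zeros hG.h_mem hG.h_val
      hG.basis.y_mem a m s).1 hk

theorem diag_eq (hG : IsGenSystem Q P r a x₁ y b f φ h m ℓ G) (s : Fin (a * (ℓ + 1))) :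
    G s s = φ ^ (m - min ((s : ℕ) / a) m) := by
  rw [← block_div_mod hG.basis.pos (G s) s, hG.block_top, Pi.single_eq_same]

theorem hasInd (hG : IsGenSystem Q P r a x₁ y b f φ h m ℓ G) (s : Fin (a * (ℓ + 1))) :
    HasInd (G s) s := by
  refine ⟨?_, fun i hi => ?_⟩
  · rw [hG.diag_eq]
    exact pow_ne_zero _ hG.phi_ne_zero
  · rw [← block_div_mod hG.basis.pos (G s) i]
    rcases (Nat.div_le_div_right (c := a) (le_of_lt hi)).lt_or_eq with hlt | heq
    · rw [hG.block_eq_zero s hlt]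
      rfl
    · rw [← heq, hG.block_top, Pi.single_eq_of_ne]
      intro hmod
      have h1 : (i : ℕ) % a = s % a := congrArg Fin.val hmod
      have h2 := Nat.mod_add_div (s : ℕ) a
      have h3 := Nat.mod_add_div (i : ℕ) a
      rw [← heq, h1, h2] at h3
      exact absurd h3 (ne_of_lt hi)

/-- The coefficient of the highest power `Z ^ k` is unchanged by `Z ↦ Z + r_i`, so it vanishes to
order `m - k` at every `P_i`. Its quotient by the corresponding power of `f` is regular away from
`Q`, and comparing coordinates gives divisibility by that power of `φ`. -/
theorem dvd_of_hasInd (hG : IsGenSystem Q P r a x₁ y b f φ h m ℓ G)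
    {v : Fin (a * (ℓ + 1)) → K[X]} (hv : ofCoords a x₁ y v ∈ interpolationModule Q P r m ℓ)
    {s : Fin (a * (ℓ + 1))} (hs : HasInd v s) : G s s ∣ v s := by
  rw [hG.diag_eq]
  set k := (s : ℕ) / a with hk
  have hdeg : (ofCoords a x₁ y v).natDegree ≤ k := by
    rw [natDegree_le_iff_coeff_eq_zero]
    intro i hi
    rw [coeff_ofCoords hG.basis.pos]
    refine Finset.sum_eq_zero fun j _ => ?_
    unfold block
    split_ifs with hlt
    · rw [hs.2, map_zero, zero_mul]
      rw [Fin.lt_def]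
      have h1 := Nat.mod_add_div (s : ℕ) a
      have h2 := Nat.mod_lt (s : ℕ) hG.basis.pos
      have h3 := Nat.mul_le_mul_left a (show k + 1 ≤ i from hi)
      rw [← hk] at h1
      simp only
      rw [Nat.mul_succ] at h3
      omega
    · rw [map_zero, zero_mul]
  have hcoeff : ∀ i, (((ofCoords a x₁ y v).comp (X + C (algebraMap K F (r i)))).coeff k) =
      (ofCoords a x₁ y v).coeff k := by
    intro i
    rcases hdeg.lt_or_eq with hlt | heq
    · rw [coeff_eq_zero_of_natDegree_lt hlt, coeff_eq_zero_of_natDegree_lt]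
      rwa [natDegree_comp, natDegree_X_add_C, mul_one]
    · have := coeff_taylor_natDegree (r := algebraMap K F (r i)) (f := ofCoords a x₁ y v)
      rw [heq] at this
      rw [← taylor_apply, this, leadingCoeff, heq]
  have hreg := hv.2.1 k
  have hval : ∀ i, (((m - min k m : ℕ) : ℤ) : WithTop ℤ) ≤
      (P i).val ((ofCoords a x₁ y v).coeff k) := by
    -- For `k > m` the truncated exponent is zero and regularity suffices.
    intro i
    have h1 := hv.2.2 i k
    rw [hcoeff] at h1
    rcases le_total k m with hkm | hkm
    · refine le_trans ?_ h1
      rw [WithTop.coe_le_coe]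
      omega
    · rw [min_eq_right hkm, Nat.sub_self]
      simpa using mem_regularAway.mp hreg _ (hG.ne i)
  obtain ⟨p, hp⟩ := hG.basis.exists_comb (hG.zeros.div_pow_mem hreg hval)
  have hblock : block a v k = fun j => φ ^ (m - min k m) * p j := by
    apply hG.basis.comb_injective
    rw [← coeff_ofCoords hG.basis.pos]
    rw [eq_div_iff (pow_ne_zero _ hG.zeros.ne_zero)] at hp
    rw [← hp]
    unfold comb
    rw [Finset.sum_mul]
    refine Finset.sum_congr rfl fun j _ => ?_
    rw [map_mul, map_pow, hG.aeval_eq]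
    ring
  rw [← block_div_mod hG.basis.pos v s, ← hk, hblock]
  exact dvd_mul_right _ _

theorem mem_interp (hG : IsGenSystem Q P r a x₁ y b f φ h m ℓ G) (s : Fin (a * (ℓ + 1))) :
    ofCoords a x₁ y (G s) ∈ interpolationModule Q P r m ℓ := by
  rw [hG.gen]
  exact interp_mono (generator_mem_interp hG.ne hG.zeros hG.h_mem hG.h_val hG.basis.y_mem a m s)
    (hG.div_le s)

theorem span_eq (hG : IsGenSystem Q P r a x₁ y b f φ h m ℓ G) :
    (Submodule.span K[X] (Set.range G) : Set (Fin (a * (ℓ + 1)) → K[X])) =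
      {v | ofCoords a x₁ y v ∈ interpolationModule Q P r m ℓ} := by
  have := span_eq_of_hasInd (S := interpSubmodule P r hG.ne a hG.basis.x_mem y _ m ℓ)
    hG.mem_interp hG.hasInd fun v hv s hs => hG.dvd_of_hasInd hv hs
  rw [this]
  rfl

/-- An element of the interpolation module of `Z`-degree less than `k` is a combination of the
generators in the blocks before the block `k`. -/
theorem mem_span_of_interp (hG : IsGenSystem Q P r a x₁ y b f φ h m ℓ G)
    {v : Fin (a * (ℓ + 1)) → K[X]} {k : ℕ} (hv : ofCoords a x₁ y v ∈ interpolationModule Q P r m ℓ)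
    (hk : (ofCoords a x₁ y v).natDegree < k) :
    v ∈ Submodule.span K[X] (G '' {i | (i : ℕ) < a * k}) := by
  have hspan := mem_span_of_hasInd (S := interpSubmodule P r hG.ne a hG.basis.x_mem y _ m ℓ)
    hG.mem_interp hG.hasInd fun v hv s hs => hG.dvd_of_hasInd hv hs
  refine hspan (a * k) v hv fun j hj => ?_
  have h1 : comb a x₁ y (block a v (j / a)) = comb a x₁ y (0 : Fin a → K[X]) := by
    rw [← coeff_ofCoords hG.basis.pos, coeff_eq_zero_of_natDegree_lt]
    · simp [comb]
    · exact hk.trans_le ((Nat.le_div_iff_mul_le hG.basis.pos).mpr (by rwa [mul_comm]))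
  rw [← block_div_mod hG.basis.pos v j, hG.basis.comb_injective h1]
  rfl

/-- The monomials that occur in the generators. -/
theorem monomial_bound (hG : IsGenSystem Q P r a x₁ y b f φ h m ℓ G) {H e : ℤ}
    (hH : ((-H : ℤ) : WithTop ℤ) ≤ Q.val h) (he : ((-e : ℤ) : WithTop ℤ) ≤ Q.val f)
    {s i : Fin (a * (ℓ + 1))} {d : ℕ} (hd : (G s i).coeff d ≠ 0) :
    (s : ℕ) / a - min ((s : ℕ) / a) m ≤ (i : ℕ) / a ∧ (i : ℕ) / a ≤ (s : ℕ) / a ∧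
      (a : ℤ) * d + b (i % a) ≤ ((s / a : ℕ) - (i / a : ℕ) : ℤ) * H +
        (m - min ((s : ℕ) / a) m : ℕ) * e + b (s % a) := by
  have hne : G s i ≠ 0 := fun h0 => hd (by rw [h0, coeff_zero])
  have hbl := block_div_mod hG.basis.pos (G s) i
  have hc : (generator a m (fun i j => f ^ i * y j) h s).coeff (i / a) =
      comb a x₁ y (block a (G s) (i / a)) := by
    rw [← hG.gen, coeff_ofCoords hG.basis.pos]
  have hne' : (generator a m (fun i j => f ^ i * y j) h s).coeff (i / a) ≠ 0 := by
    rw [hc]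
    intro h0
    have : block a (G s) (i / a) = 0 := hG.basis.comb_injective (by rw [h0]; simp [comb])
    rw [this] at hbl
    exact hne hbl.symm
  obtain ⟨h1, h2, h3⟩ := val_coeff_generator hG.basis.y_val hH he hne'
  rw [hc] at h3
  have h4 := hG.basis.wt_le_of_le_val h3 (j := ⟨i % a, Nat.mod_lt _ hG.basis.pos⟩)
    (by rw [hbl]; exact hne)
  rw [hbl] at h4
  refine ⟨h1, h2, le_trans ?_ h4⟩
  have h5 : (d : ℤ) ≤ (G s i).natDegree := by exact_mod_cast le_natDegree_of_ne_zero hd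
  have h6 : (a : ℤ) * d ≤ a * (G s i).natDegree := mul_le_mul_of_nonneg_left h5 (by positivity)
  simp only
  omega

end IsGenSystem

end Curves

/-! ### Weighted leading terms and elements of small weight -/

section Curves

variable {K F : Type*} [Field K] [Field F] [Algebra K F]

theorem coe_lt_val_of_eq_zero (v : AddValuation F (WithTop ℤ)) {z : F} (hz : z = 0) (k : ℤ) :
    (k : WithTop ℤ) < v z := by
  rw [hz, v.map_zero]
  exact WithTop.coe_lt_top k

/-- With `Z` of weight `u`, the leading term of `A` is in `Z ^ c` and has weight `d`. -/
structure IsLead (Q : Place K F) (u : ℕ) (A : F[X]) (c : ℕ) (d : ℤ) : Prop where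
  le : ∀ i : ℕ, ((i * u - d : ℤ) : WithTop ℤ) ≤ Q.val (A.coeff i)
  lt : ∀ i : ℕ, c < i → ((i * u - d : ℤ) : WithTop ℤ) < Q.val (A.coeff i)
  eq : Q.val (A.coeff c) = ((c * u - d : ℤ) : WithTop ℤ)

namespace IsLead

variable {Q : Place K F} {u : ℕ}

theorem mul {A A' : F[X]} {c c' : ℕ} {d d' : ℤ} (h : IsLead Q u A c d)
    (h' : IsLead Q u A' c' d') : IsLead Q u (A * A') (c + c') (d + d') := by
  classical
  have hle : ∀ i j : ℕ, (((i + j : ℕ) * u - (d + d') : ℤ) : WithTop ℤ) ≤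
      Q.val (A.coeff i * A'.coeff j) := by
    intro i j
    have := le_val_mul Q.val (h.le i) (h'.le j)
    refine le_trans (le_of_eq ?_) this
    congr 1
    push_cast
    ring
  have hlt : ∀ i j : ℕ, c < i ∨ c' < j → (((i + j : ℕ) * u - (d + d') : ℤ) : WithTop ℤ) <
      Q.val (A.coeff i * A'.coeff j) := by
    rintro i j (hi | hj)
    · have := lt_val_mul Q.val (h.lt i hi) (h'.le j)
      refine lt_of_le_of_lt (le_of_eq ?_) this
      congr 1
      push_cast
      ring
    · have := lt_val_mul Q.val (h'.lt j hj) (h.le i)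
      rw [mul_comm (A.coeff i)]
      refine lt_of_le_of_lt (le_of_eq ?_) this
      congr 1
      push_cast
      ring
  refine ⟨fun k => ?_, fun k hk => ?_, ?_⟩
  · rw [coeff_mul]
    refine Q.val.map_le_sum fun x hx => ?_
    rw [← Finset.HasAntidiagonal.mem_antidiagonal.mp hx]
    exact hle _ _
  · rw [coeff_mul]
    refine Q.val.map_lt_sum (WithTop.coe_ne_top) fun x hx => ?_
    have hx' := Finset.HasAntidiagonal.mem_antidiagonal.mp hx
    rw [← hx']
    exact hlt _ _ (by omega)
  · have hmem : (c, c') ∈ Finset.HasAntidiagonal.antidiagonal (c + c') := Finset.HasAntidiagonal.mem_antidiagonal.mpr rfl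
    have h1 : Q.val (A.coeff c * A'.coeff c') =
        (((c + c' : ℕ) * u - (d + d') : ℤ) : WithTop ℤ) := by
      rw [val_mul_eq Q.val h.eq h'.eq]
      congr 1
      push_cast
      ring
    rw [coeff_mul, ← Finset.add_sum_erase _ _ hmem, ← h1]
    refine Q.val.map_add_eq_of_lt_left ?_
    rw [h1]
    refine Q.val.map_lt_sum (WithTop.coe_ne_top) fun x hx => ?_
    have hx' := Finset.HasAntidiagonal.mem_antidiagonal.mp (Finset.mem_of_mem_erase hx)
    have hne := Finset.ne_of_mem_erase hx
    rw [← hx']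
    refine hlt _ _ ?_
    by_contra hcon
    push Not at hcon
    exact hne (Prod.ext (by simp only; omega) (by simp only; omega))

theorem one : IsLead Q u 1 0 0 := by
  refine ⟨fun i => ?_, fun i hi => ?_, by simp⟩
  · rcases Nat.eq_zero_or_pos i with rfl | hi
    · simp
    · simp [coeff_one, hi.ne']
  · exact coe_lt_val_of_eq_zero _ (by simp [coeff_one, hi.ne']) _

theorem pow {A : F[X]} {c : ℕ} {d : ℤ} (h : IsLead Q u A c d) (k : ℕ) :
    IsLead Q u (A ^ k) (k * c) (k * d) := by
  induction k with
  | zero => simpa using one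
  | succ k ih =>
    rw [pow_succ, Nat.succ_mul]
    convert ih.mul h using 1
    push_cast
    ring

theorem const {z : F} {e : ℤ} (h : Q.val z = ((-e : ℤ) : WithTop ℤ)) : IsLead Q u (C z) 0 e := by
  refine ⟨fun i => ?_, fun i hi => ?_, by simpa using h⟩
  · rcases Nat.eq_zero_or_pos i with rfl | hi
    · simpa using h.ge
    · simp [coeff_C, hi.ne']
  · exact coe_lt_val_of_eq_zero _ (by simp [coeff_C, hi.ne']) _

theorem X_sub_C {z : F} {e : ℤ} (h : Q.val z = ((-e : ℤ) : WithTop ℤ)) (hu : (u : ℤ) < e) :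
    IsLead Q u (X - C z) 0 e := by
  have h0 : (X - C z).coeff 0 = -z := by simp
  have h1 : (X - C z).coeff 1 = 1 := by simp
  have h2 : ∀ i, 1 < i → (X - C z).coeff i = 0 := fun i hi => by
    rw [coeff_sub, coeff_X, coeff_C, if_neg (by omega), if_neg (by omega), sub_zero]
  have hlt : ∀ i : ℕ, 0 < i → ((i * u - e : ℤ) : WithTop ℤ) < Q.val ((X - C z).coeff i) := by
    intro i hi
    rcases (show 1 ≤ i from hi).eq_or_lt with rfl | hi
    · rw [h1, Q.val.map_one, ← WithTop.coe_zero, WithTop.coe_lt_coe]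
      push_cast
      omega
    · exact coe_lt_val_of_eq_zero _ (h2 i hi) _
  have heq : Q.val ((X - C z).coeff 0) = ((((0 : ℕ) : ℤ) * u - e : ℤ) : WithTop ℤ) := by
    rw [h0, Q.val.map_neg, h]
    simp
  refine ⟨fun i => ?_, hlt, heq⟩
  rcases Nat.eq_zero_or_pos i with rfl | hi
  · exact heq.ge
  · exact (hlt i hi).le

theorem X : IsLead Q u (Polynomial.X) 1 u := by
  refine ⟨fun i => ?_, fun i hi => ?_, by simp⟩
  · rcases eq_or_ne i 1 with rfl | hi
    · simp
    · simp [coeff_X, hi.symm]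
  · exact coe_lt_val_of_eq_zero _ (by simp [coeff_X, hi.ne]) _

end IsLead

namespace IsPoleBasis

variable {Q : Place K F} {x₁ : F} {y : ℕ → F} {b : ℕ → ℕ}

theorem b_zero {a : ℕ} (hB : IsPoleBasis Q a x₁ y b) : b 0 = 0 := by
  have := hB.b_min 0 0 ⟨1, (regularRing Q).one_mem, by simp⟩ rfl
  omega

/-- For `a = 1` the ring `L(∞Q)` is `K[x₁]`, and this is Euclidean division by `φ`. Pole orders are
then degrees. -/
theorem exists_sub_mul {a : ℕ} (hB : IsPoleBasis Q a x₁ y b) (ha : a = 1) {f : F} {φ : K[X]}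
    (hφ : aeval x₁ φ = f) (hφ0 : φ ≠ 0) {n : ℕ} (hn : φ.natDegree ≤ n) {z : F}
    (hz : z ∈ regularRing Q) :
    ∃ z' ∈ regularRing Q, ((-((n - 1 : ℕ) : ℤ) : ℤ) : WithTop ℤ) ≤ Q.val (z - f * z') := by
  subst ha
  obtain ⟨p, rfl⟩ := hB.exists_comb hz
  refine ⟨aeval x₁ (p 0 / φ) * y 0, (regularRing Q).mul_mem (hB.aeval_mem _) (hB.y_mem 0), ?_⟩
  have hp : comb 1 x₁ y p - f * (aeval x₁ (p 0 / φ) * y 0) = aeval x₁ (p 0 % φ) * y 0 := by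
    have h1 := congrArg (aeval x₁) (EuclideanDomain.div_add_mod (p 0) φ)
    rw [map_add, map_mul, hφ] at h1
    simp only [comb, Finset.univ_unique, Fin.default_eq_zero, Finset.sum_singleton, Fin.val_zero]
    rw [← h1]
    ring
  rw [hp]
  by_cases h0 : p 0 % φ = 0
  · simp [h0]
  · rw [val_mul_eq Q.val (hB.val_aeval h0) (hB.y_val 0), hB.b_zero, WithTop.coe_le_coe]
    have := natDegree_lt_natDegree h0 (EuclideanDomain.mod_lt (p 0) hφ0)
    push_cast
    omega

end IsPoleBasis

namespace IsGenSystem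

variable {Q : Place K F} {n : ℕ} {P : Fin n → Place K F} {r : Fin n → K} {a : ℕ}
    {x₁ : F} {y : ℕ → F} {b : ℕ → ℕ} {f : F} {φ : K[X]} {h : F} {m ℓ : ℕ}
    {G : Fin (a * (ℓ + 1)) → Fin (a * (ℓ + 1)) → K[X]}

theorem val_f (hG : IsGenSystem Q P r a x₁ y b f φ h m ℓ G) :
    Q.val f = ((-((a : ℤ) * φ.natDegree) : ℤ) : WithTop ℤ) := by
  rw [← hG.aeval_eq, hG.basis.val_aeval hG.phi_ne_zero]

/-- An element of the interpolation module of multiplicity one with leading term in `Z`. -/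
theorem exists_lead_one (hG : IsGenSystem Q P r a x₁ y b f φ h m ℓ G) (ha : a = 1)
    (hn : φ.natDegree ≤ n) (u : ℕ) :
    ∃ A ∈ interpolationModule Q P r 1 1, IsLead Q u A 1 (max (n - 1) u : ℕ) := by
  -- The truncated exponent raises the weight `u` of `Z` to `max (n - 1) u`. This is at least the
  -- pole order of the remainder of `x₁ ^ e h` modulo `f`, and ties favour `Z`.
  set e := n - 1 - u with he
  have hx := hG.basis.x_mem
  have hxe := (regularRing Q).pow_mem hx e
  obtain ⟨z, hz, hzv⟩ := hG.basis.exists_sub_mul ha hG.aeval_eq hG.phi_ne_zero hn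
    ((regularRing Q).mul_mem hxe hG.h_mem)
  refine ⟨C (x₁ ^ e) * (X - C h) + C (f * z), ?_, ?_⟩
  · refine interp_add ?_ ?_
    · have := interp_mul (interp_C_zero (r := r) hG.ne hxe) (interp_X_sub_C hG.h_mem hG.h_val)
      simpa using this
    · refine interp_mono (interp_C ((regularRing Q).mul_mem hG.zeros.mem hz) fun i => ?_)
        (Nat.zero_le 1)
      have := le_val_mul (P i).val (hG.zeros.val_one i).ge (b := 0)
        (by simpa using mem_regularAway.mp hz _ (hG.ne i))
      simpa using this
  · have heq : C (x₁ ^ e) * (X - C h) + C (f * z) = C (x₁ ^ e) * X + C (-(x₁ ^ e * h - f * z)) := by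
      simp only [C_neg, C_sub, C_mul]
      ring
    rw [heq]
    set A := C (x₁ ^ e) * X + C (-(x₁ ^ e * h - f * z)) with hA
    have h0 : A.coeff 0 = -(x₁ ^ e * h - f * z) := by
      rw [hA, coeff_add, coeff_C_mul, coeff_X_zero, coeff_C_zero, mul_zero, zero_add]
    have h1 : A.coeff 1 = x₁ ^ e := by
      rw [hA, coeff_add, coeff_C_mul, coeff_X_one, coeff_C, if_neg one_ne_zero, mul_one, add_zero]
    have h2 : ∀ i, 1 < i → A.coeff i = 0 := by
      intro i hi
      rw [hA, coeff_add, coeff_C_mul, coeff_X, coeff_C, if_neg (by omega), if_neg (by omega), mul_zero,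
        add_zero]
    have hval1 : Q.val (x₁ ^ e) = ((((1 : ℕ) : ℤ) * u - (max (n - 1) u : ℕ) : ℤ) : WithTop ℤ) := by
      rw [val_pow_eq Q.val hG.basis.x_val, ha]
      congr 1
      push_cast
      omega
    refine ⟨fun i => ?_, fun i hi => ?_, by rw [h1, hval1]⟩
    · rcases Nat.lt_trichotomy i 1 with hi | rfl | hi
      · obtain rfl : i = 0 := by omega
        rw [h0, Q.val.map_neg]
        refine le_trans ?_ hzv
        rw [WithTop.coe_le_coe]
        push_cast
        omega
      · rw [h1, hval1]
      · exact (coe_lt_val_of_eq_zero _ (h2 i hi) _).le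
    · exact coe_lt_val_of_eq_zero _ (h2 i hi) _

/-- An element of the interpolation module of multiplicity one with leading term in `Z ^ 2`, when
`Z` has weight zero and `h` has a pole of order `n - 1`. -/
theorem exists_lead_two (hG : IsGenSystem Q P r a x₁ y b f φ h m ℓ G) (ha : a = 1)
    (hn : φ.natDegree ≤ n) (h2n : 2 ≤ n)
    (hh : Q.val h = ((-((n : ℤ) - 1) : ℤ) : WithTop ℤ)) :
    ∃ A ∈ interpolationModule Q P r 1 2, IsLead Q 0 A 2 (n - 2) := by
  obtain ⟨k, rfl⟩ : ∃ k, n = k + 2 := ⟨n - 2, by omega⟩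
  have hx := hG.basis.x_mem
  have hxe := (regularRing Q).pow_mem hx k
  obtain ⟨z, hz, hzv⟩ := hG.basis.exists_sub_mul ha hG.aeval_eq hG.phi_ne_zero hn
    ((regularRing Q).mul_mem hxe ((regularRing Q).mul_mem hG.h_mem hG.h_mem))
  -- The remainder of `x₁ ^ (n-2) h ^ 2` modulo `f` has pole order at most `n - 1`, that of `h`.
  -- Subtracting a multiple of `h` brings it down to `n - 2`, the weight of `x₁ ^ (n-2) Z ^ 2`.
  obtain ⟨c, hc⟩ := exists_cancel hG.basis.deg (x := x₁ ^ k * (h * h) - f * z)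
    (ne_zero_of_val_eq Q.val hh) (by
      rw [hh]
      refine le_trans (le_of_eq ?_) hzv
      congr 1
      push_cast
      omega)
  have hcm : algebraMap K F c ∈ regularRing Q := (regularRing Q).algebraMap_mem c
  refine ⟨C (x₁ ^ k) * (X + C h) * (X - C h) + C (f * z) + C (-algebraMap K F c) * (X - C h),
    ?_, ?_⟩
  · have hlin := interp_X_sub_C hG.h_mem hG.h_val
    refine interp_add (interp_add ?_ ?_) ?_
    · have h1 : X + C h ∈ interpolationModule Q P r 0 1 :=
        interp_add interp_X (interp_mono (interp_C_zero hG.ne hG.h_mem) (Nat.zero_le 1))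
      simpa using interp_mul (interp_mul (interp_C_zero hG.ne hxe) h1) hlin
    · refine interp_mono (interp_C ((regularRing Q).mul_mem hG.zeros.mem hz) fun i => ?_)
        (Nat.zero_le 2)
      have := le_val_mul (P i).val (hG.zeros.val_one i).ge (b := 0)
        (by simpa using mem_regularAway.mp hz _ (hG.ne i))
      simpa using this
    · have := interp_mul (interp_C_zero hG.ne ((regularRing Q).neg_mem hcm)) hlin
      exact interp_mono this one_le_two
  · set w := x₁ ^ k * (h * h) - f * z - algebraMap K F c * h with hw
    have heq : C (x₁ ^ k) * (X + C h) * (X - C h) + C (f * z) +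
        C (-algebraMap K F c) * (X - C h) =
        C (x₁ ^ k) * X ^ 2 + C (-algebraMap K F c) * X + C (-w) := by
      simp only [hw, C_neg, C_sub, C_mul]
      ring
    rw [heq]
    set A := C (x₁ ^ k) * X ^ 2 + C (-algebraMap K F c) * X + C (-w) with hA
    have h0 : A.coeff 0 = -w := by
      simp [hA]
    have h1 : A.coeff 1 = -algebraMap K F c := by
      rw [hA, coeff_add, coeff_add, coeff_C_mul, coeff_C_mul, coeff_X_pow, coeff_X_one, coeff_C,
        if_neg (by omega), if_neg one_ne_zero, mul_zero, mul_one, zero_add, add_zero]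
    have h2 : A.coeff 2 = x₁ ^ k := by
      rw [hA, coeff_add, coeff_add, coeff_C_mul, coeff_C_mul, coeff_X_pow, coeff_X, coeff_C,
        if_pos rfl, if_neg (by omega), if_neg two_ne_zero, mul_zero, mul_one, add_zero, add_zero]
    have h3 : ∀ i, 2 < i → A.coeff i = 0 := by
      intro i hi
      rw [hA, coeff_add, coeff_add, coeff_C_mul, coeff_C_mul, coeff_X_pow, coeff_X, coeff_C,
        if_neg (by omega), if_neg (by omega), if_neg (by omega), mul_zero, mul_zero, add_zero,
        add_zero]
    have hval2 : Q.val (x₁ ^ k) = ((((2 : ℕ) : ℤ) * (0 : ℕ) - ((k + 2 : ℕ) - 2) : ℤ) :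
        WithTop ℤ) := by
      rw [val_pow_eq Q.val hG.basis.x_val, ha]
      congr 1
      push_cast
      ring
    refine ⟨fun i => ?_, fun i hi => ?_, by rw [h2, hval2]⟩
    · rcases Nat.lt_trichotomy i 2 with hi | rfl | hi
      · interval_cases i
        · rw [h0, Q.val.map_neg]
          rw [hh] at hc
          by_cases hw0 : w = 0
          · simp [hw0]
          · obtain ⟨e, he⟩ := exists_val_eq Q.val hw0
            rw [he, WithTop.coe_lt_coe] at hc
            rw [he, WithTop.coe_le_coe]
            push_cast at hc ⊢
            omega
        · rw [h1, Q.val.map_neg]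
          refine le_trans ?_ (Q.val_const_nonneg c)
          rw [← WithTop.coe_zero, WithTop.coe_le_coe]
          push_cast
          omega
      · rw [h2, hval2]
      · exact (coe_lt_val_of_eq_zero _ (h3 i hi) _).le
    · exact coe_lt_val_of_eq_zero _ (h3 i hi) _

end IsGenSystem

end Curves

/-! ### Stages without steps, and the stage bound for `a₁ ≥ 2` -/

section AlgorithmG

variable {K : Type*} [Field K] {N : ℕ}

theorem exists_wtLE (ux : ℤ) (w : Fin N → ℤ) (g : Fin N → Fin N → K[X]) :
    ∃ B : ℕ, ∀ i, WtLE ux w (g i) B := by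
  classical
  obtain ⟨B, hB⟩ := Finset.exists_le (Finset.univ.biUnion fun s : Fin N =>
    Finset.univ.biUnion fun i : Fin N => (g s i).support.image fun d => monWt ux w (d, i))
  refine ⟨B.toNat, fun s d i hd => (hB _ ?_).trans (Int.self_le_toNat B)⟩
  simp only [Finset.mem_biUnion, Finset.mem_univ, true_and, Finset.mem_image, mem_support_iff]
  exact ⟨s, i, d, hd, rfl⟩

theorem IsLeadMon.monWt_le {ux : ℤ} (hux : 0 < ux) {w : Fin N → ℤ} {v : Fin N → K[X]}
    {p : ℕ × Fin N} (hp : IsLeadMon ux w v p) {d : ℕ} {i : Fin N} (hd : (v i).coeff d ≠ 0) :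
    monWt ux w (d, i) ≤ monWt ux w p :=
  monWt_le_of_monKey_le (((isLeadMon_iff hux).mp hp).2 d i hd)

theorem IsLeadMon.monWt_lt {ux : ℤ} {w : Fin N → ℤ} {v : Fin N → K[X]}
    {p : ℕ × Fin N} (hp : IsLeadMon ux w v p) {d : ℕ} {i : Fin N} (hd : (v i).coeff d ≠ 0)
    (hi : p.2 < i) : monWt ux w (d, i) < monWt ux w p := by
  rcases hp.2 (d, i) hd with heq | hlt | ⟨-, hlt⟩
  · rw [← heq] at hi
    exact absurd hi (lt_irrefl _)
  · exact hlt
  · exact absurd hlt (not_lt.mpr hi.le)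

theorem scaleCost_le_sum {v : Fin N → K[X]} {D : Fin N → ℕ}
    (h : ∀ i, v i ≠ 0 → (v i).natDegree + 1 ≤ D i) : scaleCost v ≤ ∑ i, D i := by
  unfold scaleCost
  refine Finset.sum_le_sum fun i _ => ?_
  split_ifs with h0
  · exact Nat.zero_le _
  · exact h i h0

theorem card_filter_le_fin (r : Fin N) : (Finset.univ.filter fun i : Fin N => i ≤ r).card = r + 1 := by
  have : (Finset.univ.filter fun i : Fin N => i ≤ r) = Finset.Iic r := by ext; simp
  rw [this, Fin.card_Iic]

theorem scaleCost_le_mul {a : ℕ} (ha : 0 < a) {w : Fin N → ℤ} (hw : ∀ i, 0 ≤ w i)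
    {v : Fin N → K[X]} {r : Fin N} {B : ℕ} {p : ℕ × Fin N} (hp : IsLeadMon a w v p)
    (hB : monWt a w p ≤ B) (hr : ∀ j, r < j → v j = 0) :
    scaleCost v ≤ (r + 1) * (B / a + 1) := by
  have h1 : scaleCost v ≤ ∑ i : Fin N, if i ≤ r then B / a + 1 else 0 := by
    refine scaleCost_le_sum fun i hi => ?_
    have hir : i ≤ r := not_lt.mp fun hlt => hi (hr i hlt)
    rw [if_pos hir, Nat.add_le_add_iff_right, Nat.le_div_iff_mul_le ha]
    have h2 := (hp.monWt_le (by exact_mod_cast ha) (d := (v i).natDegree) (i := i)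
      (by rwa [coeff_natDegree, leadingCoeff_ne_zero])).trans hB
    have h3 := hw i
    unfold monWt at h2
    zify
    simp only at h2
    omega
  refine h1.trans (le_of_eq ?_)
  rw [← Finset.sum_filter, Finset.sum_const, card_filter_le_fin, smul_eq_mul]

/-- A stage without steps costs nothing. -/
theorem stageBound_zero {a : ℕ} (ha : 0 < a) {w : Fin N → ℤ} (hw : ∀ i, 0 ≤ w i)
    {g : Fin N → Fin N → K[X]} {B : ℕ} {r : Fin N}
    (h : ∀ d i, i ≠ r → (g r i).coeff d ≠ 0 →
      monWt a w (d, i) ≤ monWt a w ((g r r).natDegree, r)) :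
    StageBound a w g B r 0 := by
  intro Λ hΛ _
  refine ⟨∅, fun _ => 1 + (r + 1) * (B / a + 1), fun ε s hε _ _ d i hd hle => ?_,
    fun s hs v D hv hD hr _ => ?_, by simp⟩
  · exfalso
    have h1 : monWt a w (d, i) ≤ monWt a w ((g r r).natDegree, r) := by
      by_cases hi : i = r
      · subst hi
        unfold monWt
        have := le_natDegree_of_ne_zero hd
        have : (d : ℤ) * a ≤ (g i i).natDegree * a := by gcongr
        simp only
        omega
      · exact h d i hi hd
    have h2 := i.2
    nlinarith
  · exact Nat.add_le_add_left (scaleCost_le_mul ha hw hv (hD.trans (hΛ s hs).1) hr) 1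

end AlgorithmG

section Curves

variable {K F : Type*} [Field K] [Field F] [Algebra K F]

/-- The weight of the basis vector `y_j Z ^ k`. -/
def rowWt (a : ℕ) (b : ℕ → ℕ) (u : ℕ) {N : ℕ} (s : Fin N) : ℤ :=
  b (s % a) + (s / a : ℕ) * (u : ℤ)

theorem rowWt_nonneg (a : ℕ) (b : ℕ → ℕ) (u : ℕ) {N : ℕ} (s : Fin N) : 0 ≤ rowWt a b u s := by
  unfold rowWt
  positivity

namespace IsGenSystem

variable {Q : Place K F} {n : ℕ} {P : Fin n → Place K F} {r : Fin n → K} {a : ℕ}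
    {x₁ : F} {y : ℕ → F} {b : ℕ → ℕ} {f : F} {φ : K[X]} {h : F} {m ℓ : ℕ}
    {G : Fin (a * (ℓ + 1)) → Fin (a * (ℓ + 1)) → K[X]}

theorem monWt_diag (hG : IsGenSystem Q P r a x₁ y b f φ h m ℓ G) (u : ℕ)
    (s : Fin (a * (ℓ + 1))) :
    monWt a (rowWt a b u) ((G s s).natDegree, s) =
      (m - min ((s : ℕ) / a) m : ℕ) * ((a : ℤ) * φ.natDegree) + b (s % a) + (s / a : ℕ) * u := by
  rw [hG.diag_eq, natDegree_pow]
  unfold monWt rowWt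
  push_cast
  ring

/-- Each factor `Z` replaced by `h` in expanding a power of `Z - h` trades weight `u` for at most
`H`. -/
theorem monWt_le (hG : IsGenSystem Q P r a x₁ y b f φ h m ℓ G) {H : ℤ}
    (hH : ((-H : ℤ) : WithTop ℤ) ≤ Q.val h) (u : ℕ) {s i : Fin (a * (ℓ + 1))} {d : ℕ}
    (hd : (G s i).coeff d ≠ 0) :
    (s : ℕ) / a - min ((s : ℕ) / a) m ≤ (i : ℕ) / a ∧ (i : ℕ) / a ≤ (s : ℕ) / a ∧
      monWt a (rowWt a b u) (d, i) ≤ monWt a (rowWt a b u) ((G s s).natDegree, s) +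
        ((s / a : ℕ) - (i / a : ℕ) : ℤ) * (H - u) := by
  obtain ⟨h1, h2, h3⟩ := hG.monomial_bound hH hG.val_f.ge hd
  refine ⟨h1, h2, ?_⟩
  rw [hG.monWt_diag]
  unfold monWt rowWt
  simp only
  linarith

theorem stageBound_of_le_weight (hG : IsGenSystem Q P r a x₁ y b f φ h m ℓ G) {u : ℕ}
    (hu : ((-(u : ℤ) : ℤ) : WithTop ℤ) ≤ Q.val h) (B : ℕ) (s : Fin (a * (ℓ + 1))) :
    StageBound a (rowWt a b u) G B s 0 := by
  refine stageBound_zero hG.basis.pos (rowWt_nonneg a b u) fun d i _ hd => ?_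
  have := (hG.monWt_le hu u hd).2.2
  simpa using this

/-- For `m = 0` the generators are the monomials `Z ^ k y_j` themselves. -/
theorem stageBound_of_multiplicity_zero (hG : IsGenSystem Q P r a x₁ y b f φ h 0 ℓ G)
    {H : ℤ} (hH : ((-H : ℤ) : WithTop ℤ) ≤ Q.val h) {u : ℕ} (B : ℕ) (s : Fin (a * (ℓ + 1))) :
    StageBound a (rowWt a b u) G B s 0 := by
  refine stageBound_zero hG.basis.pos (rowWt_nonneg a b u) fun d i _ hd => ?_
  obtain ⟨h1, h2, h3⟩ := hG.monWt_le hH u hd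
  rw [Nat.min_zero, Nat.sub_zero] at h1
  rw [le_antisymm h2 h1] at h3
  simpa using h3

/-- The steps in the stage of the row `s`. -/
theorem step_bound (hG : IsGenSystem Q P r a x₁ y b f φ h m ℓ G) {H u : ℕ} (huH : u < H)
    (hH : ((-(H : ℤ) : ℤ) : WithTop ℤ) ≤ Q.val h) {s i j : Fin (a * (ℓ + 1))} {d : ℕ}
    (hd : (G s i).coeff d ≠ 0) {ε : ℤ}
    (hle : ε * (a * (ℓ + 1) : ℕ) + (j : ℕ) ≤ (monWt a (rowWt a b u) (d, i) -
      monWt a (rowWt a b u) ((G s s).natDegree, s)) * (a * (ℓ + 1) : ℕ) + (i : ℕ)) :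
    ε ≤ (min ((s : ℕ) / a) m : ℕ) * (H - u) ∧
      (ε = (min ((s : ℕ) / a) m : ℕ) * (H - u) → j ≤ i ∧
        (i : ℕ) / a = s / a - min ((s : ℕ) / a) m) := by
  obtain ⟨h1, h2, h3⟩ := hG.monWt_le hH u hd
  set δ := monWt a (rowWt a b u) (d, i) - monWt a (rowWt a b u) ((G s s).natDegree, s) with hδ
  have hN := i.2
  have hj := j.2
  set k' := min ((s : ℕ) / a) m with hk'
  have hk'le : k' ≤ (s : ℕ) / a := min_le_left _ _
  have h4 : δ ≤ (((s / a : ℕ) : ℤ) - (i / a : ℕ)) * (H - u) := by omega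
  have hHu : (1 : ℤ) ≤ H - u := by omega
  have h5 : ε ≤ δ := by
    by_contra hcon
    have : (δ + 1) * ((a * (ℓ + 1) : ℕ) : ℤ) ≤ ε * (a * (ℓ + 1) : ℕ) := by
      gcongr
      omega
    rw [add_mul, one_mul] at this
    omega
  -- The lowest power of `Z` in the generator is `Z ^ (k - k')`. Only this power can attain the
  -- extreme value of `ε`, and then ties restrict the index.
  have h6 : (((s / a : ℕ) : ℤ) - (i / a : ℕ)) ≤ k' := by omega
  have h7 : (((s / a : ℕ) : ℤ) - (i / a : ℕ)) * ((H : ℤ) - u) ≤ k' * (H - u) := by gcongr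
  refine ⟨by omega, fun heq => ?_⟩
  have h8 : ε = δ := by omega
  rw [h8] at hle
  refine ⟨by rw [Fin.le_def]; omega, ?_⟩
  by_contra hne
  have h9 : (((s / a : ℕ) : ℤ) - (i / a : ℕ)) ≤ k' - 1 := by omega
  have h10 : (((s / a : ℕ) : ℤ) - (i / a : ℕ)) * ((H : ℤ) - u) ≤ (k' - 1) * (H - u) := by gcongr
  have h11 : ((k' : ℤ) - 1) * (H - u) = k' * (H - u) - (H - u) := by ring
  linarith

/-- A factor `f` may weigh `H + 1` rather than `H`, which accounts for the final summand `m`. -/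
theorem wtLE (hG : IsGenSystem Q P r a x₁ y b f φ h m ℓ G) {H u : ℕ} (huH : u < H)
    (hH : ((-(H : ℤ) : ℤ) : WithTop ℤ) ≤ Q.val h) (hφ : a * φ.natDegree ≤ H + 1) (hmℓ : m ≤ ℓ)
    {β : ℕ} (hβ : ∀ j < a, b j ≤ β) (s : Fin (a * (ℓ + 1))) :
    WtLE a (rowWt a b u) (G s) ((β + m * H + u * (ℓ - m) + m : ℕ) : ℤ) := by
  intro d i hd
  obtain ⟨h1, h2, h3⟩ := hG.monWt_le hH u hd
  rw [hG.monWt_diag] at h3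
  refine h3.trans ?_
  have h4 := hβ _ (Nat.mod_lt (s : ℕ) hG.basis.pos)
  have h5 := hG.div_le s
  set k := (s : ℕ) / a with hk
  set c := min k m with hc
  have hck : c ≤ k := min_le_left _ _
  have hcm : c ≤ m := min_le_right _ _
  have hkc : k - c ≤ ℓ - m := by omega
  have e1 : ((k : ℤ) - (i / a : ℕ)) * ((H : ℤ) - u) ≤ c * (H - u) := by
    gcongr <;> omega
  have e2 : ((m - c : ℕ) : ℤ) * ((a : ℤ) * φ.natDegree) ≤ (m - c : ℕ) * ((H : ℤ) + 1) := by
    gcongr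
    exact_mod_cast hφ
  have e3 : ((k - c : ℕ) : ℤ) * u ≤ (ℓ - m : ℕ) * u := by gcongr
  push_cast [Nat.cast_sub hcm, Nat.cast_sub hck, Nat.cast_sub hmℓ] at *
  have h4' : (b (s % a) : ℤ) ≤ β := by exact_mod_cast h4
  have : (0 : ℤ) ≤ c := by positivity
  nlinarith

/-- The `b_j` are distinct modulo `a`, so for given `ε` the congruence admits at most one coordinate
in each block. There are about `s / a` blocks, at most `(s + 1) / 2`, and this factor one half
absorbs the crude cost of a step. -/
theorem stageBound_of_two_le (hG : IsGenSystem Q P r a x₁ y b f φ h m ℓ G) (ha : 2 ≤ a)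
    {H u : ℕ} (huH : u < H) (hH : ((-(H : ℤ) : ℤ) : WithTop ℤ) ≤ Q.val h)
    {M : ℕ} (hM : m * H + a ≤ M + 1) (s : Fin (a * (ℓ + 1))) :
    StageBound a (rowWt a b u) G ((M + m : ℕ) : ℤ) s ((M : ℚ) ^ 2 * (a : ℚ)⁻¹ * ((s + 1 : ℕ) : ℚ) ^ 2) := by
  classical
  intro Λ hΛ _
  have ha0 := hG.basis.pos
  set k' := min ((s : ℕ) / a) m with hk'
  set Δ : ℤ := k' * (H - u) with hΔ
  set S : Finset (ℤ × Fin (a * (ℓ + 1))) := (Finset.Icc 1 Δ ×ˢ Finset.Iio s).filter fun x =>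
    (a : ℤ) ∣ x.1 + rowWt a b u s - rowWt a b u x.2 with hS
  set c : ℕ := 1 + (s + 1) * ((M + m) / a + 1) with hc
  refine ⟨S, fun _ => c, fun ε j hε hj hdvd d i hd hle => ?_, fun j hj v D hv hD hr _ => ?_, ?_⟩
  · rw [hS, Finset.mem_filter, Finset.mem_product, Finset.mem_Icc, Finset.mem_Iio]
    exact ⟨⟨⟨hε, (hG.step_bound huH hH hd hle).1⟩, hj⟩, hdvd⟩
  · exact Nat.add_le_add_left
      (scaleCost_le_mul ha0 (rowWt_nonneg a b u) hv (hD.trans (hΛ j hj).1) hr) 1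
  · rw [Finset.sum_const, smul_eq_mul]
    have hΔ0 : 0 ≤ Δ := mul_nonneg (by positivity) (by omega)
    have hdiv : ∀ x ∈ S, (x.1, ((x.2 : ℕ) / a)) ∈
        Finset.Icc 1 Δ ×ˢ Finset.range (((s : ℕ) - 1) / a + 1) := by
      intro x hx
      rw [hS, Finset.mem_filter, Finset.mem_product, Finset.mem_Iio, Fin.lt_def] at hx
      rw [Finset.mem_product, Finset.mem_range, Nat.lt_succ_iff]
      exact ⟨hx.1.1, Nat.div_le_div_right (by omega)⟩
    have hcard : S.card ≤ Δ.toNat * (((s : ℕ) - 1) / a + 1) := by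
      refine (Finset.card_le_card_of_injOn (fun x => (x.1, ((x.2 : ℕ) / a))) (fun x hx => hdiv x hx) ?_).trans ?_
      · rintro ⟨ε, i⟩ hx ⟨ε', i'⟩ hx' heq
        rw [Finset.mem_coe, hS, Finset.mem_filter] at hx hx'
        simp only [Prod.mk.injEq] at heq
        obtain ⟨rfl, hdiv⟩ := heq
        have h1 := dvd_sub hx'.2 hx.2
        simp only [rowWt] at h1
        rw [hdiv] at h1
        have h2 : ((b (i % a) : ℕ) : ℤ) ≡ (b (i' % a) : ℕ) [ZMOD a] := by
          apply Int.ModEq.symm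
          rw [Int.modEq_iff_dvd]
          refine (dvd_of_eq rfl).trans (h1.trans (dvd_of_eq ?_))
          ring
        have h3 : i % a ≡ i' % a [MOD a] := ((hG.basis.b_mod _).symm.trans
          (Int.natCast_modEq_iff.mp h2)).trans (hG.basis.b_mod _)
        have h4 : (i : ℕ) % a = i' % a := by
          have : (i : ℕ) % a % a = i' % a % a := h3
          simpa using this
        refine Prod.ext rfl (Fin.ext ?_)
        have h5 := Nat.mod_add_div (i : ℕ) a
        have h6 := Nat.mod_add_div (i' : ℕ) a
        rw [hdiv, h4] at h5
        exact h5.symm.trans h6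
      · rw [Finset.card_product, Int.card_Icc, Finset.card_range, add_sub_cancel_right]
    rcases Nat.eq_zero_or_pos Δ.toNat with hz | hpos
    · rw [hz, Nat.zero_mul] at hcard
      rw [Nat.le_zero.mp hcard, Nat.zero_mul, Nat.cast_zero]
      positivity
    have hk1 : 1 ≤ (s : ℕ) / a := by
      by_contra hcon
      have hk0 : k' = 0 := by
        rw [hk', Nat.lt_one_iff.mp (not_le.mp hcon), Nat.zero_min]
      rw [hΔ, hk0, Nat.cast_zero, zero_mul] at hpos
      simp at hpos
    have hsa : a ≤ (s : ℕ) := by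
      have := Nat.div_mul_le_self (s : ℕ) a
      nlinarith
    have hhalf : 2 * (((s : ℕ) - 1) / a + 1) ≤ s + 1 := by
      have h1 : ((s : ℕ) - 1) / a ≤ ((s : ℕ) - 1) / 2 := Nat.div_le_div_left ha two_pos
      omega
    have hΔM : Δ.toNat ≤ m * H := by
      rw [Int.toNat_le, hΔ]
      push_cast
      refine mul_le_mul ?_ (by omega) (by omega) (by positivity)
      exact_mod_cast min_le_right _ _
    have hcq : (a : ℚ) * c ≤ a + (s + 1) * (M + m + a) := by
      have h1 : (a : ℕ) * c ≤ a + (s + 1) * (M + m + a) := by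
        have := Nat.mul_div_le (M + m) a
        rw [hc]
        nlinarith
      exact_mod_cast h1
    have hmM : m ≤ m * H := Nat.le_mul_of_pos_right _ (by omega)
    -- The number of steps contributes `M - 1` and the cost `2(M + 1)`. Their product is `2(M ^ 2 -
    -- 1)`.
    have hprod : 2 * (a : ℚ) * (S.card * c : ℕ) ≤ 2 * (M : ℚ) ^ 2 * ((s + 1 : ℕ) : ℚ) ^ 2 := by
      have e1 : (2 * S.card : ℚ) ≤ (M - 1) * (s + 1) := by
        have h1 : 2 * S.card + (s + 1) ≤ M * (s + 1) := by
          have : Δ.toNat + 1 ≤ M := by omega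
          nlinarith
        have h2 : (2 * S.card + (s + 1) : ℚ) ≤ M * (s + 1) := by exact_mod_cast h1
        linarith
      have e2 : (a : ℚ) * c ≤ (s + 1) * (2 * M + 2) := by
        have h1 : (M + m + a : ℚ) ≤ 2 * M + 1 := by
          have : M + m + a ≤ 2 * M + 1 := by omega
          exact_mod_cast this
        have h2 : (a : ℚ) ≤ s + 1 := by
          have : a ≤ (s : ℕ) + 1 := by omega
          exact_mod_cast this
        have h3 : ((s : ℚ) + 1) * (M + m + a) ≤ (s + 1) * (2 * M + 1) := by gcongr
        linarith
      have hM1 : (1 : ℚ) ≤ M := by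
        have : 1 ≤ M := by omega
        exact_mod_cast this
      calc 2 * (a : ℚ) * (S.card * c : ℕ) = (2 * S.card) * (a * c) := by push_cast; ring
        _ ≤ ((M - 1) * (s + 1)) * ((s + 1) * (2 * M + 2)) := by
          refine mul_le_mul e1 e2 (by positivity) ?_
          have : (0 : ℚ) ≤ M - 1 := by linarith
          positivity
        _ ≤ 2 * (M : ℚ) ^ 2 * ((s + 1 : ℕ) : ℚ) ^ 2 := by
          push_cast
          have : (0 : ℚ) ≤ ((s : ℚ) + 1) ^ 2 := by positivity
          nlinarith
    have ha' : (0 : ℚ) < a := by exact_mod_cast ha0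
    rw [mul_right_comm, ← div_eq_mul_inv, le_div_iff₀ ha']
    linarith

end IsGenSystem

end Curves

/-! ### Costs and leading weights for `a₁ = 1` -/

section AlgorithmG

variable {K : Type*} [Field K] {N : ℕ}

theorem stageBound_first {ux : ℤ} {w : Fin N → ℤ} {g : Fin N → Fin N → K[X]} {B : ℤ} {r : Fin N}
    (hr : (r : ℕ) = 0) : StageBound ux w g B r 0 := by
  have h : ∀ s : Fin N, ¬ s < r := fun s hs => by
    rw [Fin.lt_def] at hs
    omega
  exact fun Λ _ _ => ⟨∅, 0, fun ε s _ hs => absurd hs (h s), fun s hs => absurd hs (h s), by simp⟩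

theorem StageBound.mono {ux : ℤ} {w : Fin N → ℤ} {g : Fin N → Fin N → K[X]} {B : ℤ} {r : Fin N}
    {C C' : ℚ} (h : StageBound ux w g B r C) (hC : C ≤ C') : StageBound ux w g B r C' := by
  intro Λ h1 h2
  obtain ⟨S, c, h3, h4, h5⟩ := h Λ h1 h2
  exact ⟨S, c, h3, h4, h5.trans hC⟩

theorem sum_ite_le_fin (r : Fin N) (c : ℕ) : (∑ i : Fin N, if i ≤ r then c else 0) = (r + 1) * c := by
  rw [← Finset.sum_filter, Finset.sum_const, card_filter_le_fin, smul_eq_mul]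

theorem sum_ite_lt_fin (r : Fin N) (c : ℕ) : (∑ i : Fin N, if i < r then c else 0) = r * c := by
  have : (Finset.univ.filter fun i : Fin N => i < r) = Finset.Iio r := by ext; simp
  rw [← Finset.sum_filter, Finset.sum_const, this, Fin.card_Iio, smul_eq_mul]

/-- The number of multiplications in a step, when the basis of the ring has a single element. -/
theorem scaleCost_le_of_weight {u : ℕ} {w : Fin N → ℤ} (hw : ∀ i : Fin N, w i = (i : ℕ) * (u : ℤ))
    {v : Fin N → K[X]} {r i : Fin N} (hir : i < r) {D : ℕ} (hv : IsLeadMon 1 w v (D, i)) {L : ℕ}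
    (hL : monWt 1 w (D, i) ≤ L) (hr : ∀ j, r < j → v j = 0)
    (hvr : ∀ d, (v r).coeff d ≠ 0 → monWt 1 w (d, r) + 2 ≤ monWt 1 w (D, i)) :
    1 + scaleCost v ≤ (r + 1) * L + i + 2 ∧
      (1 ≤ L → 1 + scaleCost v ≤ (r + 1) * L + i + 1) ∧
      (1 ≤ u → 1 + scaleCost v ≤ (r + 1) * L + 2) := by
  set W := D + i * u with hW
  have hmon : ∀ (d : ℕ) (j : Fin N), monWt 1 w (d, j) = ((d + j * u : ℕ) : ℤ) := by
    intro d j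
    simp only [monWt, hw]
    push_cast
    ring
  rw [hmon, ← hW] at hL hvr
  have hWL : W ≤ L := by exact_mod_cast hL
  have hc : ∀ j, v j ≠ 0 → (v j).coeff (v j).natDegree ≠ 0 := fun j hj => by
    rwa [coeff_natDegree, leadingCoeff_ne_zero]
  have h1 : ∀ j, v j ≠ 0 → (v j).natDegree + j * u ≤ W := fun j hj => by
    have := hv.monWt_le one_pos (hc j hj)
    rw [hmon, hmon] at this
    exact_mod_cast this
  have h2 : ∀ j, i < j → v j ≠ 0 → (v j).natDegree + j * u < W := fun j hij hj => by
    have := hv.monWt_lt (hc j hj) hij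
    rw [hmon, hmon] at this
    exact_mod_cast this
  have h3 : v r ≠ 0 → (v r).natDegree + r * u + 2 ≤ W := fun hj => by
    have := hvr _ (hc r hj)
    rw [hmon] at this
    exact_mod_cast this
  have hle : ∀ j, v j ≠ 0 → j ≤ r := fun j hj => not_lt.mp fun hlt => hj (hr j hlt)
  -- Coordinates up to `i` may reach the full weight `W`, those between `i` and `r` stay strictly
  -- below it by the tie rule, and coordinate `r` stays below it by two.
  have hcost : scaleCost v ≤ r * W + (W - 1) + (i + 1) := by
    have : scaleCost v ≤ ∑ j : Fin N, ((if j < r then W else 0) + (if j = r then W - 1 else 0) +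
        (if j ≤ i then 1 else 0)) := by
      refine scaleCost_le_sum fun j hj => ?_
      have e1 := h1 j hj
      rcases (hle j hj).lt_or_eq with hlt | rfl
      · rw [if_pos hlt, if_neg hlt.ne]
        by_cases hji : j ≤ i
        · rw [if_pos hji]
          omega
        · have := h2 j (not_le.mp hji) hj
          rw [if_neg hji]
          omega
      · have := h3 hj
        rw [if_pos rfl]
        omega
    refine this.trans (le_of_eq ?_)
    rw [Finset.sum_add_distrib, Finset.sum_add_distrib, sum_ite_le_fin, sum_ite_lt_fin,
      Finset.sum_ite_eq' Finset.univ r, if_pos (Finset.mem_univ r), mul_one]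
  have hrW : (r : ℕ) * W ≤ r * L := Nat.mul_le_mul_left _ hWL
  refine ⟨?_, fun hL1 => ?_, fun hu => ?_⟩
  · rw [Nat.add_mul]
    omega
  · rw [Nat.add_mul]
    omega
  -- For `u ≥ 1` every basis vector but the first has positive weight, so only coordinate `0` can
  -- have `W + 1` coefficients.
  · have : scaleCost v ≤ ∑ j : Fin N, ((if j ≤ r then W else 0) +
        (if j = ⟨0, i.pos⟩ then 1 else 0)) := by
      refine scaleCost_le_sum fun j hj => ?_
      have e1 := h1 j hj
      rw [if_pos (hle j hj)]
      by_cases hj0 : j = ⟨0, i.pos⟩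
      · rw [if_pos hj0]
        omega
      · rw [if_neg hj0]
        have : 1 ≤ (j : ℕ) := Nat.one_le_iff_ne_zero.mpr fun h0 => hj0 (Fin.ext h0)
        have : 1 ≤ (j : ℕ) * u := Nat.mul_pos this hu
        omega
    rw [Finset.sum_add_distrib, sum_ite_le_fin, Finset.sum_ite_eq' Finset.univ,
      if_pos (Finset.mem_univ _)] at this
    rw [Nat.add_mul] at this ⊢
    omega

end AlgorithmG

section Curves

variable {K F : Type*} [Field K] [Field F] [Algebra K F]

namespace IsGenSystem

variable {Q : Place K F} {n : ℕ} {P : Fin n → Place K F} {r : Fin n → K}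
    {x₁ : F} {y : ℕ → F} {b : ℕ → ℕ} {f : F} {φ : K[X]} {h : F} {m ℓ : ℕ}
    {G : Fin (1 * (ℓ + 1)) → Fin (1 * (ℓ + 1)) → K[X]}

theorem rowWt_one (hG : IsGenSystem Q P r 1 x₁ y b f φ h m ℓ G) (u : ℕ)
    (i : Fin (1 * (ℓ + 1))) : rowWt 1 b u i = (i : ℕ) * (u : ℤ) := by
  simp [rowWt, Nat.mod_one, hG.basis.b_zero]

/-- Passes from valuations at `Q` to coordinates: when `a = 1` the pole order of a coefficient is
the degree of its single coordinate. The bound `k < s` places the vector in the span of the earlier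
rows. -/
theorem exists_isLeadMon_of_isLead (hG : IsGenSystem Q P r 1 x₁ y b f φ h m ℓ G) {u k c : ℕ}
    {d : ℤ} {A : F[X]} {s i : Fin (1 * (ℓ + 1))} (hA : A ∈ interpolationModule Q P r m k)
    (hk : k < s) (hlead : IsLead Q u A c d) (hi : (i : ℕ) = c) :
    ∃ v ∈ Submodule.span K[X] (G '' Set.Iio s), ∃ e,
      IsLeadMon 1 (rowWt 1 b u) v (e, i) ∧ monWt 1 (rowWt 1 b u) (e, i) = d := by
  have hs := s.2
  obtain ⟨v, rfl⟩ := hG.basis.exists_ofCoords (ℓ := ℓ) (hA.1.trans (by omega)) hA.2.1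
  have hmem := hG.mem_span_of_interp (interp_mono hA (by omega)) (hA.1.trans_lt hk)
  have hset : {i : Fin (1 * (ℓ + 1)) | (i : ℕ) < 1 * (s : ℕ)} = Set.Iio s := by
    ext j
    rw [Set.mem_ofPred_eq, Set.mem_Iio, Fin.lt_def]
    omega
  rw [hset] at hmem
  have hcoeff : ∀ j : Fin (1 * (ℓ + 1)), (ofCoords 1 x₁ y v).coeff j = aeval x₁ (v j) * y 0 := by
    intro j
    rw [coeff_ofCoords one_pos]
    have hbl := block_div_mod one_pos v j
    simp only [Nat.div_one, Nat.mod_one] at hbl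
    rw [← hbl]
    simp [comb]
  have hval : ∀ j : Fin (1 * (ℓ + 1)), v j ≠ 0 →
      Q.val ((ofCoords 1 x₁ y v).coeff j) = ((-((v j).natDegree : ℤ) : ℤ) : WithTop ℤ) := by
    intro j hj
    rw [hcoeff, val_mul_eq Q.val (hG.basis.val_aeval hj) (hG.basis.y_val 0), hG.basis.b_zero]
    congr 1
    push_cast
    ring
  have hmon : ∀ (e : ℕ) (j : Fin (1 * (ℓ + 1))), monWt 1 (rowWt 1 b u) (e, j) = e + j * u := by
    intro e j
    simp only [monWt, hG.rowWt_one, mul_one]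
  have hlc := hlead.eq
  rw [← hi] at hlc
  have hvi : v i ≠ 0 := by
    intro h0
    rw [hcoeff, h0, map_zero, zero_mul, Q.val.map_zero] at hlc
    exact WithTop.top_ne_coe hlc
  rw [hval i hvi, WithTop.coe_inj] at hlc
  refine ⟨v, hmem, (v i).natDegree, ⟨?_, fun q hq => ?_⟩, by rw [hmon]; omega⟩
  · rwa [coeff_natDegree, leadingCoeff_ne_zero]
  · obtain ⟨e, j⟩ := q
    simp only at hq
    have hvj : v j ≠ 0 := fun h0 => hq (by rw [h0, coeff_zero])
    have hej := le_natDegree_of_ne_zero hq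
    have h1 := hlead.le j
    rw [hval j hvj, WithTop.coe_le_coe] at h1
    have hqw := hmon e j
    have hpw := hmon (v i).natDegree i
    unfold MonLT
    unfold monWt at hqw hpw
    simp only at hqw hpw ⊢
    rw [hqw, hpw]
    rcases lt_trichotomy j i with hji | rfl | hji
    · rcases (show (e : ℤ) + j * u ≤ (v i).natDegree + i * u by omega).lt_or_eq with hlt | heq
      · exact Or.inr (Or.inl hlt)
      · exact Or.inr (Or.inr ⟨heq, hji⟩)
    · rcases hej.lt_or_eq with hlt | rfl
      · right
        left
        omega
      · exact Or.inl rfl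
    · have h2 := hlead.lt j (by rw [← hi]; exact hji)
      rw [hval j hvj, WithTop.coe_lt_coe] at h2
      right
      left
      omega

/-- The witness is `f ^ α (Z - h) ^ β A ^ γ Z ^ δ` with `A` from `exists_lead_one`. Multiplicities,
`Z`-degrees and leading weights all add. -/
theorem exists_isLeadMon_of_exponents (hG : IsGenSystem Q P r 1 x₁ y b f φ h m ℓ G) {u H : ℕ}
    (hn : φ.natDegree ≤ n) (hH : Q.val h = ((-(H : ℤ) : ℤ) : WithTop ℤ)) (huH : u < H)
    {s i : Fin (1 * (ℓ + 1))} (α β γ δ : ℕ) (hm : α + β + γ = m) (hi : (i : ℕ) = γ + δ)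
    (hs : β + γ + δ < s) :
    ∃ v ∈ Submodule.span K[X] (G '' Set.Iio s), ∃ e,
      IsLeadMon 1 (rowWt 1 b u) v (e, i) ∧ monWt 1 (rowWt 1 b u) (e, i) =
        (α * φ.natDegree + β * H + γ * max (n - 1) u + δ * u : ℕ) := by
  obtain ⟨A, hA, hAl⟩ := hG.exists_lead_one rfl hn u
  have hf : C f ∈ interpolationModule Q P r 1 0 :=
    interp_C hG.zeros.mem fun i => (hG.zeros.val_one i).ge
  have hmem := interp_mul (interp_mul (interp_mul (interp_pow hf α)
    (interp_pow (interp_X_sub_C hG.h_mem hG.h_val) β)) (interp_pow hA γ)) (interp_pow interp_X δ)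
  have hlead := (((((IsLead.const (u := u) hG.val_f).pow α).mul
    ((IsLead.X_sub_C hH (by exact_mod_cast huH)).pow β)).mul (hAl.pow γ))).mul
    ((IsLead.X (Q := Q) (u := u)).pow δ)
  have e1 : α * 1 + β * 1 + γ * 1 + δ * 0 = m := by omega
  have e2 : α * 0 + β * 1 + γ * 1 + δ * 1 = β + γ + δ := by omega
  rw [e1, e2] at hmem
  obtain ⟨v, hv, e, he, hw⟩ := hG.exists_isLeadMon_of_isLead hmem hs hlead (i := i) (by omega)
  refine ⟨v, hv, e, he, hw.trans ?_⟩
  push_cast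
  ring

/-- One of the `m` linear factors `A` is replaced by the quadratic element of `exists_lead_two`,
which saves one unit of weight. -/
theorem exists_isLeadMon_of_lead_two (hG : IsGenSystem Q P r 1 x₁ y b f φ h m ℓ G)
    (hn : φ.natDegree ≤ n) (h2n : 2 ≤ n) (hm : 1 ≤ m)
    (hh : Q.val h = ((-((n : ℤ) - 1) : ℤ) : WithTop ℤ)) {s i : Fin (1 * (ℓ + 1))} (hmi : m < i)
    (his : i < s) :
    ∃ v ∈ Submodule.span K[X] (G '' Set.Iio s), ∃ e,
      IsLeadMon 1 (rowWt 1 b 0) v (e, i) ∧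
        monWt 1 (rowWt 1 b 0) (e, i) = m * ((n : ℤ) - 1) - 1 := by
  obtain ⟨A, hA, hAl⟩ := hG.exists_lead_one rfl hn 0
  obtain ⟨A', hA', hAl'⟩ := hG.exists_lead_two rfl hn h2n hh
  obtain ⟨m, rfl⟩ : ∃ k, m = k + 1 := ⟨m - 1, by omega⟩
  have hmem := interp_mul (interp_mul (interp_pow hA m) hA')
    (interp_pow interp_X ((i : ℕ) - (m + 1) - 1))
  have hlead := ((hAl.pow m).mul hAl').mul ((IsLead.X (Q := Q) (u := 0)).pow
    ((i : ℕ) - (m + 1) - 1))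
  have e1 : m * 1 + 1 + ((i : ℕ) - (m + 1) - 1) * 0 = m + 1 := by omega
  have e2 : m * 1 + 2 + ((i : ℕ) - (m + 1) - 1) * 1 = i := by omega
  rw [e1, e2] at hmem
  obtain ⟨v, hv, e, he, hw⟩ := hG.exists_isLeadMon_of_isLead hmem his hlead (i := i) (by omega)
  refine ⟨v, hv, e, he, hw.trans ?_⟩
  push_cast [Nat.cast_sub (show 1 ≤ n by omega)]
  rw [max_eq_left (by omega)]
  ring

/-- The number of steps of a stage, each weighted by a bound for its cost. -/
theorem stageBound_of_cost (hG : IsGenSystem Q P r 1 x₁ y b f φ h m ℓ G) {H u : ℕ} (huH : u < H)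
    (hH : ((-(H : ℤ) : ℤ) : WithTop ℤ) ≤ Q.val h) (B : ℤ) {s : Fin (1 * (ℓ + 1))}
    (L : Fin (1 * (ℓ + 1)) → ℕ)
    (hL : ∀ i < s, ∃ v ∈ Submodule.span K[X] (G '' Set.Iio s), ∃ e,
      IsLeadMon 1 (rowWt 1 b u) v (e, i) ∧ monWt 1 (rowWt 1 b u) (e, i) ≤ L i)
    (c : ℕ) (x : Fin (1 * (ℓ + 1)) → ℕ)
    (hc : ∀ i < s, ∀ z : ℕ, z ≤ (s + 1) * L i + i + 2 →
      (1 ≤ L i → z ≤ (s + 1) * L i + i + 1) → (1 ≤ u → z ≤ (s + 1) * L i + 2) → z ≤ c + x i)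
    {C : ℚ} (hC : (((min (s : ℕ) m * (H - u) - 1) * s + (s - min (s : ℕ) m + 1)) * c +
      (min (s : ℕ) m * (H - u) - 1 + 1) * ∑ i ∈ Finset.Iio s, x i : ℕ) ≤ C) :
    StageBound 1 (rowWt 1 b u) G B s C := by
  classical
  intro Λ hΛ hmin
  set k' := min (s : ℕ) m with hk'
  set Δ := k' * (H - u) with hΔ
  -- Labels with the extreme `ε = Δ` come only from the power `Z ^ (s - k')`, which limits their
  -- coordinate.
  set T := (Finset.Iio s).filter fun i : Fin (1 * (ℓ + 1)) => (i : ℕ) ≤ s - k' with hT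
  have hdisj : Disjoint (Finset.Icc (1 : ℤ) (Δ - 1 : ℕ) ×ˢ Finset.Iio s) ({(Δ : ℤ)} ×ˢ T) := by
    rw [Finset.disjoint_left]
    rintro ⟨ε, i⟩ h1 h2
    rw [Finset.mem_product, Finset.mem_Icc] at h1
    rw [Finset.mem_product, Finset.mem_singleton] at h2
    have := h1.1
    have := h2.1
    simp only at *
    omega
  refine ⟨Finset.Icc (1 : ℤ) (Δ - 1 : ℕ) ×ˢ Finset.Iio s ∪ {(Δ : ℤ)} ×ˢ T, fun i => c + x i,
    fun ε j hε hj _ d i hd hle => ?_, fun i hi v D hv hD hr hvr => ?_, ?_⟩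
  · have hb := hG.step_bound huH hH hd hle
    simp only [Nat.div_one] at hb
    rw [← hk', show ((k' : ℤ) * ((H : ℤ) - u)) = (Δ : ℤ) by
      rw [hΔ, Nat.cast_mul, Nat.cast_sub huH.le]] at hb
    rw [Finset.mem_union, Finset.mem_product, Finset.mem_product, Finset.mem_Icc, Finset.mem_Iio,
      Finset.mem_singleton, hT, Finset.mem_filter, Finset.mem_Iio]
    simp only
    rcases hb.1.lt_or_eq with hlt | heq
    · left
      exact ⟨⟨hε, by omega⟩, hj⟩
    · right
      obtain ⟨h1, h2⟩ := hb.2 heq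
      exact ⟨heq, hj, by rw [Fin.le_def] at h1; omega⟩
  · obtain ⟨v', hv', e, he, hwt⟩ := hL i hi
    have hlam : monWt 1 (rowWt 1 b u) (D, i) ≤ L i := hD.trans ((hmin i hi v' hv' e he).trans hwt)
    obtain ⟨h1, h2, h3⟩ := scaleCost_le_of_weight (hG.rowWt_one u) hi hv hlam hr hvr
    exact hc i hi _ h1 h2 h3
  · refine le_trans ?_ hC
    rw [Nat.cast_le, Finset.sum_union hdisj, Finset.sum_product, Finset.sum_product]
    simp only
    rw [Finset.sum_const, Int.card_Icc, Finset.sum_singleton, smul_eq_mul]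
    have hcardT : T.card ≤ s - k' + 1 := by
      have : T.card ≤ (Finset.range ((s : ℕ) - k' + 1)).card := by
        refine Finset.card_le_card_of_injOn (fun i => (i : ℕ)) (fun i hi => ?_)
          (fun i _ j _ hij => Fin.ext hij)
        rw [Finset.mem_coe, hT, Finset.mem_filter] at hi
        simp only [Finset.coe_range, Set.mem_Iio]
        omega
      rwa [Finset.card_range] at this
    have hsum : ∑ i ∈ Finset.Iio s, (c + x i) = s * c + ∑ i ∈ Finset.Iio s, x i := by
      rw [Finset.sum_add_distrib, Finset.sum_const, Fin.card_Iio, smul_eq_mul]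
    have hsumT : ∑ i ∈ T, (c + x i) ≤ (s - k' + 1) * c + ∑ i ∈ Finset.Iio s, x i := by
      rw [Finset.sum_add_distrib, Finset.sum_const, smul_eq_mul]
      exact add_le_add (Nat.mul_le_mul_right _ hcardT)
        (Finset.sum_le_sum_of_subset (Finset.filter_subset _ _))
    have hcast : (((Δ - 1 : ℕ) : ℤ) + 1 - 1).toNat = Δ - 1 := by omega
    rw [hsum, hcast]
    calc _ ≤ (Δ - 1) * (s * c + ∑ i ∈ Finset.Iio s, x i) +
          ((s - k' + 1) * c + ∑ i ∈ Finset.Iio s, x i) := Nat.add_le_add_left hsumT _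
      _ = _ := by ring

end IsGenSystem

end Curves

/-! ### Arithmetic of the stage bounds for `a₁ = 1` -/

theorem steps_le_mul {Δ s k : ℕ} (hΔ : 1 ≤ Δ) (hk : 1 ≤ k) (hks : k ≤ s) :
    (Δ - 1) * s + (s - k + 1) ≤ Δ * s := by
  obtain ⟨Δ, rfl⟩ := Nat.exists_eq_add_of_le' hΔ
  rw [Nat.add_sub_cancel, Nat.add_mul]
  omega

/-- The extra term is needed: for `k = m = H = 1` the left side is `5`, while the main term is `4`.
-/
theorem low_stage_arith {k m H : ℕ} (hk : 1 ≤ k) (hkm : k ≤ m) (hH : 1 ≤ H) :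
    ((k * H - 1) * k + 1) * ((k + 1) * (m * H + (m - k + 1)) + k) ≤
      (m * H) ^ 2 * (k + 1) ^ 2 + if k = 1 then (m * H) ^ 2 else 0 := by
  -- Writing each variable as its least value plus a natural number gives a difference with
  -- nonnegative coefficients.
  obtain ⟨t, rfl⟩ := Nat.exists_eq_add_of_le hkm
  obtain ⟨z, rfl⟩ := Nat.exists_eq_add_of_le hH
  have hkH : 1 ≤ k * (1 + z) := Nat.mul_pos hk (by omega)
  rw [Nat.add_sub_cancel_left]
  split_ifs with h1
  · subst h1
    zify [hkH]
    rw [← sub_nonneg]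
    ring_nf
    positivity
  · obtain ⟨p, rfl⟩ : ∃ p, k = 2 + p := Nat.exists_eq_add_of_le (by omega)
    zify [hkH]
    rw [← sub_nonneg]
    ring_nf
    positivity

theorem high_stage_arith {s m A X : ℕ} (hm : 1 ≤ m) (hms : m < s) (hA : m ≤ A)
    (hX : 2 * X ≤ (m + 1) * (m + 2)) :
    ((A - 1) * s + (s - m + 1)) * ((s + 1) * A) + A * X ≤ A ^ 2 * (s + 1) ^ 2 := by
  obtain ⟨p, rfl⟩ := Nat.exists_eq_add_of_lt hms
  obtain ⟨q, rfl⟩ := Nat.exists_eq_add_of_le hA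
  obtain ⟨m, rfl⟩ := Nat.exists_eq_add_of_le' hm
  have e1 : m + 1 + q - 1 = m + q := by omega
  have e2 : m + 1 + p + 1 - (m + 1) + 1 = p + 2 := by omega
  rw [e1, e2]
  have h1 : (m + 1 + q) * (2 * X) ≤ (m + 1 + q) * ((m + 1 + 1) * (m + 1 + 2)) :=
    Nat.mul_le_mul_left _ hX
  suffices h : 2 * (((m + q) * (m + 1 + p + 1) + (p + 2)) * ((m + 1 + p + 1 + 1) * (m + 1 + q))) +
      (m + 1 + q) * ((m + 1 + 1) * (m + 1 + 2)) ≤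
      2 * ((m + 1 + q) ^ 2 * (m + 1 + p + 1 + 1) ^ 2) by linarith
  zify
  rw [← sub_nonneg]
  ring_nf
  positivity

theorem sum_Iio_fin {N : ℕ} (s : Fin N) (g : ℕ → ℕ) :
    ∑ i ∈ Finset.Iio s, g i = ∑ i ∈ Finset.range s, g i := by
  have h := Fin.map_valEmbedding_Iio s
  rw [Nat.Iio_eq_range] at h
  rw [← h, Finset.sum_map]
  rfl

theorem two_mul_sum_range_ite_le (s m : ℕ) :
    2 * ∑ i ∈ Finset.range s, (if i ≤ m then i + 1 else 0) ≤ (m + 1) * (m + 2) := by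
  have h1 : ∑ i ∈ Finset.range s, (if i ≤ m then i + 1 else 0) ≤
      ∑ i ∈ Finset.range (m + 1), (i + 1) := by
    rw [← Finset.sum_filter]
    refine Finset.sum_le_sum_of_subset fun i hi => ?_
    rw [Finset.mem_filter] at hi
    exact Finset.mem_range.mpr (by omega)
  have h2 : ∀ k : ℕ, 2 * ∑ i ∈ Finset.range k, (i + 1) = k * (k + 1) := by
    intro k
    induction k with
    | zero => rfl
    | succ k ih =>
      rw [Finset.sum_range_succ, mul_add, ih]
      ring
  have h3 := h2 (m + 1)
  linarith

/-! ### The stage bounds for `a₁ = 1` -/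

section Curves

variable {K F : Type*} [Field K] [Field F] [Algebra K F]

/-- The cost allotted to a stage when the basis of the ring has a single element. -/
def stageBudget (M s : ℕ) : ℕ :=
  if s = 0 then 0 else M ^ 2 * (s + 1) ^ 2 + if s = 1 then M ^ 2 else 0

/-- The first stage has no steps, so its share `M ^ 2` is available to the second one. -/
theorem sum_stageBudget_le (M N : ℕ) :
    ∑ s ∈ Finset.range N, stageBudget M s ≤ M ^ 2 * ∑ s ∈ Finset.range N, (s + 1) ^ 2 := by
  have h : ∀ N, ∑ s ∈ Finset.range (N + 1), stageBudget M s + (if N = 0 then M ^ 2 else 0) =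
      M ^ 2 * ∑ s ∈ Finset.range (N + 1), (s + 1) ^ 2 := by
    intro N
    induction N with
    | zero => simp [stageBudget]
    | succ N ih =>
      rw [Finset.sum_range_succ, Finset.sum_range_succ _ (N + 1), mul_add, ← ih, stageBudget,
        if_neg N.succ_ne_zero, if_neg N.succ_ne_zero]
      by_cases hN : N = 0
      · simp [hN]
        ring
      · simp [hN]
  rcases N with _ | N
  · simp
  · rw [← h]
    exact Nat.le_add_right _ _

theorem stageBudget_mono {M M' s : ℕ} (h : M ≤ M') : stageBudget M s ≤ stageBudget M' s := by
  unfold stageBudget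
  split_ifs
  · exact le_rfl
  · gcongr
  · gcongr

theorem le_stageBudget {M s : ℕ} (hs : 1 ≤ s) : M ^ 2 * (s + 1) ^ 2 ≤ stageBudget M s := by
  unfold stageBudget
  rw [if_neg (by omega)]
  exact Nat.le_add_right _ _

namespace IsGenSystem

variable {Q : Place K F} {n : ℕ} {P : Fin n → Place K F} {r : Fin n → K}
    {x₁ : F} {y : ℕ → F} {b : ℕ → ℕ} {f : F} {φ : K[X]} {h : F} {m ℓ : ℕ}
    {G : Fin (1 * (ℓ + 1)) → Fin (1 * (ℓ + 1)) → K[X]}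

/-- With `n < H`, the products `f ^ (m-c) A ^ c Z ^ (i-c)`, `c = min(i, m)`, save one unit of weight
per factor. Hence all leading weights are at most `M - 1`, and a step costs at most `(s + 1)M`. -/
theorem stageBound_of_lt (hG : IsGenSystem Q P r 1 x₁ y b f φ h m ℓ G) (hn : φ.natDegree ≤ n)
    (hm : 1 ≤ m) {u H H' : ℕ} (hh : Q.val h = ((-(H' : ℤ) : ℤ) : WithTop ℤ)) (huH' : u < H')
    (hH' : H' ≤ H) (hnH : n < H) {M : ℕ} (hM : m * H + u * (ℓ - m) ≤ M) (B : ℤ)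
    {s : Fin (1 * (ℓ + 1))} (hs : 1 ≤ (s : ℕ)) :
    StageBound 1 (rowWt 1 b u) G B s (stageBudget M s : ℕ) := by
  have huH : u < H := by omega
  have hmH : m ≤ m * H := Nat.le_mul_of_pos_right _ (by omega)
  have hsℓ := s.2
  refine hG.stageBound_of_cost huH (by rw [hh, WithTop.coe_le_coe]; omega) B (fun _ => M - 1)
    (fun i hi => ?_) ((s + 1) * M) 0 (fun i hi z hz _ _ => ?_) ?_
  · rw [Fin.lt_def] at hi
    have hmax : max (n - 1) u ≤ H - 1 := by omega
    obtain ⟨v, hv, e, he, hw⟩ := hG.exists_isLeadMon_of_exponents hn hh huH' (s := s) (i := i)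
      (m - min (i : ℕ) m) 0 (min (i : ℕ) m) (i - min (i : ℕ) m) (by omega) (by omega) (by omega)
    refine ⟨v, hv, e, he, hw.le.trans ?_⟩
    rw [Nat.cast_le]
    set c := min (i : ℕ) m with hc
    have hcm : c ≤ m := min_le_right _ _
    have e1 : (m - c) * φ.natDegree ≤ (m - c) * (H - 1) := Nat.mul_le_mul_left _ (by omega)
    have e2 : c * max (n - 1) u ≤ c * (H - 1) := Nat.mul_le_mul_left _ hmax
    have e3 : (i - c) * u ≤ (ℓ - m) * u := Nat.mul_le_mul_right _ (by omega)
    have e4 : (m - c) * (H - 1) + c * (H - 1) = m * (H - 1) := by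
      rw [← Nat.add_mul, Nat.sub_add_cancel hcm]
    have e5 : m * (H - 1) + m = m * H := by
      rw [← Nat.mul_succ, Nat.succ_eq_add_one, Nat.sub_add_cancel (by omega)]
    have e6 : (ℓ - m) * u = u * (ℓ - m) := Nat.mul_comm _ _
    omega
  · rw [Fin.lt_def] at hi
    obtain ⟨M, rfl⟩ : ∃ k, M = k + 1 := ⟨M - 1, by omega⟩
    rw [Nat.add_sub_cancel] at hz
    rw [Nat.mul_succ]
    simp only [Pi.zero_apply]
    omega
  · rw [Nat.cast_le]
    refine le_trans ?_ (le_stageBudget hs)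
    set k := min (s : ℕ) m with hk
    have hk1 : 1 ≤ k := by omega
    have hΔ : 1 ≤ k * (H - u) := Nat.mul_pos hk1 (by omega)
    have hΔM : k * (H - u) ≤ M :=
      (Nat.mul_le_mul (min_le_right _ _) (Nat.sub_le H u)).trans (by omega)
    have h1 := steps_le_mul hΔ hk1 (min_le_left (s : ℕ) m)
    have h2 : k * (H - u) * s ≤ M * (s + 1) := Nat.mul_le_mul hΔM (Nat.le_succ _)
    simp only [Pi.zero_apply, Finset.sum_const_zero, mul_zero, add_zero]
    calc _ ≤ (M * (s + 1)) * ((s + 1) * M) := Nat.mul_le_mul_right _ (h1.trans h2)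
      _ = _ := by ring

/-- Only `Z`-degrees below `s ≤ m` are allowed, which forces `m - s + 1` factors `f`, of weight up
to `H + 1` each. This explains the excess over `mH`. The small number of top labels compensates for
it. -/
theorem stageBound_of_le_multiplicity (hG : IsGenSystem Q P r 1 x₁ y b f φ h m ℓ G)
    (hn : φ.natDegree ≤ n) {u H H' : ℕ} (hh : Q.val h = ((-(H' : ℤ) : ℤ) : WithTop ℤ))
    (huH' : u < H') (hH' : H' ≤ H) (hnH : n = H + 1) (B : ℤ)
    {s : Fin (1 * (ℓ + 1))} (hs : 1 ≤ (s : ℕ)) (hsm : (s : ℕ) ≤ m) :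
    StageBound 1 (rowWt 1 b u) G B s (stageBudget (m * H) s : ℕ) := by
  have huH : u < H := by omega
  refine hG.stageBound_of_cost huH (by rw [hh, WithTop.coe_le_coe]; omega) B
    (fun _ => m * H + (m - s + 1)) (fun i hi => ?_) ((s + 1) * (m * H + (m - s + 1)) + s) 0
    (fun i hi z _ hz _ => ?_) ?_
  · rw [Fin.lt_def] at hi
    obtain ⟨v, hv, e, he, hw⟩ := hG.exists_isLeadMon_of_exponents hn hh huH' (s := s) (i := i)
      (m - s + 1) (s - 1 - i) i 0 (by omega) (by omega) (by omega)
    refine ⟨v, hv, e, he, hw.le.trans ?_⟩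
    rw [Nat.cast_le, Nat.zero_mul, Nat.add_zero]
    have e1 : (m - s + 1) * φ.natDegree ≤ (m - s + 1) * (H + 1) := Nat.mul_le_mul_left _ (by omega)
    have e2 : (s - 1 - i) * H' ≤ (s - 1 - i) * H := Nat.mul_le_mul_left _ hH'
    have e3 : (i : ℕ) * max (n - 1) u ≤ i * H := Nat.mul_le_mul_left _ (by omega)
    have e4 : (m - s + 1) * (H + 1) + (s - 1 - i) * H + i * H = m * H + (m - s + 1) := by
      have : m - s + 1 + (s - 1 - i) + i = m := by omega
      have e5 : (m - s + 1 + (s - 1 - i) + i) * H = m * H := by rw [this]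
      rw [Nat.mul_succ, ← e5]
      ring
    omega
  · rw [Fin.lt_def] at hi
    have := hz (by omega)
    simp only [Pi.zero_apply]
    omega
  · rw [Nat.cast_le, stageBudget, if_neg (by omega), min_eq_left hsm, Nat.sub_self, Nat.zero_add]
    simp only [Pi.zero_apply, Finset.sum_const_zero, mul_zero, add_zero]
    refine le_trans ?_ (low_stage_arith hs hsm (by omega : 1 ≤ H))
    gcongr
    exact Nat.sub_le H u

/-- The vectors used in the stages after the block of the multiplicity. -/
theorem exists_isLeadMon_of_multiplicity_lt (hG : IsGenSystem Q P r 1 x₁ y b f φ h m ℓ G)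
    (hn : φ.natDegree ≤ n) {u H H' : ℕ} (hh : Q.val h = ((-(H' : ℤ) : ℤ) : WithTop ℤ))
    (huH' : u < H') (hH' : H' ≤ H) (hnH : n = H + 1) {s i : Fin (1 * (ℓ + 1))}
    (hsm : m < (s : ℕ)) (hi : i < s) :
    ∃ v ∈ Submodule.span K[X] (G '' Set.Iio s), ∃ e,
      IsLeadMon 1 (rowWt 1 b u) v (e, i) ∧
        monWt 1 (rowWt 1 b u) (e, i) ≤ ((m * H + u * (i - m) : ℕ) : ℤ) := by
  rw [Fin.lt_def] at hi
  obtain ⟨v, hv, e, he, hw⟩ := hG.exists_isLeadMon_of_exponents hn hh huH' (s := s) (i := i)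
    0 (m - min (i : ℕ) m) (min (i : ℕ) m) (i - min (i : ℕ) m) (by omega) (by omega) (by omega)
  refine ⟨v, hv, e, he, hw.le.trans ?_⟩
  rw [Nat.cast_le, Nat.zero_mul, Nat.zero_add]
  set c := min (i : ℕ) m with hc
  have hcm : c ≤ m := min_le_right _ _
  have e1 : (m - c) * H' ≤ (m - c) * H := Nat.mul_le_mul_left _ hH'
  have e2 : c * max (n - 1) u ≤ c * H := Nat.mul_le_mul_left _ (by omega)
  have e4 : (m - c) * H + c * H = m * H := by
    rw [← Nat.add_mul, Nat.sub_add_cancel hcm]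
  have e5 : (i : ℕ) - c = i - m := by omega
  rw [e5, Nat.mul_comm _ u]
  omega

/-- No factor `f` is needed here, so the leading weights are at most `mH + u(i-m)`. The remaining
slack comes from `u ≥ 1`, from `H' < H`, or, when `u = 0` and `H' = H`, from the quadratic element.
-/
theorem stageBound_of_multiplicity_lt (hG : IsGenSystem Q P r 1 x₁ y b f φ h m ℓ G)
    (hn : φ.natDegree ≤ n) (hm : 1 ≤ m) {u H H' : ℕ}
    (hh : Q.val h = ((-(H' : ℤ) : ℤ) : WithTop ℤ)) (huH' : u < H') (hH' : H' ≤ H)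
    (hnH : n = H + 1) {M : ℕ} (hM : m * H + u * (ℓ - m) ≤ M) (B : ℤ)
    {s : Fin (1 * (ℓ + 1))} (hsm : m < (s : ℕ)) :
    StageBound 1 (rowWt 1 b u) G B s (stageBudget M s : ℕ) := by
  have huH : u < H := by omega
  have hsℓ := s.2
  have hbound : ∀ i < s, ∃ v ∈ Submodule.span K[X] (G '' Set.Iio s), ∃ e,
      IsLeadMon 1 (rowWt 1 b u) v (e, i) ∧
        monWt 1 (rowWt 1 b u) (e, i) ≤ ((m * H + u * (i - m) : ℕ) : ℤ) := fun i hi =>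
    hG.exists_isLeadMon_of_multiplicity_lt hn hh huH' hH' hnH hsm hi
  have hmin : min (s : ℕ) m = m := min_eq_right hsm.le
  have hbudget : ∀ L : ℕ, L ≤ M → L ^ 2 * (s + 1) ^ 2 ≤ stageBudget M s := fun L hL =>
    (le_stageBudget (by omega)).trans (stageBudget_mono hL)
  rcases Nat.eq_zero_or_pos u with rfl | hu
  · simp only [Nat.zero_mul, Nat.add_zero] at hbound hM
    rcases hH'.lt_or_eq with hlt | rfl
    -- The true pole order of `h` is at most `H - 1`, which reduces the number of steps by a factor
    -- `(H - 1) / H`.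
    · refine hG.stageBound_of_cost (H := H - 1) (u := 0) (by omega)
        (by rw [hh, WithTop.coe_le_coe]; omega) B (fun _ => m * H) hbound
        ((s + 1) * (m * H + 1)) 0 (fun i hi z _ hz _ => ?_) ?_
      · rw [Fin.lt_def] at hi
        have := hz (Nat.mul_pos hm huH)
        simp only [Pi.zero_apply]
        rw [Nat.mul_succ]
        omega
      · rw [Nat.cast_le]
        refine le_trans ?_ (hbudget _ hM)
        rw [hmin, Nat.sub_zero]
        simp only [Pi.zero_apply, Finset.sum_const_zero, mul_zero, add_zero]
        have h1 := steps_le_mul (Δ := m * (H - 1)) (Nat.mul_pos hm (by omega)) hm hsm.le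
        refine (Nat.mul_le_mul_right _ h1).trans ?_
        obtain ⟨H, rfl⟩ : ∃ k, H = k + 1 := ⟨H - 1, by omega⟩
        rw [Nat.add_sub_cancel]
        calc m * H * s * ((s + 1) * (m * (H + 1) + 1))
            = m * s * (s + 1) * (H * (m * (H + 1) + 1)) := by ring
          _ ≤ m * (s + 1) * (s + 1) * (m * (H + 1) ^ 2) := by
            gcongr ?_ * ?_
            · gcongr
              omega
            · nlinarith
          _ = _ := by ring
    · refine hG.stageBound_of_cost (H := H') (u := 0) huH hh.ge B
        -- The quadratic element lowers the weights only for coordinates beyond `m`. The surcharge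
        -- `i + 1` for the others is summed separately.
        (fun i => if (i : ℕ) ≤ m then m * H' else m * H' - 1) (fun i hi => ?_) ((s + 1) * (m * H'))
        (fun i => if (i : ℕ) ≤ m then i + 1 else 0) (fun i hi z hz hz' _ => ?_) ?_
      · split_ifs with him
        · exact hbound i hi
        · have hpos : 1 ≤ m * H' := Nat.mul_pos hm huH
          obtain ⟨v, hv, e, he, hw⟩ := hG.exists_isLeadMon_of_lead_two hn (by omega) hm
            (by rw [hh, hnH]; congr 1; push_cast; ring) (not_le.mp him) hi
          refine ⟨v, hv, e, he, hw.le.trans ?_⟩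
          rw [hnH]
          push_cast [Nat.cast_sub hpos]
          linarith
      · rw [Fin.lt_def] at hi
        have hpos : 1 ≤ m * H' := Nat.mul_pos hm huH
        split_ifs at hz hz' ⊢
        · exact hz' hpos
        · obtain ⟨A, hA⟩ : ∃ A, m * H' = A + 1 := ⟨m * H' - 1, by omega⟩
          rw [hA, Nat.add_sub_cancel] at hz
          rw [hA, Nat.mul_succ]
          omega
      · rw [Nat.cast_le]
        refine le_trans ?_ (hbudget _ hM)
        have hpos : 1 ≤ m * H' := Nat.mul_pos hm huH
        rw [hmin, Nat.sub_zero, sum_Iio_fin s fun i => if i ≤ m then i + 1 else 0,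
          Nat.sub_add_cancel hpos]
        exact high_stage_arith hm hsm (Nat.le_mul_of_pos_right _ huH)
          (two_mul_sum_range_ite_le s m)
  · set L := m * H + u * (s - m) with hL
    have hLM : L ≤ M := le_trans (by rw [hL]; gcongr; omega) hM
    refine hG.stageBound_of_cost huH (by rw [hh, WithTop.coe_le_coe]; omega) B (fun _ => L)
      (fun i hi => ?_) ((s + 1) * L + 2) 0 (fun i hi z _ _ hz => by simpa using hz hu) ?_
    · obtain ⟨v, hv, e, he, hw⟩ := hbound i hi
      refine ⟨v, hv, e, he, hw.trans ?_⟩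
      rw [Nat.cast_le, hL]
      rw [Fin.lt_def] at hi
      gcongr
    · rw [Nat.cast_le]
      refine le_trans ?_ (hbudget _ hLM)
      rw [hmin]
      simp only [Pi.zero_apply, Finset.sum_const_zero, mul_zero, add_zero]
      have h1 := steps_le_mul (Δ := m * (H - u)) (Nat.mul_pos hm (by omega)) hm hsm.le
      -- A positive `u` makes the number of values of `ε` smaller than `L`, which pays for the extra
      -- `2` in the cost.
      have h2 : m * (H - u) + 1 ≤ L := by
        have e1 : m * (H - u) + 1 ≤ m * H := by
          have : m * (H - u) + m * u = m * H := by
            rw [← Nat.mul_add, Nat.sub_add_cancel huH.le]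
          have : 1 ≤ m * u := Nat.mul_pos hm hu
          omega
        omega
      refine (Nat.mul_le_mul_right _ h1).trans ?_
      obtain ⟨L', hL'⟩ : ∃ k, L = k + 1 := ⟨L - 1, by omega⟩
      rw [hL'] at h2 ⊢
      have hs1 : 1 ≤ (s : ℕ) := by omega
      calc m * (H - u) * s * ((s + 1) * (L' + 1) + 2)
          ≤ L' * s * ((s + 1) * (L' + 1) + 2) := by
            gcongr
            omega
        _ ≤ _ := by nlinarith [Nat.zero_le (L' * s), Nat.zero_le (s : ℕ)]

theorem stageBound_of_one (hG : IsGenSystem Q P r 1 x₁ y b f φ h m ℓ G)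
    (hn : φ.natDegree ≤ n) (hm : 1 ≤ m) {u g H H' : ℕ}
    (hh : Q.val h = ((-(H' : ℤ) : ℤ) : WithTop ℤ)) (huH' : u < H') (hH' : H' ≤ H)
    (hnH : n + 2 * g = H + 1) {M : ℕ} (hM : m * H + u * (ℓ - m) ≤ M) (B : ℤ)
    (s : Fin (1 * (ℓ + 1))) :
    StageBound 1 (rowWt 1 b u) G B s (stageBudget M s : ℕ) := by
  rcases Nat.eq_zero_or_pos (s : ℕ) with hs | hs
  · exact (stageBound_first hs).mono (by positivity)
  rcases Nat.eq_zero_or_pos g with rfl | hg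
  · rcases le_or_gt (s : ℕ) m with hsm | hsm
    · exact (hG.stageBound_of_le_multiplicity hn hh huH' hH' hnH B hs hsm).mono
        (Nat.cast_le.mpr (stageBudget_mono (by omega)))
    · exact hG.stageBound_of_multiplicity_lt hn hm hh huH' hH' hnH hM B hsm
  · exact hG.stageBound_of_lt hn hm hh huH' hH' (by omega) hM B hs

end IsGenSystem

end Curves

/-! ### Summation over the stages and the final assembly -/

theorem sum_Icc_sq (N : ℕ) :
    ∑ i ∈ Finset.Icc 1 N, (i : ℚ) ^ 2 = ∑ i ∈ Finset.range N, ((i + 1 : ℕ) : ℚ) ^ 2 := by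
  induction N with
  | zero => rfl
  | succ N ih => rw [Finset.sum_Icc_succ_top (by omega), Finset.sum_range_succ, ih]

section Curves

variable {K F : Type*} [Field K] [Field F] [Algebra K F]

namespace IsGenSystem

variable {Q : Place K F} {n : ℕ} {P : Fin n → Place K F} {r : Fin n → K} {a : ℕ}
    {x₁ : F} {y : ℕ → F} {b : ℕ → ℕ} {f : F} {φ : K[X]} {h : F} {m ℓ : ℕ}
    {G : Fin (a * (ℓ + 1)) → Fin (a * (ℓ + 1)) → K[X]}

theorem exists_stageBounds (hG : IsGenSystem Q P r a x₁ y b f φ h m ℓ G) {g : ℕ}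
    (hφ : a * φ.natDegree ≤ n)
    (hh : ((-((n : ℤ) + 2 * (g : ℤ) - 1) : ℤ) : WithTop ℤ) ≤ Q.val h) (hmℓ : m ≤ ℓ) (u : ℕ)
    {β : ℕ} (hβ : ∀ j < a, b j ≤ β) :
    ∃ (B : ℕ) (C : ℕ → ℚ), (∀ s, WtLE a (rowWt a b u) (G s) B) ∧
      (∀ s : Fin (a * (ℓ + 1)), StageBound a (rowWt a b u) G B s (C s)) ∧
      ∑ s ∈ Finset.range (a * (ℓ + 1)), C s ≤
        ((β + (m : ℤ) * ((n : ℤ) + 2 * g - 1) + (u : ℤ) * ((ℓ : ℤ) - m) : ℤ) : ℚ) ^ 2 *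
          (a : ℚ)⁻¹ * ∑ i ∈ Finset.range (a * (ℓ + 1)), ((i + 1 : ℕ) : ℚ) ^ 2 := by
  have ha0 := hG.basis.pos
  -- If no stage costs anything, the bound holds because its right side is nonnegative. Otherwise `m
  -- ≥ 1` and `h` has pole order `H' > u`, so `H = n + 2g - 1` is a natural number.
  by_cases hzero : ∀ (B : ℕ) s, StageBound a (rowWt a b u) G B s 0
  · obtain ⟨B, hB⟩ := exists_wtLE a (rowWt a b u) G
    refine ⟨B, fun _ => 0, hB, hzero B, ?_⟩
    rw [Finset.sum_const_zero]
    positivity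
  have hm : 1 ≤ m := by
    by_contra hm
    obtain rfl : m = 0 := by omega
    exact hzero fun B s => hG.stageBound_of_multiplicity_zero hh B s
  have hu : ¬ ((-(u : ℤ) : ℤ) : WithTop ℤ) ≤ Q.val h := fun hu =>
    hzero fun B s => hG.stageBound_of_le_weight hu B s
  have hh0 : h ≠ 0 := by
    rintro rfl
    simp at hu
  obtain ⟨k, hk⟩ := exists_val_eq Q.val hh0
  rw [hk, WithTop.coe_le_coe] at hh hu
  obtain ⟨H', rfl⟩ : ∃ H' : ℕ, k = -(H' : ℤ) := ⟨k.natAbs, by omega⟩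
  obtain ⟨H, hH⟩ : ∃ H : ℕ, (H : ℤ) = n + 2 * g - 1 := ⟨n + 2 * g - 1, by omega⟩
  have huH' : u < H' := by omega
  have hHH' : H' ≤ H := by omega
  have hhH : ((-(H : ℤ) : ℤ) : WithTop ℤ) ≤ Q.val h := by
    rw [hk, WithTop.coe_le_coe]
    omega
  have hM : (((β + (m : ℤ) * ((n : ℤ) + 2 * g - 1) + (u : ℤ) * ((ℓ : ℤ) - m) : ℤ) : ℚ)) =
      ((β + m * H + u * (ℓ - m) : ℕ) : ℚ) := by
    rw [← hH]
    push_cast [Nat.cast_sub hmℓ]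
    ring
  rw [hM]
  set M := β + m * H + u * (ℓ - m) with hMdef
  refine ⟨M + m, ?_⟩
  rcases (show a = 1 ∨ 2 ≤ a by omega) with rfl | ha
  · refine ⟨fun s => (stageBudget M s : ℕ), fun s => hG.wtLE (by omega) hhH (by omega) hmℓ hβ s,
      fun s => hG.stageBound_of_one (by omega) hm hk huH' hHH' (g := g) (by omega) (by omega) _ s,
      ?_⟩
    rw [Nat.cast_one, inv_one, mul_one]
    simp only
    exact_mod_cast sum_stageBudget_le M (1 * (ℓ + 1))
  -- The class of `a - 1` forces `b (a - 1) ≥ a - 1`, so `β` leaves the room of `a - 1` that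
  -- `stageBound_of_two_le` requires.
  · have hab : a ≤ β + 1 := by
      have h1 := hβ (a - 1) (by omega)
      have h2 : b (a - 1) % a = (a - 1) % a := hG.basis.b_mod (a - 1)
      rw [Nat.mod_eq_of_lt (by omega : a - 1 < a)] at h2
      have h3 := Nat.mod_le (b (a - 1)) a
      omega
    refine ⟨fun s => (M : ℚ) ^ 2 * (a : ℚ)⁻¹ * ((s + 1 : ℕ) : ℚ) ^ 2,
      fun s => hG.wtLE (by omega) hhH (by omega) hmℓ hβ s,
      fun s => hG.stageBound_of_two_le ha (by omega) hhH (by omega) s, ?_⟩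
    rw [Finset.mul_sum]

theorem algG (hG : IsGenSystem Q P r a x₁ y b f φ h m ℓ G) {g : ℕ}
    (hφ : a * φ.natDegree ≤ n)
    (hh : ((-((n : ℤ) + 2 * (g : ℤ) - 1) : ℤ) : WithTop ℤ) ≤ Q.val h) (hmℓ : m ≤ ℓ) (u : ℕ)
    {β : ℕ} (hβ : ∀ j < a, b j ≤ β) :
    ∃ τ, AlgGHaltsWith a (rowWt a b u) G τ ∧
      IsMinimalGroebnerBasis a (rowWt a b u)
        {v | ofCoords a x₁ y v ∈ interpolationModule Q P r m ℓ} τ.rows ∧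
      (τ.mults : ℚ) ≤
        ((β + (m : ℤ) * ((n : ℤ) + 2 * g - 1) + (u : ℤ) * ((ℓ : ℤ) - m) : ℤ) : ℚ) ^ 2 *
          (a : ℚ)⁻¹ * ∑ i ∈ Finset.Icc 1 (a * (ℓ + 1)), (i : ℚ) ^ 2 := by
  obtain ⟨B, C, hB, hC, hsum⟩ := hG.exists_stageBounds hφ hh hmℓ u hβ
  obtain ⟨τ, h1, h2, h3⟩ := algG_halts (by exact_mod_cast hG.basis.pos) hG.hasInd hB C hC
  rw [hG.span_eq] at h2
  rw [sum_Icc_sq]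
  exact ⟨τ, h1, h2, h3.trans hsum⟩

end IsGenSystem

end Curves

end AGInterp

theorem mainTheorem5 {K F : Type*} [Field K] [Finite K] [Field F] [Algebra K F]
    (hF : AGInterp.IsFunctionField K F)
    (g : ℕ) (hg : AGInterp.genus K F = (g : ℕ∞))
    -- the places of degree one
    (n : ℕ) (Q : AGInterp.Place K F) (P : Fin n → AGInterp.Place K F)
    (hQdeg : Q.degree = 1) (hPdeg : ∀ i, (P i).degree = 1)
    (hPinj : Function.Injective P) (hPQ : ∀ i, P i ≠ Q)
    -- generators of the Weierstrass semigroup and the functions that realize them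
    (t : ℕ) (a : Fin (t + 1) → ℕ) (ha : ∀ i, 0 < a i)
    (hgen : (AddSubmonoid.closure (Set.range a) : Set ℕ) = AGInterp.weierstrass Q)
    (x : Fin (t + 1) → F)
    (hx : ∀ i, AGInterp.HasPoleDivisor (x i) (Finsupp.single Q (a i : ℤ)))
    -- the assumption on `D = P_1 + ⋯ + P_n`
    (f : F) (hf : f ∈ AGInterp.regularAway Q)
    (hfD : AGInterp.HasZeroDivisor f (∑ i, Finsupp.single (P i) (1 : ℤ)))
    (hfx : f ∈ Algebra.adjoin K {x 0})
    -- the parameters, the received word, and its interpolating function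
    (u m ℓ : ℕ) (hmℓ : m ≤ ℓ) (r : Fin n → K)
    (h : F) (hh : h ∈ AGInterp.regularAway Q)
    (hhr : ∀ i, 0 < (P i).val (h - algebraMap K F (r i)))
    (hhQ : ((-((n : ℤ) + 2 * (g : ℤ) - 1) : ℤ) : WithTop ℤ) ≤ Q.val h) :
    let y : ℕ → F := AGInterp.basisElt Q a x
    let η : ℕ → ℕ → F := fun i j => f ^ i * y j
    let N : ℕ := a 0 * (ℓ + 1)
    let ux : ℤ := AGInterp.poleOrder Q (x 0)
    let w : Fin N → ℤ := fun s =>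
      AGInterp.poleOrder Q (y (s.1 % a 0)) + ((s.1 / a 0 : ℕ) : ℤ) * (u : ℤ)
    let toPoly : (Fin N → Polynomial K) → Polynomial F := AGInterp.ofCoords (a 0) (x 0) y
    (∀ i ≤ m, ∀ j < a 0,
      AGInterp.IsMinPole (-((i : ℤ) • ∑ k, Finsupp.single (P k) (1 : ℤ))) Q (a 0) j (η i j)) ∧
    ∃ G : Fin N → Fin N → Polynomial K,
      (∀ G' : Fin N → Fin N → Polynomial K,
        (∀ s : Fin N, toPoly (G' s) = AGInterp.generator (a 0) m η h s.1) ↔ G' = G) ∧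
      (∀ s : Fin N, AGInterp.HasInd (G s) s) ∧
      ∃ τ : AGInterp.GState K N,
        AGInterp.AlgGHaltsWith ux w G τ ∧
        AGInterp.IsMinimalGroebnerBasis ux w
          {v | toPoly v ∈ AGInterp.interpolationModule Q P r m ℓ} τ.rows ∧
        (τ.mults : ℚ) ≤
          (((⨆ j : Fin (a 0), AGInterp.poleOrder Q (y j.1)) + (m : ℤ) * ((n : ℤ) + 2 * g - 1) +
              (u : ℤ) * ((ℓ : ℤ) - m) : ℤ) : ℚ) ^ 2 * ((a 0 : ℕ) : ℚ)⁻¹ *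
            ∑ i ∈ Finset.Icc 1 (a 0 * (ℓ + 1)), (i : ℚ) ^ 2 := by
  intro y η N ux w toPoly
  have hB := AGInterp.isPoleBasis_basisElt hg hQdeg ha hgen hx
  have hZ := AGInterp.hasSimpleZeros_of_hasZeroDivisor hPinj hPQ hf hfD
  rw [Algebra.adjoin_singleton_eq_range_aeval] at hfx
  obtain ⟨φ, hφ⟩ := hfx
  refine ⟨fun i _ j _ => hB.isMinPole hPinj hPQ hZ hφ i j, ?_⟩
  have hex : ∀ s : Fin N, ∃ v : Fin N → Polynomial K,
      toPoly v = AGInterp.generator (a 0) m η h s.1 := by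
    intro s
    have hs : s.1 / a 0 ≤ ℓ :=
      Nat.lt_succ_iff.mp ((Nat.div_lt_iff_lt_mul (ha 0)).mpr (s.2.trans_eq (mul_comm _ _)))
    have hmem := AGInterp.generator_mem_interp hPQ hZ hh hhr hB.y_mem (a 0) m s.1
    exact hB.exists_ofCoords (hmem.1.trans hs) hmem.2.1
  choose G hGen using hex
  have hG : AGInterp.IsGenSystem Q P r (a 0) (x 0) y (AGInterp.residueMin Q (a 0)) f φ h m ℓ G :=
    ⟨hB, hPQ, hZ, hφ, hh, hhr, hGen⟩
  -- The left side is the pole order of `f`, which is at most its number `n` of zeros.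
  have hdeg : a 0 * φ.natDegree ≤ n := by
    have h1 := hZ.le_val hg hQdeg hPdeg hPinj hPQ
    rw [hG.val_f, WithTop.coe_le_coe] at h1
    zify
    omega
  have hy : ∀ j, AGInterp.poleOrder Q (y j) = AGInterp.residueMin Q (a 0) j :=
    fun j => AGInterp.poleOrder_eq (hB.y_val j)
  have hsup : ∀ j < a 0, (AGInterp.residueMin Q (a 0) j : ℤ) ≤
      ⨆ j : Fin (a 0), AGInterp.poleOrder Q (y j.1) := by
    intro j hj
    rw [← hy]
    exact le_ciSup (f := fun j : Fin (a 0) => AGInterp.poleOrder Q (y j.1))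
      (Set.finite_range _).bddAbove ⟨j, hj⟩
  -- The supremum of pole orders is an integer and dominates `b_0 ≥ 0`, so it can be handled as a
  -- natural number.
  obtain ⟨β, hβ⟩ := Int.eq_ofNat_of_zero_le
    ((Int.natCast_nonneg _).trans (hsup 0 (ha 0)))
  have hux : ux = (a 0 : ℤ) := AGInterp.poleOrder_eq hB.x_val
  have hw : w = AGInterp.rowWt (a 0) (AGInterp.residueMin Q (a 0)) u := by
    funext s
    simp only [w, AGInterp.rowWt, hy]
  refine ⟨G, fun G' => ⟨fun hG' => ?_, fun hG' => ?_⟩, hG.hasInd, ?_⟩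
  · funext s
    exact hB.ofCoords_injective ((hG' s).trans (hGen s).symm)
  · rw [hG']
    exact hGen
  · rw [hux, hw, hβ]
    refine hG.algG hdeg hhQ hmℓ u fun j hj => ?_
    have := hsup j hj
    rw [hβ] at this
    exact_mod_cast this
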